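/- **Setting.** Let $L,d\ge 1$, $m\ge 0$ be integers, $n=2^m$, $N=Ln$. A kernel on a set $S$ is a symmetric function $K:S\times S\to\mathbb R$ with $\sum_{i,j}c_ic_jK(x_i,x_j)>0$ for finitely many distinct $x_i\in S$ and coefficients $c_i\in\mathbb R$ that are not all zero. Let $R$ be a kernel on $\{1,\dots,L\}$, $Q$ a kernel on $[0,1)^d$, and $K((\ell,x),(\ell',x'))=R(\ell,\ell')Q(x,x')$. Let $\xi_1,\dots,\xi_L\ge 0$ be noise variances. For points $x_{\ell i}\in[0,1)^d$ ($1\le\ell\le L$, $0\le i<n$) let $\widetilde{\mathsf K}\in\mathbb R^{N\times N}$ be the matrix with entries $K((\ell,x_{\ell i}),(\ell',x_{\ell' i'}))+\xi_\ell\,\delta_{\ell\ell'}\delta_{ii'}$. Write $i=\sum_p \mathsf i_p2^p$ in binary, $v(i)=\sum_p\mathsf i_p2^{-p-1}$, and let $\oplus$ be the digitwise exclusive or of binary expansions. Suppose one of the following. * (SI-LAT) $Q(x,x')=\widehat Q((x-x')\bmod 1)$ for some function $\widehat Q$, and $x_{\ell i}=(v(i)g+\Delta_\ell)\bmod 1$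 for some $g\in\mathbb N_0^d$ and $\Delta_1,\dots,\Delta_L\in[0,1)^d$. Put $(\mathsf V_m)_{ik}=n^{-1/2}e^{2\pi\mathrm i\,v(i)k}$, so that $\mathsf V_m^{*}$ is the bit-reversal permutation followed by the unitary discrete Fourier transform. * (DSI-DSEQ) $Q(x,x')=\widehat Q(x\oplus x')$ for some function $\widehat Q$, and $x_{\ell i}=\bigoplus_p\mathsf i_p g_p\oplus\Delta_\ell$ for some $g_0,g_1,\dots\in[0,1)^d$ and $\Delta_1,\dots,\Delta_L\in[0,1)^d$. Binary expansions that end in an infinite tail of ones are excluded: the identity for $Q$ is required only where the digitwise exclusive or of $x$ and $x'$ is not of this kind, and the digitwise exclusive ors that define the $x_{\ell i}$ and the $x_{\ell i}\oplus x_{\ell' i'}$ ($i,i'<n$) are assumed not to be of this kind. Put $(\mathsf V_m)_{ik}=n^{-1/2}(-1)^{\sum_p\mathsf i_p\mathsf k_p}$, the normalised Walsh–Hadamard matrix. Let $\mathsf V=\mathrm{diag}(\mathsf V_m,\dots,\mathsf V_m)$ ($L$ blocks) and $\widetilde{\mathsf\Lambda}=\mathsf V^{*}\widetilde{\mathsf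 K}\mathsf V$. **Cost model.** Computations are counted for straight-line programs on registers that hold complex numbers: loading a constant, copying, negation, conjugation, reciprocal, addition, subtraction and multiplication cost $1$ each, and one evaluation of $K$ at two collocation points costs $q\le c\,d$. Storage is the number of registers used. The constants in $\mathcal O(\cdot)$ depend only on $c$, and the programs depend only on $L$, $m$ and on which of the two cases holds. **Claim.** $\mathsf V$ is unitary, $\widetilde{\mathsf K}=\mathsf V\widetilde{\mathsf\Lambda}\mathsf V^{*}$, and $\widetilde{\mathsf\Lambda}$ is an $L\times L$ block matrix with diagonal $n\times n$ blocks (stored by the $L^2n$ diagonal entries of its blocks). With the explicit programs built on the radix-2 fast Fourier, respectively fast Walsh–Hadamard, transform: 1. Evaluating $\widetilde{\mathsf\Lambda}$, each block being $\sqrt n\,\mathsf V_m^{*}$ applied to the zeroth column of the corresponding block of $\widetilde{\mathsf K}$, requires $\mathcal O(L^2(n\log n+dn))$ computations and $\mathcal O(L^2n)$ storage. 2. Having evaluated $\widetilde{\mathsf\Lambda}$, computing $\widetilde{\mathsf K}y=\mathsf V\widetilde{\mathsf\Lambda}\mathsf V^{*}y$ for any $y\in\mathbb R^N$ requires $\mathcal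 O(Ln\log n+L^2n)$ computations. Assume moreover that for every task $\ell$ either $\xi_\ell>0$ or the points $x_{\ell 0},\dots,x_{\ell,n-1}$ are distinct. Then $\widetilde{\mathsf K}$ and $\widetilde{\mathsf\Lambda}$ are nonsingular, and: 3. Having evaluated $\widetilde{\mathsf\Lambda}$, evaluating $|\widetilde{\mathsf K}|=|\widetilde{\mathsf\Lambda}|$ and $\widetilde{\mathsf\Lambda}^{-1}$ (which again has diagonal $n\times n$ blocks) requires $\mathcal O(L^3n)$ computations and $\mathcal O(L^2n)$ storage with the following algorithm, in which no division by zero occurs. Start with $\mathsf A=\widetilde{\mathsf\Lambda}_{11}^{-1}$ and $\varrho=|\widetilde{\mathsf\Lambda}_{11}|$. For $\ell=2,\dots,L$ let $\mathsf D=\widetilde{\mathsf\Lambda}_{\ell\ell}$, let $\mathsf B$ consist of the blocks of block column $\ell$ above $\mathsf D$, and compute $\mathsf L=\mathsf A\mathsf B$, $\mathsf S=\mathsf D-\mathsf B^{*}\mathsf L$, $\varrho\leftarrow\varrho|\mathsf S|$, $\mathsf G=\mathsf S^{-1}$, $\mathsf H=\mathsf L\mathsf G$, $\mathsf M=\mathsf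 A+\mathsf H\mathsf L^{*}$, $\mathsf A\leftarrow\begin{pmatrix}\mathsf M&-\mathsf H\\-\mathsf H^{*}&\mathsf G\end{pmatrix}$. The result is $\widetilde{\mathsf\Lambda}^{-1}=\mathsf A$, $|\widetilde{\mathsf\Lambda}|=\varrho$. 4. Having stored $\widetilde{\mathsf\Lambda}^{-1}$, computing $\widetilde{\mathsf K}^{-1}y=\mathsf V\widetilde{\mathsf\Lambda}^{-1}\mathsf V^{*}y$ for any $y\in\mathbb R^N$ requires $\mathcal O(Ln\log n+L^2n)$ computations. -/

import Mathlib

namespace FastMTGP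

/-! ### Kernels -/

/-- The half-open unit cube `[0,1)^d`. -/
def cube (d : ℕ) : Set (Fin d → ℝ) := {x | ∀ j, x j ∈ Set.Ico (0 : ℝ) 1}

/-- `K` is a symmetric positive definite kernel on the set `S`: it is symmetric, and every quadratic
form on finitely many distinct points is positive at every nonzero coefficient vector. -/
def IsSPDOn {α : Type*} (S : Set α) (K : α → α → ℝ) : Prop :=
  (∀ x ∈ S, ∀ y ∈ S, K x y = K y x) ∧
    ∀ (n : ℕ) (x : Fin n → α) (c : Fin n → ℝ), (∀ i, x i ∈ S) → Function.Injective x → c ≠ 0 →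
      0 < ∑ i, ∑ j, c i * c j * K (x i) (x j)

/-- Shift-invariant kernels on `[0,1)^d`. -/
def IsSI {d : ℕ} (Q : (Fin d → ℝ) → (Fin d → ℝ) → ℝ) : Prop :=
  ∃ Qhat : (Fin d → ℝ) → ℝ, ∀ x ∈ cube d, ∀ y ∈ cube d, Q x y = Qhat fun j => Int.fract (x j - y j)

/-- The digit sequence `a` does not end in an infinite tail of ones. -/
def NoOnesTail (a : ℕ → Fin 2) : Prop := ¬ ∃ P, ∀ p ≥ P, a p = 1

/-- Digitwise exclusive or of the binary expansions of two numbers of `[0,1)`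
(addition in `Fin 2` is addition modulo 2). -/
noncomputable def xorDigits (a b : ℝ) : ℕ → Fin 2 := fun p => Real.digits a 2 p + Real.digits b 2 p

/-- The operator `a ⊕ b` on `[0,1)`. -/
noncomputable def dxor (a b : ℝ) : ℝ := Real.ofDigits (xorDigits a b)

/-- Digitally-shift-invariant kernels on `[0,1)^d`: `Q x y` is a function of `x ⊕ y`. Binary expansions
are not allowed to end in an infinite tail of ones, so the identity is only required at those `x`, `y`
whose digitwise exclusive or is such an expansion. -/
def IsDSI {d : ℕ} (Q : (Fin d → ℝ) → (Fin d → ℝ) → ℝ) : Prop :=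
  ∃ Qhat : (Fin d → ℝ) → ℝ, ∀ x ∈ cube d, ∀ y ∈ cube d,
    (∀ j, NoOnesTail (xorDigits (x j) (y j))) → Q x y = Qhat fun j => dxor (x j) (y j)

/-! ### Point sequences -/

/-- The van der Corput sequence in base 2 (`Nat.size i` is the number of binary digits of `i`). -/
noncomputable def vdc (i : ℕ) : ℝ :=
  ∑ p ∈ Finset.range (Nat.size i), if i.testBit p then ((2 : ℝ) ^ (p + 1))⁻¹ else 0

/-- The shifted rank-1 lattice in radical-inverse order with generating vector `g` and shift `Δ`. -/
noncomputable def latticePt {d : ℕ} (g : Fin d → ℕ) (Δ : Fin d → ℝ) (i : ℕ) : Fin d → ℝ :=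
  fun j => Int.fract (vdc i * g j + Δ j)

/-- Binary digits of coordinate `j` of the point number `i` of the digitally-shifted digital sequence
with generating columns `g 0, g 1, …` and digital shift `Δ`: the exclusive or of the digits of `Δ j`
with those of the `g p j` for which the binary digit number `p` of `i` is one. -/
noncomputable def dseqDigits {d : ℕ} (g : ℕ → Fin d → ℝ) (Δ : Fin d → ℝ) (i : ℕ) (j : Fin d) :
    ℕ → Fin 2 :=
  fun q => (∑ p ∈ Finset.range (Nat.size i), if i.testBit p then Real.digits (g p j) 2 q else 0)
    + Real.digits (Δ j) 2 q

/-- The digitally-shifted base-2 digital sequence in radical-inverse order. -/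
noncomputable def dseqPt {d : ℕ} (g : ℕ → Fin d → ℝ) (Δ : Fin d → ℝ) (i : ℕ) : Fin d → ℝ :=
  fun j => Real.ofDigits (dseqDigits g Δ i j)

/-- The two flavours of fast multitask Gaussian processes: SI-LAT and DSI-DSEQ. -/
inductive Flavour
  | lattice
  | digital

/-- Spatial kernel and collocation points `x_{ℓ i}` (`i < 2 ^ m`) of a fast multitask Gaussian process
with `2 ^ m` points per task; generating vector or columns are common, shifts may differ by task. -/
def IsFastDesign {L d : ℕ} (m : ℕ) (Q : (Fin d → ℝ) → (Fin d → ℝ) → ℝ)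
    (X : Fin L → ℕ → Fin d → ℝ) : Flavour → Prop
  | .lattice => IsSI Q ∧ ∃ (g : Fin d → ℕ) (Δ : Fin L → Fin d → ℝ),
      (∀ l, Δ l ∈ cube d) ∧ ∀ l, ∀ i < 2 ^ m, X l i = latticePt g (Δ l) i
  | .digital => IsDSI Q ∧ ∃ (g : ℕ → Fin d → ℝ) (Δ : Fin L → Fin d → ℝ),
      (∀ p, g p ∈ cube d) ∧ (∀ l, Δ l ∈ cube d) ∧
      (∀ l, ∀ i < 2 ^ m, X l i = dseqPt g (Δ l) i) ∧
      -- no binary expansion that occurs ends in an infinite tail of ones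
      (∀ l, ∀ i < 2 ^ m, ∀ j, NoOnesTail (dseqDigits g (Δ l) i j)) ∧
      (∀ l l', ∀ i < 2 ^ m, ∀ i' < 2 ^ m, ∀ j, NoOnesTail (xorDigits (X l i j) (X l' i' j)))

/-- The fast multitask Gaussian process condition with task kernel `R`, spatial kernel `Q`, noise
variances `ξ`, collocation points `X` and `2 ^ m` points for every task. -/
structure Condition {L d : ℕ} (fl : Flavour) (m : ℕ) (R : Fin L → Fin L → ℝ)
    (Q : (Fin d → ℝ) → (Fin d → ℝ) → ℝ) (ξ : Fin L → ℝ) (X : Fin L → ℕ → Fin d → ℝ) : Prop where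
  taskKernel : IsSPDOn Set.univ R
  spatialKernel : IsSPDOn (cube d) Q
  noise : ∀ l, 0 ≤ ξ l
  design : IsFastDesign m Q X fl

/-! ### Matrices -/

/-- The multitask product kernel at the collocation points number `i` of task `l` and number `i'` of
task `l'`. -/
def kernelAt {L d : ℕ} (R : Fin L → Fin L → ℝ) (Q : (Fin d → ℝ) → (Fin d → ℝ) → ℝ)
    (X : Fin L → ℕ → Fin d → ℝ) (l : Fin L) (i : ℕ) (l' : Fin L) (i' : ℕ) : ℝ :=
  R l l' * Q (X l i) (X l' i')

/-- The noisy Gram matrix, with entries in `ℂ`. -/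
noncomputable def gram {L d : ℕ} (m : ℕ) (R : Fin L → Fin L → ℝ)
    (Q : (Fin d → ℝ) → (Fin d → ℝ) → ℝ) (ξ : Fin L → ℝ) (X : Fin L → ℕ → Fin d → ℝ) :
    Matrix (Fin L × Fin (2 ^ m)) (Fin L × Fin (2 ^ m)) ℂ :=
  Matrix.of fun p q =>
    ((kernelAt R Q X p.1 p.2 q.1 q.2 + if p = q then ξ p.1 else 0 : ℝ) : ℂ)

/-- The unitary matrix `V_m`. For lattices `(V_m)ᴴ` is the bit-reversal permutation followed by the
discrete Fourier transform (`2 ^ m * vdc i` is the bit reversal of `i`); for digital sequences it is the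
Walsh–Hadamard transform; both normalised by `1 / √(2 ^ m)`. -/
noncomputable def transform (m : ℕ) : Flavour → Matrix (Fin (2 ^ m)) (Fin (2 ^ m)) ℂ
  | .lattice => Matrix.of fun i k =>
      ((√((2 : ℝ) ^ m))⁻¹ : ℂ) * Complex.exp (2 * Real.pi * Complex.I * vdc i * (k : ℕ))
  | .digital => Matrix.of fun i k =>
      ((√((2 : ℝ) ^ m))⁻¹ : ℂ) *
        ∏ p ∈ Finset.range m, if (i : ℕ).testBit p ∧ (k : ℕ).testBit p then -1 else 1

/-- `V = diag(V_m, …, V_m)`, with `L` blocks. -/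
noncomputable def bigV (fl : Flavour) (L m : ℕ) :
    Matrix (Fin L × Fin (2 ^ m)) (Fin L × Fin (2 ^ m)) ℂ :=
  Matrix.kronecker (1 : Matrix (Fin L) (Fin L) ℂ) (transform m fl)

/-- `Λ = Vᴴ K V`, where `K` is the noisy Gram matrix. -/
noncomputable def lambdaMat {L d : ℕ} (fl : Flavour) (m : ℕ) (R : Fin L → Fin L → ℝ)
    (Q : (Fin d → ℝ) → (Fin d → ℝ) → ℝ) (ξ : Fin L → ℝ) (X : Fin L → ℕ → Fin d → ℝ) :
    Matrix (Fin L × Fin (2 ^ m)) (Fin L × Fin (2 ^ m)) ℂ :=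
  (bigV fl L m).conjTranspose * gram m R Q ξ X * bigV fl L m

/-- The matrix whose block `(l, l')` is the `n × n` diagonal matrix with diagonal `a l l'`. -/
def ofDiagBlocks {L n : ℕ} (a : Fin L → Fin L → ℕ → ℂ) : Matrix (Fin L × Fin n) (Fin L × Fin n) ℂ :=
  Matrix.of fun p q => if p.2 = q.2 then a p.1 q.1 p.2 else 0

/-! ### Computational model: straight-line programs on registers that hold complex numbers -/

/-- Register names. `lam l l' k` and `inv l l' k` hold diagonal entry `k` of block `(l, l')` of `Λ` and of
its inverse, `xi l` holds the noise variance of task `l`, `vec l k` and `out l k` hold vectors of length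
`L n`; the others are intermediate results. -/
inductive Reg (L : ℕ)
  | lam (l l' : Fin L) (k : ℕ)
  | inv (l l' : Fin L) (k : ℕ)
  | xi (l : Fin L)
  | vec (l : Fin L) (k : ℕ)
  | out (l : Fin L) (k : ℕ)
  | el (l : Fin L) (k : ℕ)
  | eff (k : ℕ)
  | schur (k : ℕ)
  | gee (k : ℕ)
  | aitch (l : Fin L) (k : ℕ)
  | jay (l l' : Fin L) (k : ℕ)
  | rho
  | tw
  | tmp
  deriving DecidableEq

/-- Instructions; the first argument is the register that receives the result. `ker t l i l' i'` evaluates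
the kernel at point `i` of task `l` and point `i'` of task `l'`. -/
inductive Instr (L : ℕ)
  | const (t : Reg L) (c : ℂ)
  | copy (t a : Reg L)
  | neg (t a : Reg L)
  | conj (t a : Reg L)
  | recip (t a : Reg L)
  | add (t a b : Reg L)
  | sub (t a b : Reg L)
  | mul (t a b : Reg L)
  | ker (t : Reg L) (l : Fin L) (i : ℕ) (l' : Fin L) (i' : ℕ)

abbrev Prog (L : ℕ) := List (Instr L)

abbrev State (L : ℕ) := Reg L → ℂ

/-- Effect of one instruction; `κ` answers the kernel evaluations. -/
noncomputable def Instr.exec {L : ℕ} (κ : Fin L → ℕ → Fin L → ℕ → ℝ) (s : State L) :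
    Instr L → State L
  | .const t c => Function.update s t c
  | .copy t a => Function.update s t (s a)
  | .neg t a => Function.update s t (-s a)
  | .conj t a => Function.update s t (starRingEnd ℂ (s a))
  | .recip t a => Function.update s t (s a)⁻¹
  | .add t a b => Function.update s t (s a + s b)
  | .sub t a b => Function.update s t (s a - s b)
  | .mul t a b => Function.update s t (s a * s b)
  | .ker t l i l' i' => Function.update s t (κ l i l' i' : ℂ)

/-- Final state of a program. -/
noncomputable def run {L : ℕ} (κ : Fin L → ℕ → Fin L → ℕ → ℝ) (P : Prog L) (s : State L) : State L :=
  P.foldl (Instr.exec κ) s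

/-- The run of the program from the given state never takes the reciprocal of zero. -/
def DivSafe {L : ℕ} (κ : Fin L → ℕ → Fin L → ℕ → ℝ) : Prog L → State L → Prop
  | [], _ => True
  | I :: P, s => (∀ t a, I = .recip t a → s a ≠ 0) ∧ DivSafe κ P (I.exec κ s)

/-- A kernel evaluation costs `q`, any other instruction costs `1`. -/
def Instr.cost {L : ℕ} (q : ℕ) : Instr L → ℕ
  | .ker _ _ _ _ _ => q
  | _ => 1

/-- Number of operations of a program. -/
def cost {L : ℕ} (q : ℕ) (P : Prog L) : ℕ := (P.map (Instr.cost q)).sum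

def Instr.regs {L : ℕ} : Instr L → List (Reg L)
  | .const t _ => [t]
  | .copy t a => [t, a]
  | .neg t a => [t, a]
  | .conj t a => [t, a]
  | .recip t a => [t, a]
  | .add t a b => [t, a, b]
  | .sub t a b => [t, a, b]
  | .mul t a b => [t, a, b]
  | .ker t _ _ _ _ => [t]

/-- Storage of a program: the number of registers that it uses. -/
def storage {L : ℕ} (P : Prog L) : ℕ := (P.flatMap Instr.regs).toFinset.card

/-! ### The algorithms -/

/-- Twiddle factors of the last stage of a transform of length `2 ^ (m + 1)`. -/
noncomputable def twiddle (m : ℕ) : Flavour → ℕ → ℂ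
  | .lattice, j => Complex.exp (-(2 * Real.pi * Complex.I * j / 2 ^ (m + 1)))
  | .digital, _ => 1

/-- In-place fast transform by `√(2 ^ m) (V_m)ᴴ` of the array `a 0, …, a (2 ^ m - 1)`: the
decimation-in-time fast Fourier transform of the bit-reversed array (on which its own initial bit-reversal
pass cancels), respectively the fast Walsh–Hadamard transform. -/
noncomputable def fwd {L : ℕ} (fl : Flavour) : (m : ℕ) → (ℕ → Reg L) → Prog L
  | 0, _ => []
  | m + 1, a =>
      fwd fl m a ++ fwd fl m (fun k => a (k + 2 ^ m)) ++
      (List.range (2 ^ m)).flatMap fun j =>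
        [.const .tw (twiddle m fl j),
         .mul .tmp .tw (a (j + 2 ^ m)),
         .sub (a (j + 2 ^ m)) (a j) .tmp,
         .add (a j) (a j) .tmp]

/-- In-place fast transform by `√(2 ^ m) V_m`: the adjoint stages in reverse order. -/
noncomputable def bwd {L : ℕ} (fl : Flavour) : (m : ℕ) → (ℕ → Reg L) → Prog L
  | 0, _ => []
  | m + 1, a =>
      ((List.range (2 ^ m)).flatMap fun j =>
        [.sub .tmp (a j) (a (j + 2 ^ m)),
         .add (a j) (a j) (a (j + 2 ^ m)),
         .const .tw (starRingEnd ℂ (twiddle m fl j)),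
         .mul (a (j + 2 ^ m)) .tw .tmp]) ++
      bwd fl m a ++ bwd fl m (fun k => a (k + 2 ^ m))

/-- Multiplication of the array `a 0, …, a (2 ^ m - 1)` by `1 / √(2 ^ m)`. -/
noncomputable def scale {L : ℕ} (m : ℕ) (a : ℕ → Reg L) : Prog L :=
  .const .tw ((√((2 : ℝ) ^ m))⁻¹ : ℂ) :: (List.range (2 ^ m)).map fun k => .mul (a k) .tw (a k)

/-- Evaluation of `Λ`: block `(l, l')` is the transform of the zeroth column of block `(l, l')` of the noisy
Gram matrix. -/
noncomputable def formProg (fl : Flavour) (L m : ℕ) : Prog L :=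
  (List.finRange L).flatMap fun l => (List.finRange L).flatMap fun l' =>
    ((List.range (2 ^ m)).map fun i => .ker (.lam l l' i) l i l' 0) ++
    (if l = l' then [.add (.lam l l' 0) (.lam l l' 0) (.xi l)] else []) ++
    fwd fl m (.lam l l')

/-- The vector in the registers `vec` is multiplied by `V M Vᴴ`, where `M` is the matrix with the diagonal
blocks stored in `mat`; the result is left in the registers `out`. -/
noncomputable def mulProg (fl : Flavour) (L m : ℕ) (mat : Fin L → Fin L → ℕ → Reg L) : Prog L :=
  ((List.finRange L).flatMap fun l => fwd fl m (.vec l) ++ scale m (.vec l)) ++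
  ((List.finRange L).flatMap fun l => (List.range (2 ^ m)).flatMap fun k =>
    .const (.out l k) 0 ::
      (List.finRange L).flatMap fun l' =>
        [.mul .tmp (mat l l' k) (.vec l' k), .add (.out l k) (.out l k) .tmp]) ++
  ((List.finRange L).flatMap fun l => bwd fl m (.out l) ++ scale m (.out l))

/-- One pass of the loop of the inversion algorithm, for task `l`, on matrices with `n × n` diagonal blocks.
On entry the registers `inv` hold the inverse `A` of the leading part of `Λ` that belongs to the tasks before
`l`. If there are none, the pass reduces to `A ← D⁻¹`, `ϱ ← |D|`. -/
noncomputable def invDetStage (L n : ℕ) (l : Fin L) : Prog L :=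
  let prev := (List.finRange L).filter fun i => i < l
  let ks := List.range n
  -- `L ← A B`, where `B` consists of the blocks of column `l` above the diagonal
  (prev.flatMap fun i => ks.flatMap fun k =>
    .const (.el i k) 0 ::
      prev.flatMap fun j =>
        [.mul .tmp (.inv i j k) (.lam j l k), .add (.el i k) (.el i k) .tmp]) ++
  -- `F ← Bᴴ L`
  (ks.flatMap fun k =>
    .const (.eff k) 0 ::
      prev.flatMap fun i =>
        [.conj .tmp (.lam i l k), .mul .tmp .tmp (.el i k), .add (.eff k) (.eff k) .tmp]) ++
  -- `S ← D - F`
  (ks.map fun k => .sub (.schur k) (.lam l l k) (.eff k)) ++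
  -- `ϱ ← ϱ |S|`
  (ks.map fun k => .mul .rho .rho (.schur k)) ++
  -- `G ← S⁻¹`
  (ks.map fun k => .recip (.gee k) (.schur k)) ++
  -- `H ← L G`
  (prev.flatMap fun i => ks.map fun k => .mul (.aitch i k) (.el i k) (.gee k)) ++
  -- `J ← H Lᴴ`
  (prev.flatMap fun i => prev.flatMap fun j => ks.flatMap fun k =>
    [.conj .tmp (.el j k), .mul (.jay i j k) (.aitch i k) .tmp]) ++
  -- `M ← A + J`, in place of `A`
  (prev.flatMap fun i => prev.flatMap fun j => ks.map fun k =>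
    .add (.inv i j k) (.inv i j k) (.jay i j k)) ++
  -- `A ← (M, -H; -Hᴴ, G)`
  (prev.flatMap fun i => ks.flatMap fun k =>
    [.neg (.inv i l k) (.aitch i k), .conj .tmp (.aitch i k), .neg (.inv l i k) .tmp]) ++
  (ks.map fun k => .copy (.inv l l k) (.gee k))

/-- Inverse (in the registers `inv`) and determinant (in `rho`) of the matrix in the registers `lam`. -/
noncomputable def invDetProg (L n : ℕ) : Prog L :=
  .const .rho 1 :: (List.finRange L).flatMap (invDetStage L n)

end FastMTGP

namespace FastMTGP

/-! ### Semantics of programs: concatenation, division safety, independent loops. -/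

section Programs

variable {L : ℕ} {κ : Fin L → ℕ → Fin L → ℕ → ℝ}

/-! The indices of the points in a task form a finite abelian group: for lattices the fractions with
denominator `2 ^ m` modulo one, for digital sequences the bit vectors under exclusive or. Points and
transform both respect this group. Given indices `i` and `i'` there is an index `j`, independent of
the tasks, such that row `j` of the phases is row `i` times the conjugate of row `i'`, and the
spatial kernel at `(i, i')` equals the kernel at `(j, 0)` for every pair of tasks
(`IsFastDesign.exists_sub`). Shifts that differ by task do no harm, since they contribute the same
offset on both sides. Every block of the Gram matrix is thus a group convolution. The columns of
`transform` are characters, hence common eigenvectors of all blocks, and the eigenvalues are the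
unnormalised transform of the zeroth column. Noise enters only where `j = 0` (`gram_mul_bigV`,
`lambdaMat_eq`).

The phases of both flavours obey one radix-2 recursion (`phase_succ_low_low` and its three
companions). By induction it yields orthogonality, hence unitarity, and the same recursion proves
the fast transforms correct (`run_fwd`, `run_bwd`).

For nonsingularity the quadratic form of the Gram matrix is regrouped by distinct points. It becomes
the form of the Kronecker product of two positive definite matrices plus a nonnegative noise term,
and the noise term takes over when the regrouped weights vanish (`realGram_posDef`). Conjugation by
`bigV` preserves positive definiteness.

Sorted by frequency `k` instead of by task, `Λ` consists of `n` independent positive definite `L ×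
L` matrices. The inversion algorithm borders all of them simultaneously, one row and column at a
time (`posDef_border`, `InvState.step`). Its pivots are ratios of determinants of consecutive
leading principal submatrices, all nonzero, so no division by zero occurs.

That programs compute what the algebra says rests on a noninterference principle for loops
(`run_flatMap_indep`). Costs and storage follow by counting loop passes and register families. -/

@[simp] theorem run_nil (s : State L) : run κ [] s = s := rfl

@[simp] theorem run_cons (I : Instr L) (P : Prog L) (s : State L) :
    run κ (I :: P) s = run κ P (I.exec κ s) := rfl

@[simp] theorem run_append (P Q : Prog L) (s : State L) :
    run κ (P ++ Q) s = run κ Q (run κ P s) := by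
  simp [run]

theorem divSafe_append (P Q : Prog L) (s : State L) :
    DivSafe κ (P ++ Q) s ↔ DivSafe κ P s ∧ DivSafe κ Q (run κ P s) := by
  induction P generalizing s with
  | nil => simp [DivSafe]
  | cons I P ih => simp [DivSafe, ih, and_assoc]

/-- The program takes no reciprocals. -/
def DivFree (P : Prog L) : Prop := ∀ I ∈ P, ∀ t a, I ≠ .recip t a

theorem DivFree.divSafe {P : Prog L} (h : DivFree P) (s : State L) : DivSafe κ P s := by
  induction P generalizing s with
  | nil => trivial
  | cons I P ih =>
    exact ⟨fun t a e => absurd e (h I (by simp) t a), ih (fun J hJ => h J (by simp [hJ])) _⟩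

@[simp] theorem divFree_nil : DivFree ([] : Prog L) := by simp [DivFree]

@[simp] theorem divFree_cons (I : Instr L) (P : Prog L) :
    DivFree (I :: P) ↔ (∀ t a, I ≠ .recip t a) ∧ DivFree P := by
  simp [DivFree]

@[simp] theorem divFree_append (P Q : Prog L) : DivFree (P ++ Q) ↔ DivFree P ∧ DivFree Q := by
  simp only [DivFree, List.mem_append]
  exact ⟨fun h => ⟨fun I hI => h I (Or.inl hI), fun I hI => h I (Or.inr hI)⟩,
    fun h I hI => hI.elim (h.1 I) (h.2 I)⟩

theorem divFree_flatMap {α : Type*} {xs : List α} {P : α → Prog L} (h : ∀ a ∈ xs, DivFree (P a)) :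
    DivFree (xs.flatMap P) := by
  intro I hI
  obtain ⟨a, ha, hIa⟩ := List.mem_flatMap.1 hI
  exact h a ha I hIa

theorem divFree_map {α : Type*} {xs : List α} {f : α → Instr L}
    (h : ∀ a ∈ xs, ∀ t b, f a ≠ .recip t b) : DivFree (xs.map f) := by
  intro I hI
  obtain ⟨a, ha, rfl⟩ := List.mem_map.1 hI
  exact h a ha

theorem map_eq_flatMap_singleton {α β : Type*} (xs : List α) (f : α → β) :
    xs.map f = xs.flatMap fun a => [f a] := by
  induction xs with
  | nil => rfl
  | cons a xs ih => simp [ih]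

/-- Turns nested loops into one loop over pairs, so that the lemmas on a single independent loop
apply to them. -/
theorem flatMap_product {α β γ : Type*} (xs : List α) (ys : List β) (f : α → β → List γ) :
    (xs.flatMap fun a => ys.flatMap fun b => f a b) = (xs ×ˢ ys).flatMap fun p => f p.1 p.2 := by
  induction xs with
  | nil => simp
  | cons a xs ih => simp [List.product_cons, ih, List.flatMap_map]

/-- A loop whose passes are independent: pass `a` writes to its own registers `W a` and to scratch
registers `T`, and its result only depends on registers that no other pass writes to. -/
theorem run_flatMap_indep {α : Type*} (W : α → Reg L → Prop) (T : Reg L → Prop)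
    (P : α → Prog L) (val : α → Reg L → ℂ) (xs : List α) (s₀ : State L) (hnd : xs.Nodup)
    (hW : ∀ a ∈ xs, ∀ b ∈ xs, ∀ r, W a r → W b r → a = b)
    (hT : ∀ a ∈ xs, ∀ r, W a r → ¬ T r)
    (hframe : ∀ a ∈ xs, ∀ s r, ¬ W a r → ¬ T r → run κ (P a) s r = s r)
    (hval : ∀ a ∈ xs, ∀ s, (∀ r, ¬ T r → (∀ b ∈ xs, b ≠ a → ¬ W b r) → s r = s₀ r) →
      ∀ r, W a r → run κ (P a) s r = val a r) :
    (∀ a ∈ xs, ∀ r, W a r → run κ (xs.flatMap P) s₀ r = val a r) ∧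
      ∀ r, ¬ T r → (∀ a ∈ xs, ¬ W a r) → run κ (xs.flatMap P) s₀ r = s₀ r := by
  suffices H : ∀ (ys : List α), ys ⊆ xs → ys.Nodup →
      (∀ a ∈ ys, ∀ r, W a r → run κ (ys.flatMap P) s₀ r = val a r) ∧
      ∀ r, ¬ T r → (∀ a ∈ ys, ¬ W a r) → run κ (ys.flatMap P) s₀ r = s₀ r from
    H xs (fun _ h => h) hnd
  intro ys
  -- The last pass is peeled off: the state on its entry is then described by the induction
  -- hypothesis for the preceding passes, which is what `hval` asks for. Keeping `ys` inside the
  -- fixed list `xs` leaves all hypotheses unchanged.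
  induction ys using List.reverseRecOn with
  | nil => simp
  | append_singleton ys a ih =>
    intro hsub hnd'
    have ha : a ∈ xs := hsub (by simp)
    have hys : ys ⊆ xs := fun x hx => hsub (by simp [hx])
    have hnd'' := List.nodup_append.1 hnd'
    have hna : a ∉ ys := fun h => hnd''.2.2 a h a (by simp) rfl
    obtain ⟨ih1, ih2⟩ := ih hys hnd''.1
    simp only [List.flatMap_append, List.flatMap_cons, List.flatMap_nil, List.append_nil, run_append]
    constructor
    · intro b hb r hbr
      rcases List.mem_append.1 hb with hb | hb
      · rw [hframe a ha _ r (fun har => hna ((hW a ha b (hys hb) r har hbr) ▸ hb))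
          (hT b (hys hb) r hbr)]
        exact ih1 b hb r hbr
      · obtain rfl : b = a := by simpa using hb
        refine hval b ha _ (fun r hTr hr => ih2 r hTr fun c hc => ?_) r hbr
        exact hr c (hys hc) (fun e => hna (e ▸ hc))
    · intro r hTr hr
      rw [hframe a ha _ r (hr a (by simp)) hTr]
      exact ih2 r hTr fun c hc => hr c (by simp [hc])

/-- Accumulation of a sum of products. -/
theorem run_accumulate {α : Type*} (t : Reg L) (x y : α → Reg L) (xs : List α) (s : State L)
    (ht : t ≠ .tmp) (hx : ∀ a, x a ≠ .tmp ∧ x a ≠ t) (hy : ∀ a, y a ≠ .tmp ∧ y a ≠ t) :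
    run κ (xs.flatMap fun a => [.mul .tmp (x a) (y a), .add t t .tmp]) s t =
        s t + (xs.map fun a => s (x a) * s (y a)).sum ∧
      ∀ r, r ≠ t → r ≠ .tmp →
        run κ (xs.flatMap fun a => [.mul .tmp (x a) (y a), .add t t .tmp]) s r = s r := by
  induction xs generalizing s with
  | nil => simp
  | cons a xs ih =>
    simp only [List.flatMap_cons, run_append, List.map_cons, List.sum_cons]
    obtain ⟨h1, h2⟩ := ih (run κ [.mul .tmp (x a) (y a), .add t t .tmp] s)
    have hfr : ∀ r, r ≠ t → r ≠ .tmp → run κ [.mul .tmp (x a) (y a), .add t t .tmp] s r = s r := by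
      intro r h h'
      simp [Instr.exec, h, h']
    refine ⟨?_, fun r h h' => by rw [h2 r h h', hfr r h h']⟩
    rw [h1]
    have : ∀ b, run κ [.mul .tmp (x a) (y a), .add t t .tmp] s (x b) *
        run κ [.mul .tmp (x a) (y a), .add t t .tmp] s (y b) = s (x b) * s (y b) := fun b => by
      rw [hfr _ (hx b).2 (hx b).1, hfr _ (hy b).2 (hy b).1]
    simp only [this]
    simp [Instr.exec, ht, add_assoc]

/-- Accumulation of a sum of products with one conjugated factor. -/
theorem run_accumulate_conj {α : Type*} (t : Reg L) (x y : α → Reg L) (xs : List α) (s : State L)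
    (ht : t ≠ .tmp) (hx : ∀ a, x a ≠ .tmp ∧ x a ≠ t) (hy : ∀ a, y a ≠ .tmp ∧ y a ≠ t) :
    run κ (xs.flatMap fun a => [.conj .tmp (x a), .mul .tmp .tmp (y a), .add t t .tmp]) s t =
        s t + (xs.map fun a => starRingEnd ℂ (s (x a)) * s (y a)).sum ∧
      ∀ r, r ≠ t → r ≠ .tmp →
        run κ (xs.flatMap fun a => [.conj .tmp (x a), .mul .tmp .tmp (y a), .add t t .tmp]) s r =
          s r := by
  induction xs generalizing s with
  | nil => simp
  | cons a xs ih =>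
    simp only [List.flatMap_cons, run_append, List.map_cons, List.sum_cons]
    obtain ⟨h1, h2⟩ := ih (run κ [.conj .tmp (x a), .mul .tmp .tmp (y a), .add t t .tmp] s)
    have hfr : ∀ r, r ≠ t → r ≠ .tmp →
        run κ [.conj .tmp (x a), .mul .tmp .tmp (y a), .add t t .tmp] s r = s r := by
      intro r h h'
      simp [Instr.exec, h, h']
    refine ⟨?_, fun r h h' => by rw [h2 r h h', hfr r h h']⟩
    rw [h1]
    have : ∀ b, starRingEnd ℂ
        (run κ [.conj .tmp (x a), .mul .tmp .tmp (y a), .add t t .tmp] s (x b)) *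
        run κ [.conj .tmp (x a), .mul .tmp .tmp (y a), .add t t .tmp] s (y b) =
          starRingEnd ℂ (s (x b)) * s (y b) := fun b => by
      rw [hfr _ (hx b).2 (hx b).1, hfr _ (hy b).2 (hy b).1]
    simp only [this]
    simp [Instr.exec, ht, (hy a).1, add_assoc]

/-- Accumulation of a product. -/
theorem run_accumulate_mul {α : Type*} (t : Reg L) (x : α → Reg L) (xs : List α) (s : State L)
    (hx : ∀ a, x a ≠ t) :
    run κ (xs.map fun a => .mul t t (x a)) s t = s t * (xs.map fun a => s (x a)).prod ∧
      ∀ r, r ≠ t → run κ (xs.map fun a => .mul t t (x a)) s r = s r := by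
  induction xs generalizing s with
  | nil => simp
  | cons a xs ih =>
    simp only [List.map_cons, run_cons, List.prod_cons]
    obtain ⟨h1, h2⟩ := ih (Instr.exec κ s (.mul t t (x a)))
    refine ⟨?_, fun r h => by rw [h2 r h]; simp [Instr.exec, h]⟩
    rw [h1]
    simp [Instr.exec, hx, mul_assoc]

/-- No target is an operand, so the operands of later reciprocals keep their initial nonzero values.
-/
theorem divSafe_recip_map {α : Type*} (t x : α → Reg L) (xs : List α) (s : State L)
    (htx : ∀ a b, t a ≠ x b) (h : ∀ a ∈ xs, s (x a) ≠ 0) :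
    DivSafe κ (xs.map fun a => .recip (t a) (x a)) s := by
  induction xs generalizing s with
  | nil => trivial
  | cons a xs ih =>
    refine ⟨fun t' a' e => ?_, ih _ fun b hb => ?_⟩
    · cases e; exact h a (by simp)
    · simpa [Instr.exec, Function.update_of_ne (htx a b).symm] using h b (by simp [hb])

end Programs

/-! ### Characters, their radix-2 recursion, and unitarity. -/

section Transforms

/-! ### The matrices `√(2 ^ m) V_m` -/

/-- The entries of `√(2 ^ m) V_m`. -/
noncomputable def phase (m : ℕ) : Flavour → ℕ → ℕ → ℂ
  | .lattice, i, k => Complex.exp (2 * Real.pi * Complex.I * vdc i * k)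
  | .digital, i, k => ∏ p ∈ Finset.range m, if i.testBit p ∧ k.testBit p then -1 else 1

theorem transform_apply (m : ℕ) (fl : Flavour) (i k : Fin (2 ^ m)) :
    transform m fl i k = ((√((2 : ℝ) ^ m))⁻¹ : ℂ) * phase m fl i k := by
  cases fl <;> simp [transform, phase]

/-- Bits beyond the binary length vanish. This replaces the cutoff that depends on `i` by the common
cutoff `m`, so that sums for different indices can be compared term by term. -/
theorem sum_testBit_size {M : Type*} [AddCommMonoid M] {m i : ℕ} (hi : i < 2 ^ m) (f : ℕ → M) :
    ∑ p ∈ Finset.range (Nat.size i), (if i.testBit p then f p else 0) =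
      ∑ p ∈ Finset.range m, if i.testBit p then f p else 0 := by
  apply Finset.sum_subset
  · intro p hp
    rw [Finset.mem_range] at *
    exact hp.trans_le (Nat.size_le.2 hi)
  · intro p _ hp
    rw [Finset.mem_range, not_lt] at hp
    rw [Nat.testBit_lt_two_pow ((Nat.lt_size_self i).trans_le (Nat.pow_le_pow_right two_pos hp))]
    simp

theorem testBit_add_two_pow_of_lt {m p : ℕ} (hp : p < m) (i : ℕ) :
    (i + 2 ^ m).testBit p = i.testBit p := by
  rw [add_comm, Nat.testBit_two_pow_add_gt hp]

theorem testBit_add_two_pow_self {m i : ℕ} (hi : i < 2 ^ m) : (i + 2 ^ m).testBit m = true := by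
  rw [add_comm, Nat.testBit_two_pow_add_eq, Nat.testBit_lt_two_pow hi]
  rfl

theorem add_two_pow_lt {m i : ℕ} (hi : i < 2 ^ m) : i + 2 ^ m < 2 ^ (m + 1) := by
  rw [pow_succ]; omega

theorem lt_two_pow_succ {m i : ℕ} (hi : i < 2 ^ m) : i < 2 ^ (m + 1) := by
  rw [pow_succ]; omega

theorem vdc_eq_sum {m i : ℕ} (hi : i < 2 ^ m) :
    vdc i = ∑ p ∈ Finset.range m, if i.testBit p then ((2 : ℝ) ^ (p + 1))⁻¹ else 0 :=
  sum_testBit_size hi _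

theorem vdc_add_two_pow {m i : ℕ} (hi : i < 2 ^ m) :
    vdc (i + 2 ^ m) = vdc i + ((2 : ℝ) ^ (m + 1))⁻¹ := by
  rw [vdc_eq_sum (add_two_pow_lt hi), vdc_eq_sum hi, Finset.sum_range_succ,
    testBit_add_two_pow_self hi]
  simp only [if_true, add_left_inj]
  refine Finset.sum_congr rfl fun p hp => ?_
  rw [testBit_add_two_pow_of_lt (Finset.mem_range.1 hp)]

/-- `2 ^ m * vdc i` is an integer. -/
theorem exists_vdc_eq (m : ℕ) : ∀ i < 2 ^ m, ∃ a : ℤ, vdc i * 2 ^ m = a := by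
  induction m with
  | zero =>
    intro i hi
    obtain rfl : i = 0 := by simpa using hi
    exact ⟨0, by simp [vdc]⟩
  | succ m ih =>
    intro i hi
    rcases lt_or_ge i (2 ^ m) with h | h
    · obtain ⟨a, ha⟩ := ih i h
      exact ⟨a * 2, by rw [pow_succ, ← mul_assoc, ha]; push_cast; rfl⟩
    · obtain ⟨j, rfl⟩ := Nat.exists_eq_add_of_le' h
      have hj : j < 2 ^ m := by rw [pow_succ] at hi; omega
      obtain ⟨a, ha⟩ := ih j hj
      refine ⟨a * 2 + 1, ?_⟩
      rw [vdc_add_two_pow hj, add_mul, inv_mul_cancel₀ (by positivity), pow_succ, ← mul_assoc, ha]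
      push_cast; rfl

/-- Every fraction with denominator `2 ^ m` is a radical inverse modulo one. -/
theorem exists_vdc_sub (m : ℕ) : ∀ a : ℤ, ∃ i < 2 ^ m, ∃ z : ℤ, (a : ℝ) / 2 ^ m = vdc i + z := by
  induction m with
  | zero => exact fun a => ⟨0, by simp, a, by simp [vdc]⟩
  | succ m ih =>
    intro a
    -- The parity of `a` is the finest binary digit of the fraction, hence the top bit of the index;
    -- the quotient determines the other bits.
    obtain ⟨i, hi, z, hz⟩ := ih (a / 2)
    have ha : (a : ℝ) / 2 ^ (m + 1) = ((a / 2 : ℤ) : ℝ) / 2 ^ m + ((a % 2 : ℤ) : ℝ) / 2 ^ (m + 1) := by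
      have : (a : ℝ) = 2 * ((a / 2 : ℤ) : ℝ) + ((a % 2 : ℤ) : ℝ) := by
        exact_mod_cast (Int.mul_ediv_add_emod a 2).symm
      rw [this, pow_succ]
      field_simp
    rcases Int.emod_two_eq_zero_or_one a with h | h
    · exact ⟨i, lt_two_pow_succ hi, z, by rw [ha, h, hz]; simp⟩
    · refine ⟨i + 2 ^ m, add_two_pow_lt hi, z, ?_⟩
      rw [ha, h, hz, vdc_add_two_pow hi]
      push_cast
      ring

theorem phase_zero_col (m : ℕ) (fl : Flavour) (i : ℕ) : phase m fl i 0 = 1 := by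
  cases fl <;> simp [phase]

theorem phase_zero_row (m : ℕ) (fl : Flavour) (k : ℕ) : phase m fl 0 k = 1 := by
  cases fl <;> simp [phase, vdc]

theorem conj_phase_lattice (m i k : ℕ) :
    starRingEnd ℂ (phase m .lattice i k) = Complex.exp (-(2 * Real.pi * Complex.I * vdc i * k)) := by
  simp only [phase, ← Complex.exp_conj]
  congr 1
  simp [Complex.conj_ofReal, map_ofNat (starRingEnd ℂ) 2]

theorem twiddle_mul_conj (m : ℕ) (fl : Flavour) (j : ℕ) :
    twiddle m fl j * starRingEnd ℂ (twiddle m fl j) = 1 := by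
  cases fl
  · simp only [twiddle, ← Complex.exp_conj, ← Complex.exp_add]
    rw [← Complex.exp_zero]
    congr 1
    simp [Complex.conj_ofReal, map_ofNat (starRingEnd ℂ) 2]
    ring
  · simp [twiddle]

/-- This and the next three lemmas are the radix-2 recursion. With `A` the phase matrix of order `2
^ m` and `D` the diagonal matrix of conjugated twiddle factors, the matrix of order `2 ^ (m + 1)`
has block rows `(A, A)` and `(A D, -A D)`. -/
theorem phase_succ_low_low {m i k : ℕ} (fl : Flavour) (hi : i < 2 ^ m) :
    phase (m + 1) fl i k = phase m fl i k := by
  cases fl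
  · rfl
  · simp [phase, Finset.prod_range_succ, Nat.testBit_lt_two_pow hi]

theorem phase_succ_low_high {m i k : ℕ} (fl : Flavour) (hi : i < 2 ^ m) :
    phase (m + 1) fl i (k + 2 ^ m) = phase m fl i k := by
  cases fl
  · obtain ⟨a, ha⟩ := exists_vdc_eq m i hi
    simp only [phase]
    -- Since `vdc i * 2 ^ m` is an integer, moving `k` by `2 ^ m` adds whole turns.
    rw [show (2 * Real.pi * Complex.I * vdc i * ((k + 2 ^ m : ℕ) : ℂ)) =
      2 * Real.pi * Complex.I * vdc i * k + a * (2 * Real.pi * Complex.I) by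
        have : (vdc i : ℂ) * 2 ^ m = a := by exact_mod_cast congrArg (fun x : ℝ => (x : ℂ)) ha
        rw [← this]; push_cast; ring, Complex.exp_add, Complex.exp_int_mul_two_pi_mul_I, mul_one]
  · simp only [phase, Finset.prod_range_succ, Nat.testBit_lt_two_pow hi]
    simp only [Bool.false_eq_true, false_and, if_false, mul_one]
    refine Finset.prod_congr rfl fun p hp => ?_
    rw [testBit_add_two_pow_of_lt (Finset.mem_range.1 hp)]

theorem phase_succ_high_low {m i k : ℕ} (fl : Flavour) (hi : i < 2 ^ m) (hk : k < 2 ^ m) :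
    phase (m + 1) fl (i + 2 ^ m) k = phase m fl i k * starRingEnd ℂ (twiddle m fl k) := by
  cases fl
  · simp only [phase, twiddle, ← Complex.exp_conj, ← Complex.exp_add, vdc_add_two_pow hi]
    congr 1
    simp [Complex.conj_ofReal, map_ofNat (starRingEnd ℂ) 2]
    ring
  · simp only [phase, twiddle, Finset.prod_range_succ, Nat.testBit_lt_two_pow hk]
    simp only [Bool.false_eq_true, and_false, if_false, mul_one, map_one]
    refine Finset.prod_congr rfl fun p hp => ?_
    rw [testBit_add_two_pow_of_lt (Finset.mem_range.1 hp)]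

theorem phase_succ_high_high {m i k : ℕ} (fl : Flavour) (hi : i < 2 ^ m) (hk : k < 2 ^ m) :
    phase (m + 1) fl (i + 2 ^ m) (k + 2 ^ m) =
      -(phase m fl i k * starRingEnd ℂ (twiddle m fl k)) := by
  cases fl
  · have hlow := phase_succ_low_high (k := k) .lattice hi
    simp only [phase] at hlow
    simp only [phase, twiddle, vdc_add_two_pow hi]
    rw [Complex.ofReal_add, mul_add, add_mul, Complex.exp_add, hlow, ← mul_neg, ← Complex.exp_conj]
    congr 1
    -- The finest digit of the row index meets the column shift `2 ^ m` in half a turn, which is the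
    -- minus sign.
    rw [show (2 * Real.pi * Complex.I * (((2 : ℝ) ^ (m + 1))⁻¹ : ℝ) * ((k + 2 ^ m : ℕ) : ℂ)) =
      starRingEnd ℂ (-(2 * Real.pi * Complex.I * k / 2 ^ (m + 1))) + Real.pi * Complex.I by
        simp [Complex.conj_ofReal, map_ofNat (starRingEnd ℂ) 2, pow_succ]
        field_simp, Complex.exp_add, Complex.exp_pi_mul_I]
    ring
  · simp only [phase, twiddle, Finset.prod_range_succ, testBit_add_two_pow_self hk,
      testBit_add_two_pow_self hi]
    simp only [and_self, if_true, map_one, mul_one, mul_neg, neg_inj]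
    refine Finset.prod_congr rfl fun p hp => ?_
    rw [testBit_add_two_pow_of_lt (Finset.mem_range.1 hp),
      testBit_add_two_pow_of_lt (Finset.mem_range.1 hp)]

theorem sum_range_two_pow_succ {M : Type*} [AddCommMonoid M] (m : ℕ) (f : ℕ → M) :
    ∑ i ∈ Finset.range (2 ^ (m + 1)), f i =
      ∑ i ∈ Finset.range (2 ^ m), f i + ∑ i ∈ Finset.range (2 ^ m), f (i + 2 ^ m) := by
  rw [pow_succ, mul_two, Finset.sum_range_add]
  simp [add_comm]

theorem lt_two_pow_succ_cases {m k : ℕ} (hk : k < 2 ^ (m + 1)) :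
    k < 2 ^ m ∨ ∃ j < 2 ^ m, k = j + 2 ^ m := by
  rcases lt_or_ge k (2 ^ m) with h | h
  · exact Or.inl h
  · obtain ⟨j, rfl⟩ := Nat.exists_eq_add_of_le' h
    exact Or.inr ⟨j, by rw [pow_succ] at hk; omega, rfl⟩

/-- Orthogonality of the columns of `√(2 ^ m) V_m`. -/
theorem sum_conj_phase_mul_phase (fl : Flavour) (m : ℕ) : ∀ k < 2 ^ m, ∀ k' < 2 ^ m,
    ∑ i ∈ Finset.range (2 ^ m), starRingEnd ℂ (phase m fl i k) * phase m fl i k' =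
      if k = k' then (2 : ℂ) ^ m else 0 := by
  induction m with
  | zero =>
    intro k hk k' hk'
    obtain rfl : k = 0 := by simpa using hk
    obtain rfl : k' = 0 := by simpa using hk'
    simp [phase_zero_col]
  | succ m ih =>
    intro k hk k' hk'
    rw [sum_range_two_pow_succ]
    -- The high rows carry the same inner products as the low rows: a factor of twiddles appears,
    -- but it is one when the columns agree and is irrelevant when the sum vanishes. The two halves
    -- then add up if the columns lie in the same half and cancel, by the sign in the last block, if
    -- they do not.
    have key : ∀ k < 2 ^ m, ∀ k' < 2 ^ m, ∑ i ∈ Finset.range (2 ^ m),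
        starRingEnd ℂ (phase m fl i k * starRingEnd ℂ (twiddle m fl k)) *
          (phase m fl i k' * starRingEnd ℂ (twiddle m fl k')) =
          if k = k' then (2 : ℂ) ^ m else 0 := by
      intro k hk k' hk'
      have : ∀ i, starRingEnd ℂ (phase m fl i k * starRingEnd ℂ (twiddle m fl k)) *
          (phase m fl i k' * starRingEnd ℂ (twiddle m fl k')) =
          (twiddle m fl k * starRingEnd ℂ (twiddle m fl k')) *
            (starRingEnd ℂ (phase m fl i k) * phase m fl i k') := fun i => by
        simp only [map_mul, Complex.conj_conj]; ring
      simp only [this, ← Finset.mul_sum, ih k hk k' hk']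
      split_ifs with h
      · rw [h, twiddle_mul_conj, one_mul]
      · simp
    rcases lt_two_pow_succ_cases hk with hk | ⟨j, hj, rfl⟩ <;>
      rcases lt_two_pow_succ_cases hk' with hk' | ⟨j', hj', rfl⟩
    · rw [Finset.sum_congr rfl fun i hi => by
        rw [phase_succ_low_low fl (Finset.mem_range.1 hi), phase_succ_low_low fl (Finset.mem_range.1 hi)],
        ih k hk k' hk', Finset.sum_congr rfl fun i hi => by
        rw [phase_succ_high_low fl (Finset.mem_range.1 hi) hk,
          phase_succ_high_low fl (Finset.mem_range.1 hi) hk'], key k hk k' hk']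
      split_ifs <;> ring
    · rw [Finset.sum_congr rfl fun i hi => by
        rw [phase_succ_low_low fl (Finset.mem_range.1 hi), phase_succ_low_high fl (Finset.mem_range.1 hi)],
        ih k hk j' hj', Finset.sum_congr rfl fun i hi => by
        rw [phase_succ_high_low fl (Finset.mem_range.1 hi) hk,
          phase_succ_high_high fl (Finset.mem_range.1 hi) hj', mul_neg], Finset.sum_neg_distrib,
          key k hk j' hj', if_neg (show k ≠ j' + 2 ^ m by omega)]
      ring
    · rw [Finset.sum_congr rfl fun i hi => by
        rw [phase_succ_low_high fl (Finset.mem_range.1 hi), phase_succ_low_low fl (Finset.mem_range.1 hi)],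
        ih j hj k' hk', Finset.sum_congr rfl fun i hi => by
        rw [phase_succ_high_high fl (Finset.mem_range.1 hi) hj,
          phase_succ_high_low fl (Finset.mem_range.1 hi) hk', map_neg, neg_mul],
          Finset.sum_neg_distrib,
          key j hj k' hk', if_neg (show j + 2 ^ m ≠ k' by omega)]
      ring
    · rw [Finset.sum_congr rfl fun i hi => by
        rw [phase_succ_low_high fl (Finset.mem_range.1 hi), phase_succ_low_high fl (Finset.mem_range.1 hi)],
        ih j hj j' hj', Finset.sum_congr rfl fun i hi => by
        rw [phase_succ_high_high fl (Finset.mem_range.1 hi) hj,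
          phase_succ_high_high fl (Finset.mem_range.1 hi) hj', map_neg, neg_mul_neg],
          key j hj j' hj']
      simp only [add_left_inj]
      split_ifs <;> ring

theorem inv_sqrt_mul_inv_sqrt (m : ℕ) :
    ((√((2 : ℝ) ^ m))⁻¹ : ℂ) * ((√((2 : ℝ) ^ m))⁻¹ : ℂ) * (2 : ℂ) ^ m = 1 := by
  have h : √((2 : ℝ) ^ m) * √((2 : ℝ) ^ m) = 2 ^ m := Real.mul_self_sqrt (by positivity)
  have h' : ((√((2 : ℝ) ^ m) : ℝ) : ℂ) * ((√((2 : ℝ) ^ m) : ℝ) : ℂ) = 2 ^ m := by exact_mod_cast h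
  rw [← h']
  have : ((√((2 : ℝ) ^ m) : ℝ) : ℂ) ≠ 0 := by
    exact_mod_cast (Real.sqrt_pos.2 (by positivity)).ne'
  field_simp

theorem transform_conjTranspose_mul_self (m : ℕ) (fl : Flavour) :
    (transform m fl).conjTranspose * transform m fl = 1 := by
  ext k k'
  rw [Matrix.mul_apply]
  simp only [Matrix.conjTranspose_apply, transform_apply, Matrix.one_apply]
  have h := sum_conj_phase_mul_phase fl m k k.2 k' k'.2
  rw [Finset.sum_range] at h
  have : ∀ i : Fin (2 ^ m), star (((√((2 : ℝ) ^ m))⁻¹ : ℂ) * phase m fl i k) *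
      (((√((2 : ℝ) ^ m))⁻¹ : ℂ) * phase m fl i k') =
      ((√((2 : ℝ) ^ m))⁻¹ : ℂ) * ((√((2 : ℝ) ^ m))⁻¹ : ℂ) *
        (starRingEnd ℂ (phase m fl i k) * phase m fl i k') := fun i => by
    have hc : starRingEnd ℂ ((√((2 : ℝ) ^ m))⁻¹ : ℂ) = ((√((2 : ℝ) ^ m))⁻¹ : ℂ) := by
      rw [map_inv₀, Complex.conj_ofReal]
    rw [← starRingEnd_apply, map_mul, hc]; ring
  simp only [this, ← Finset.mul_sum, h, Fin.ext_iff]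
  split_ifs
  · exact inv_sqrt_mul_inv_sqrt m
  · simp

theorem transform_mul_conjTranspose_self (m : ℕ) (fl : Flavour) :
    transform m fl * (transform m fl).conjTranspose = 1 :=
  mul_eq_one_comm.1 (transform_conjTranspose_mul_self m fl)

/-- Orthogonality of the rows of `√(2 ^ m) V_m`. -/
theorem sum_phase_mul_conj_phase (fl : Flavour) (m : ℕ) (i i' : Fin (2 ^ m)) :
    ∑ k : Fin (2 ^ m), phase m fl i k * starRingEnd ℂ (phase m fl i' k) =
      if i = i' then (2 : ℂ) ^ m else 0 := by
  -- For a square matrix a left inverse is a right inverse, so column orthogonality passes to rows;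
  -- only the normalisation has to be removed.
  have h := congrFun (congrFun (transform_mul_conjTranspose_self m fl) i) i'
  rw [Matrix.mul_apply] at h
  simp only [Matrix.conjTranspose_apply, transform_apply, Matrix.one_apply] at h
  have : ∀ k : Fin (2 ^ m), (((√((2 : ℝ) ^ m))⁻¹ : ℂ) * phase m fl i k) *
      star (((√((2 : ℝ) ^ m))⁻¹ : ℂ) * phase m fl i' k) =
      ((√((2 : ℝ) ^ m))⁻¹ : ℂ) * ((√((2 : ℝ) ^ m))⁻¹ : ℂ) *
        (phase m fl i k * starRingEnd ℂ (phase m fl i' k)) := fun k => by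
    have hc : starRingEnd ℂ ((√((2 : ℝ) ^ m))⁻¹ : ℂ) = ((√((2 : ℝ) ^ m))⁻¹ : ℂ) := by
      rw [map_inv₀, Complex.conj_ofReal]
    rw [← starRingEnd_apply, map_mul, hc]; ring
  simp only [this, ← Finset.mul_sum] at h
  have h0 := inv_sqrt_mul_inv_sqrt m
  have h1 : ((√((2 : ℝ) ^ m))⁻¹ : ℂ) * ((√((2 : ℝ) ^ m))⁻¹ : ℂ) ≠ 0 := left_ne_zero_of_mul_eq_one h0
  apply mul_left_cancel₀ h1
  rw [h]
  split_ifs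
  · exact h0.symm
  · simp

theorem bigV_conjTranspose_mul_self (fl : Flavour) (L m : ℕ) :
    (bigV fl L m).conjTranspose * bigV fl L m = 1 := by
  have h : (bigV fl L m).conjTranspose =
      Matrix.kronecker (1 : Matrix (Fin L) (Fin L) ℂ) (transform m fl).conjTranspose := by
    have := Matrix.conjTranspose_kronecker (1 : Matrix (Fin L) (Fin L) ℂ) (transform m fl)
    rwa [Matrix.conjTranspose_one] at this
  rw [h]
  refine (Matrix.mul_kronecker_mul _ _ _ _).symm.trans ?_
  rw [transform_conjTranspose_mul_self, one_mul, Matrix.one_kronecker_one]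

theorem bigV_mem_unitaryGroup (fl : Flavour) (L m : ℕ) :
    bigV fl L m ∈ Matrix.unitaryGroup (Fin L × Fin (2 ^ m)) ℂ :=
  Matrix.mem_unitaryGroup_iff'.2 (bigV_conjTranspose_mul_self fl L m)

theorem bigV_mul_conjTranspose_self (fl : Flavour) (L m : ℕ) :
    bigV fl L m * (bigV fl L m).conjTranspose = 1 :=
  mul_eq_one_comm.1 (bigV_conjTranspose_mul_self fl L m)

end Transforms

/-! ### Correctness of the in-place fast transforms. -/

section FastTransforms

variable {L : ℕ} {κ : Fin L → ℕ → Fin L → ℕ → ℝ}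

/-- Scratch registers of the transforms. -/
def IsScratch (r : Reg L) : Prop := r = .tw ∨ r = .tmp

/-- `a 0, …, a (2 ^ m - 1)` are distinct registers, and none is a scratch register. -/
structure IsArray (m : ℕ) (a : ℕ → Reg L) : Prop where
  inj : ∀ i < 2 ^ m, ∀ j < 2 ^ m, a i = a j → i = j
  ne_tw : ∀ i < 2 ^ m, a i ≠ .tw
  ne_tmp : ∀ i < 2 ^ m, a i ≠ .tmp

theorem IsArray.low {m : ℕ} {a : ℕ → Reg L} (h : IsArray (m + 1) a) : IsArray m a :=
  ⟨fun i hi j hj => h.inj i (lt_two_pow_succ hi) j (lt_two_pow_succ hj),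
    fun i hi => h.ne_tw i (lt_two_pow_succ hi), fun i hi => h.ne_tmp i (lt_two_pow_succ hi)⟩

theorem IsArray.high {m : ℕ} {a : ℕ → Reg L} (h : IsArray (m + 1) a) :
    IsArray m (fun k => a (k + 2 ^ m)) :=
  ⟨fun i hi j hj e => by
      have := h.inj _ (add_two_pow_lt hi) _ (add_two_pow_lt hj) e
      omega,
    fun i hi => h.ne_tw _ (add_two_pow_lt hi), fun i hi => h.ne_tmp _ (add_two_pow_lt hi)⟩

theorem IsArray.low_ne_high {m i j : ℕ} {a : ℕ → Reg L} (h : IsArray (m + 1) a) (hi : i < 2 ^ m)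
    (hj : j < 2 ^ m) : a i ≠ a (j + 2 ^ m) := fun e => by
  have := h.inj _ (lt_two_pow_succ hi) _ (add_two_pow_lt hj) e
  omega

theorem divFree_fwd (fl : Flavour) (m : ℕ) (a : ℕ → Reg L) : DivFree (fwd fl m a) := by
  induction m generalizing a with
  | zero => simp [fwd]
  | succ m ih =>
    simp only [fwd, divFree_append]
    exact ⟨⟨ih _, ih _⟩, divFree_flatMap fun j _ => by simp⟩

theorem divFree_bwd (fl : Flavour) (m : ℕ) (a : ℕ → Reg L) : DivFree (bwd fl m a) := by
  induction m generalizing a with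
  | zero => simp [bwd]
  | succ m ih =>
    simp only [bwd, divFree_append]
    exact ⟨⟨divFree_flatMap fun j _ => by simp, ih _⟩, ih _⟩

theorem divFree_scale (m : ℕ) (a : ℕ → Reg L) : DivFree (scale m a) := by
  simp only [scale, divFree_cons]
  exact ⟨by simp, divFree_map fun j _ => by simp⟩

/-- A loop of butterflies on the pairs `a j`, `a (j + 2 ^ m)`. -/
theorem run_butterflies {m : ℕ} {a : ℕ → Reg L} (ha : IsArray (m + 1) a) (P : ℕ → Prog L)
    (f g : ℕ → ℂ → ℂ → ℂ)
    (hframe : ∀ j < 2 ^ m, ∀ s r, r ≠ a j → r ≠ a (j + 2 ^ m) → ¬ IsScratch r →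
      run κ (P j) s r = s r)
    (hf : ∀ j < 2 ^ m, ∀ s, run κ (P j) s (a j) = f j (s (a j)) (s (a (j + 2 ^ m))))
    (hg : ∀ j < 2 ^ m, ∀ s, run κ (P j) s (a (j + 2 ^ m)) = g j (s (a j)) (s (a (j + 2 ^ m))))
    (s : State L) :
    (∀ j < 2 ^ m, run κ ((List.range (2 ^ m)).flatMap P) s (a j) =
      f j (s (a j)) (s (a (j + 2 ^ m)))) ∧
    (∀ j < 2 ^ m, run κ ((List.range (2 ^ m)).flatMap P) s (a (j + 2 ^ m)) =
      g j (s (a j)) (s (a (j + 2 ^ m)))) ∧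
    ∀ r, ¬ IsScratch r → (∀ j < 2 ^ (m + 1), r ≠ a j) →
      run κ ((List.range (2 ^ m)).flatMap P) s r = s r := by
  have hns : ∀ j < 2 ^ (m + 1), ¬ IsScratch (a j) := fun j hj h =>
    h.elim (ha.ne_tw j hj) (ha.ne_tmp j hj)
  obtain ⟨h1, h2⟩ := run_flatMap_indep (κ := κ) (fun j r => r = a j ∨ r = a (j + 2 ^ m)) IsScratch P
    (fun j r => if r = a j then f j (s (a j)) (s (a (j + 2 ^ m)))
      else g j (s (a j)) (s (a (j + 2 ^ m)))) (List.range (2 ^ m)) s List.nodup_range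
    (by
      intro i hi j hj r h h'
      rw [List.mem_range] at hi hj
      rcases h with rfl | rfl <;> rcases h' with h' | h'
      · exact ha.inj _ (lt_two_pow_succ hi) _ (lt_two_pow_succ hj) h'
      · exact absurd h' (ha.low_ne_high hi hj)
      · exact absurd h'.symm (ha.low_ne_high hj hi)
      · exact ha.high.inj _ hi _ hj h')
    (by
      intro i hi r h
      rw [List.mem_range] at hi
      rcases h with rfl | rfl
      · exact hns _ (lt_two_pow_succ hi)
      · exact hns _ (add_two_pow_lt hi))
    (by
      intro i hi s r h h'
      rw [not_or] at h
      exact hframe i (List.mem_range.1 hi) s r h.1 h.2 h')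
    (by
      intro i hi s' hs r hr
      rw [List.mem_range] at hi
      have e1 : s' (a i) = s (a i) := hs _ (hns _ (lt_two_pow_succ hi)) fun b hb hbi h => by
        rw [List.mem_range] at hb
        rcases h with h | h
        · exact hbi (ha.inj _ (lt_two_pow_succ hi) _ (lt_two_pow_succ hb) h).symm
        · exact ha.low_ne_high hi hb h
      have e2 : s' (a (i + 2 ^ m)) = s (a (i + 2 ^ m)) :=
        hs _ (hns _ (add_two_pow_lt hi)) fun b hb hbi h => by
        rw [List.mem_range] at hb
        rcases h with h | h
        · exact ha.low_ne_high hb hi h.symm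
        · exact hbi (ha.high.inj _ hi _ hb h).symm
      rcases hr with rfl | rfl
      · rw [if_pos rfl, hf i hi, e1, e2]
      · rw [if_neg (ha.low_ne_high hi hi).symm, hg i hi, e1, e2])
  refine ⟨fun j hj => ?_, fun j hj => ?_, fun r hr h => h2 r hr fun j hj => ?_⟩
  · rw [h1 j (List.mem_range.2 hj) _ (Or.inl rfl), if_pos rfl]
  · rw [h1 j (List.mem_range.2 hj) _ (Or.inr rfl), if_neg (ha.low_ne_high hj hj).symm]
  · rw [List.mem_range] at hj
    rw [not_or]
    exact ⟨h j (lt_two_pow_succ hj), h _ (add_two_pow_lt hj)⟩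

/-- The forward program computes the product with `√(2 ^ m) (V_m)ᴴ`. -/
theorem run_fwd (fl : Flavour) (m : ℕ) : ∀ (a : ℕ → Reg L), IsArray m a → ∀ s : State L,
    (∀ k < 2 ^ m, run κ (fwd fl m a) s (a k) =
      ∑ i ∈ Finset.range (2 ^ m), starRingEnd ℂ (phase m fl i k) * s (a i)) ∧
    ∀ r, ¬ IsScratch r → (∀ j < 2 ^ m, r ≠ a j) → run κ (fwd fl m a) s r = s r := by
  induction m with
  | zero =>
    intro a ha s
    refine ⟨fun k hk => ?_, fun r _ _ => rfl⟩
    obtain rfl : k = 0 := by simpa using hk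
    simp [fwd, phase_zero_col]
  | succ m ih =>
    intro a ha s
    have hns : ∀ j < 2 ^ (m + 1), ¬ IsScratch (a j) := fun j hj h =>
      h.elim (ha.ne_tw j hj) (ha.ne_tmp j hj)
    simp only [fwd, run_append]
    obtain ⟨l1, l2⟩ := ih a ha.low s
    set s1 := run κ (fwd fl m a) s
    obtain ⟨u1, u2⟩ := ih _ ha.high s1
    set s2 := run κ (fwd fl m fun k => a (k + 2 ^ m)) s1
    obtain ⟨b1, b2, b3⟩ := run_butterflies (κ := κ) ha
      (fun j => [.const .tw (twiddle m fl j), .mul .tmp .tw (a (j + 2 ^ m)),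
        .sub (a (j + 2 ^ m)) (a j) .tmp, .add (a j) (a j) .tmp])
      (fun j x y => x + twiddle m fl j * y) (fun j x y => x - twiddle m fl j * y)
      (by
        intro j hj s r h h' h''
        rw [IsScratch, not_or] at h''
        simp [Instr.exec, h, h', h''.1, h''.2])
      (by
        intro j hj s
        have := ha.low_ne_high hj hj
        have := ha.ne_tw _ (add_two_pow_lt hj)
        have := ha.ne_tmp _ (add_two_pow_lt hj)
        have := ha.ne_tw _ (lt_two_pow_succ hj)
        have := ha.ne_tmp _ (lt_two_pow_succ hj)
        simp [Instr.exec, *, Ne.symm])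
      (by
        intro j hj s
        have := (ha.low_ne_high hj hj).symm
        have := ha.ne_tw _ (add_two_pow_lt hj)
        have := ha.ne_tmp _ (add_two_pow_lt hj)
        have := ha.ne_tw _ (lt_two_pow_succ hj)
        have := ha.ne_tmp _ (lt_two_pow_succ hj)
        simp [Instr.exec, *, Ne.symm]) s2
    -- The two half-length transforms work on disjoint registers, so both can be expressed in the
    -- initial state although they run one after the other.
    have e1 : ∀ k < 2 ^ m, s2 (a k) =
        ∑ i ∈ Finset.range (2 ^ m), starRingEnd ℂ (phase m fl i k) * s (a i) := fun k hk => by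
      rw [u2 _ (hns _ (lt_two_pow_succ hk)) fun j hj => ha.low_ne_high hk hj, l1 k hk]
    have e2 : ∀ k < 2 ^ m, s2 (a (k + 2 ^ m)) = ∑ i ∈ Finset.range (2 ^ m),
        starRingEnd ℂ (phase m fl i k) * s (a (i + 2 ^ m)) := fun k hk => by
      rw [u1 k hk]
      refine Finset.sum_congr rfl fun i hi => ?_
      rw [Finset.mem_range] at hi
      rw [l2 _ (hns _ (add_two_pow_lt hi)) fun j hj => (ha.low_ne_high hj hi).symm]
    constructor
    · intro k hk
      rcases lt_two_pow_succ_cases hk with hk | ⟨j, hj, rfl⟩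
      · rw [b1 k hk, e1 k hk, e2 k hk, sum_range_two_pow_succ, Finset.mul_sum]
        congr 1 <;> refine Finset.sum_congr rfl fun i hi => ?_ <;> rw [Finset.mem_range] at hi
        · rw [phase_succ_low_low fl hi]
        · rw [phase_succ_high_low fl hi hk, map_mul, Complex.conj_conj]; ring
      · rw [b2 j hj, e1 j hj, e2 j hj, sum_range_two_pow_succ, Finset.mul_sum, sub_eq_add_neg,
          ← Finset.sum_neg_distrib]
        congr 1 <;> refine Finset.sum_congr rfl fun i hi => ?_ <;> rw [Finset.mem_range] at hi
        · rw [phase_succ_low_high fl hi]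
        · rw [phase_succ_high_high fl hi hj, map_neg, map_mul, Complex.conj_conj]; ring
    · intro r hr h
      rw [b3 r hr h, u2 r hr fun j hj => h _ (add_two_pow_lt hj),
        l2 r hr fun j hj => h _ (lt_two_pow_succ hj)]

/-- The backward program computes the product with `√(2 ^ m) V_m`. -/
theorem run_bwd (fl : Flavour) (m : ℕ) : ∀ (a : ℕ → Reg L), IsArray m a → ∀ s : State L,
    (∀ i < 2 ^ m, run κ (bwd fl m a) s (a i) =
      ∑ k ∈ Finset.range (2 ^ m), phase m fl i k * s (a k)) ∧
    ∀ r, ¬ IsScratch r → (∀ j < 2 ^ m, r ≠ a j) → run κ (bwd fl m a) s r = s r := by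
  induction m with
  | zero =>
    intro a ha s
    refine ⟨fun k hk => ?_, fun r _ _ => rfl⟩
    obtain rfl : k = 0 := by simpa using hk
    simp [bwd, phase_zero_col]
  | succ m ih =>
    intro a ha s
    have hns : ∀ j < 2 ^ (m + 1), ¬ IsScratch (a j) := fun j hj h =>
      h.elim (ha.ne_tw j hj) (ha.ne_tmp j hj)
    simp only [bwd, run_append]
    -- By the recursion, low rows see the sum of the two halves of the input and high rows the
    -- twiddled difference; hence the butterflies precede the half-length transforms here.
    obtain ⟨b1, b2, b3⟩ := run_butterflies (κ := κ) ha
      (fun j => [.sub .tmp (a j) (a (j + 2 ^ m)), .add (a j) (a j) (a (j + 2 ^ m)),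
        .const .tw (starRingEnd ℂ (twiddle m fl j)), .mul (a (j + 2 ^ m)) .tw .tmp])
      (fun j x y => x + y) (fun j x y => starRingEnd ℂ (twiddle m fl j) * (x - y))
      (by
        intro j hj s r h h' h''
        rw [IsScratch, not_or] at h''
        simp [Instr.exec, h, h', h''.1, h''.2])
      (by
        intro j hj s
        have := ha.low_ne_high hj hj
        have := ha.ne_tw _ (add_two_pow_lt hj)
        have := ha.ne_tmp _ (add_two_pow_lt hj)
        have := ha.ne_tw _ (lt_two_pow_succ hj)
        have := ha.ne_tmp _ (lt_two_pow_succ hj)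
        simp [Instr.exec, *, Ne.symm])
      (by
        intro j hj s
        have := (ha.low_ne_high hj hj).symm
        have := ha.ne_tw _ (add_two_pow_lt hj)
        have := ha.ne_tmp _ (add_two_pow_lt hj)
        have := ha.ne_tw _ (lt_two_pow_succ hj)
        have h := ha.ne_tmp _ (lt_two_pow_succ hj)
        simp [Instr.exec, *, h.symm]) s
    set s1 := run κ ((List.range (2 ^ m)).flatMap _) s
    obtain ⟨l1, l2⟩ := ih a ha.low s1
    set s2 := run κ (bwd fl m a) s1
    obtain ⟨u1, u2⟩ := ih _ ha.high s2
    have e1 : ∀ i < 2 ^ m, run κ (bwd fl m fun k => a (k + 2 ^ m)) s2 (a i) =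
        ∑ k ∈ Finset.range (2 ^ m), phase m fl i k * (s (a k) + s (a (k + 2 ^ m))) := fun i hi => by
      rw [u2 _ (hns _ (lt_two_pow_succ hi)) fun j hj => ha.low_ne_high hi hj, l1 i hi]
      exact Finset.sum_congr rfl fun k hk => by rw [b1 k (Finset.mem_range.1 hk)]
    have e2 : ∀ i < 2 ^ m, run κ (bwd fl m fun k => a (k + 2 ^ m)) s2 (a (i + 2 ^ m)) =
        ∑ k ∈ Finset.range (2 ^ m), phase m fl i k *
          (starRingEnd ℂ (twiddle m fl k) * (s (a k) - s (a (k + 2 ^ m)))) := fun i hi => by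
      rw [u1 i hi]
      refine Finset.sum_congr rfl fun k hk => ?_
      rw [Finset.mem_range] at hk
      rw [l2 _ (hns _ (add_two_pow_lt hk)) fun j hj => (ha.low_ne_high hj hk).symm, b2 k hk]
    constructor
    · intro i hi
      rcases lt_two_pow_succ_cases hi with hi | ⟨j, hj, rfl⟩
      · rw [e1 i hi, sum_range_two_pow_succ, ← Finset.sum_add_distrib]
        refine Finset.sum_congr rfl fun k hk => ?_
        rw [phase_succ_low_low fl hi, phase_succ_low_high fl hi, mul_add]
      · rw [e2 j hj, sum_range_two_pow_succ, ← Finset.sum_add_distrib]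
        refine Finset.sum_congr rfl fun k hk => ?_
        rw [Finset.mem_range] at hk
        rw [phase_succ_high_low fl hj hk, phase_succ_high_high fl hj hk]
        ring
    · intro r hr h
      rw [u2 r hr fun j hj => h _ (add_two_pow_lt hj),
        l2 r hr fun j hj => h _ (lt_two_pow_succ hj), b3 r hr h]

/-- The factor in `.tw` is loaded once and read by every pass, so its value is part of the invariant
in the induction on the number of passes. -/
theorem run_scale (m : ℕ) (a : ℕ → Reg L) (ha : IsArray m a) (s : State L) :
    (∀ k < 2 ^ m, run κ (scale m a) s (a k) = ((√((2 : ℝ) ^ m))⁻¹ : ℂ) * s (a k)) ∧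
    ∀ r, ¬ IsScratch r → (∀ j < 2 ^ m, r ≠ a j) → run κ (scale m a) s r = s r := by
  suffices H : ∀ n ≤ 2 ^ m,
      (∀ k < 2 ^ m, run κ (.const .tw ((√((2 : ℝ) ^ m))⁻¹ : ℂ) ::
        (List.range n).map fun k => .mul (a k) .tw (a k)) s (a k) =
          if k < n then ((√((2 : ℝ) ^ m))⁻¹ : ℂ) * s (a k) else s (a k)) ∧
      run κ (.const .tw ((√((2 : ℝ) ^ m))⁻¹ : ℂ) ::
        (List.range n).map fun k => .mul (a k) .tw (a k)) s .tw = ((√((2 : ℝ) ^ m))⁻¹ : ℂ) ∧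
      ∀ r, ¬ IsScratch r → (∀ j < 2 ^ m, r ≠ a j) → run κ (.const .tw ((√((2 : ℝ) ^ m))⁻¹ : ℂ) ::
        (List.range n).map fun k => .mul (a k) .tw (a k)) s r = s r by
    obtain ⟨h1, -, h3⟩ := H _ le_rfl
    exact ⟨fun k hk => by rw [scale, h1 k hk, if_pos hk], h3⟩
  intro n
  induction n with
  | zero =>
    intro _
    refine ⟨fun k hk => ?_, ?_, fun r hr h => ?_⟩
    · simp [Instr.exec, ha.ne_tw k hk]
    · simp [Instr.exec]
    · rw [IsScratch, not_or] at hr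
      simp [Instr.exec, hr.1]
  | succ n ih =>
    intro hn
    obtain ⟨h1, h2, h3⟩ := ih (by omega)
    simp only [List.range_succ, List.map_append, List.map_cons, List.map_nil, ← List.cons_append,
      run_append]
    refine ⟨fun k hk => ?_, ?_, fun r hr h => ?_⟩
    · rcases eq_or_ne k n with rfl | hkn
      · simp only [run_cons] at h1 h2
        simp only [run_cons, run_nil, Instr.exec] at h1 h2 ⊢
        rw [Function.update_self, h2, h1 k hk]
        simp
      · have hne : a k ≠ a n := fun e => hkn (ha.inj k hk n hn e)
        rw [run_cons (Instr.mul (a n) .tw (a n)), run_nil, Instr.exec, Function.update_of_ne hne,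
          h1 k hk]
        have : k < n + 1 ↔ k < n := by omega
        simp only [this]
    · rw [run_cons (Instr.mul (a n) .tw (a n)), run_nil, Instr.exec,
        Function.update_of_ne (ha.ne_tw n hn).symm, h2]
    · rw [run_cons (Instr.mul (a n) .tw (a n)), run_nil, Instr.exec,
        Function.update_of_ne (h n hn), h3 r hr h]

end FastTransforms

/-! ### Correctness of the programs that form `Λ` and multiply by it. -/

section FormAndMultiply

variable {L : ℕ} {κ : Fin L → ℕ → Fin L → ℕ → ℝ}

/-- A loop whose passes are independent, with one target register `t a` for every pass. -/
theorem run_flatMap_single {α : Type*} (t : α → Reg L) (T : Reg L → Prop)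
    (P : α → Prog L) (val : α → ℂ) (xs : List α) (s₀ : State L) (hnd : xs.Nodup)
    (ht : ∀ a ∈ xs, ∀ b ∈ xs, t a = t b → a = b)
    (hT : ∀ a ∈ xs, ¬ T (t a))
    (hframe : ∀ a ∈ xs, ∀ s r, r ≠ t a → ¬ T r → run κ (P a) s r = s r)
    (hval : ∀ a ∈ xs, ∀ s, (∀ r, ¬ T r → (∀ b ∈ xs, b ≠ a → r ≠ t b) → s r = s₀ r) →
      run κ (P a) s (t a) = val a) :
    (∀ a ∈ xs, run κ (xs.flatMap P) s₀ (t a) = val a) ∧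
      ∀ r, ¬ T r → (∀ a ∈ xs, r ≠ t a) → run κ (xs.flatMap P) s₀ r = s₀ r := by
  obtain ⟨h1, h2⟩ := run_flatMap_indep (κ := κ) (fun a r => r = t a) T P (fun a _ => val a) xs s₀ hnd
    (fun a ha b hb r h h' => ht a ha b hb (h.symm.trans h')) (fun a ha r h => h ▸ hT a ha)
    hframe (fun a ha s hs r hr => hr ▸ hval a ha s hs)
  exact ⟨fun a ha => h1 a ha _ rfl, h2⟩

theorem nodup_finRange_product (L : ℕ) : (List.finRange L ×ˢ List.finRange L).Nodup :=
  (List.nodup_finRange L).product (List.nodup_finRange L)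

theorem isArray_lam (m : ℕ) (l l' : Fin L) : IsArray m (Reg.lam l l') :=
  ⟨fun i _ j _ h => by simpa using h, by simp, by simp⟩

theorem isArray_vec (m : ℕ) (l : Fin L) : IsArray m (Reg.vec l) :=
  ⟨fun i _ j _ h => by simpa using h, by simp, by simp⟩

theorem isArray_out (m : ℕ) (l : Fin L) : IsArray m (Reg.out l) :=
  ⟨fun i _ j _ h => by simpa using h, by simp, by simp⟩

theorem divFree_formProg (fl : Flavour) (L m : ℕ) : DivFree (formProg fl L m) := by
  refine divFree_flatMap fun l _ => divFree_flatMap fun l' _ => ?_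
  simp only [divFree_append]
  refine ⟨⟨divFree_map fun i _ => by simp, ?_⟩, divFree_fwd _ _ _⟩
  split_ifs <;> simp

/-- One block of the evaluation of `Λ`. -/
theorem run_formProg_block (fl : Flavour) (m : ℕ) (l l' : Fin L) (s : State L) :
    (∀ k < 2 ^ m, run κ (((List.range (2 ^ m)).map fun i => .ker (.lam l l' i) l i l' 0) ++
      (if l = l' then [.add (.lam l l' 0) (.lam l l' 0) (.xi l)] else []) ++
      fwd fl m (.lam l l')) s (.lam l l' k) =
        ∑ i ∈ Finset.range (2 ^ m), starRingEnd ℂ (phase m fl i k) *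
          ((κ l i l' 0 : ℂ) + if l = l' ∧ i = 0 then s (.xi l) else 0)) ∧
    ∀ r, ¬ IsScratch r → (∀ k < 2 ^ m, r ≠ .lam l l' k) →
      run κ (((List.range (2 ^ m)).map fun i => .ker (.lam l l' i) l i l' 0) ++
      (if l = l' then [.add (.lam l l' 0) (.lam l l' 0) (.xi l)] else []) ++
      fwd fl m (.lam l l')) s r = s r := by
  simp only [run_append, map_eq_flatMap_singleton]
  obtain ⟨k1, k2⟩ := run_flatMap_single (κ := κ) (Reg.lam l l') IsScratch
    (fun i => [.ker (.lam l l' i) l i l' 0]) (fun i => (κ l i l' 0 : ℂ)) (List.range (2 ^ m)) s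
    List.nodup_range (by simp) (by simp [IsScratch])
    (fun i _ s r hr _ => by simp [Instr.exec, hr]) (fun i _ s _ => by simp [Instr.exec])
  set s1 := run κ ((List.range (2 ^ m)).flatMap fun i => [.ker (.lam l l' i) l i l' 0]) s
  have e : (∀ i < 2 ^ m, run κ (if l = l' then [.add (.lam l l' 0) (.lam l l' 0) (.xi l)] else []) s1
        (.lam l l' i) = (κ l i l' 0 : ℂ) + if l = l' ∧ i = 0 then s (.xi l) else 0) ∧
      ∀ r, r ≠ .lam l l' 0 →
        run κ (if l = l' then [.add (.lam l l' 0) (.lam l l' 0) (.xi l)] else []) s1 r = s1 r := by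
    have hx : s1 (.xi l) = s (.xi l) := k2 _ (by simp [IsScratch]) (by simp)
    by_cases hl : l = l'
    · subst hl
      refine ⟨fun i hi => ?_, fun r hr => by simp [Instr.exec, hr]⟩
      have h0 := k1 i (List.mem_range.2 hi)
      rcases eq_or_ne i 0 with rfl | hi0
      · simp [Instr.exec, h0, hx]
      · simp [Instr.exec, h0, hi0]
    · exact ⟨fun i hi => by simp [hl, k1 i (List.mem_range.2 hi)], fun r hr => by simp [hl]⟩
  obtain ⟨f1, f2⟩ := run_fwd (κ := κ) fl m _ (isArray_lam m l l')
    (run κ (if l = l' then [.add (.lam l l' 0) (.lam l l' 0) (.xi l)] else []) s1)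
  refine ⟨fun k hk => ?_, fun r hr h => ?_⟩
  · rw [f1 k hk]
    exact Finset.sum_congr rfl fun i hi => by rw [e.1 i (Finset.mem_range.1 hi)]
  · rw [f2 r hr h, e.2 r (h 0 (by positivity)),
      k2 r hr fun i hi => h i (List.mem_range.1 hi)]

theorem run_formProg (fl : Flavour) (m : ℕ) (l l' : Fin L) (s : State L) (k : ℕ) (hk : k < 2 ^ m) :
    run κ (formProg fl L m) s (.lam l l' k) =
        ∑ i ∈ Finset.range (2 ^ m), starRingEnd ℂ (phase m fl i k) *
          ((κ l i l' 0 : ℂ) + if l = l' ∧ i = 0 then s (.xi l) else 0) := by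
  simp only [formProg]
  rw [flatMap_product]
  refine (run_flatMap_indep (κ := κ) (fun p r => ∃ k < 2 ^ m, r = Reg.lam p.1 p.2 k) IsScratch _
    -- The index `k` is read off from the register name. The default value is never used, because a
    -- pass only owns registers `.lam`.
    (fun p r => match r with
      | .lam _ _ k => ∑ i ∈ Finset.range (2 ^ m), starRingEnd ℂ (phase m fl i k) *
          ((κ p.1 i p.2 0 : ℂ) + if p.1 = p.2 ∧ i = 0 then s (.xi p.1) else 0)
      | _ => 0) _ s (nodup_finRange_product L) ?_ ?_ ?_ ?_).1 (l, l') (by simp [List.mem_product]) _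
      ⟨k, hk, rfl⟩
  · rintro ⟨a, b⟩ _ ⟨a', b'⟩ _ r ⟨k, _, rfl⟩ ⟨k', _, h⟩
    simp_all
  · rintro _ _ r ⟨k, _, rfl⟩
    simp [IsScratch]
  · rintro ⟨a, b⟩ _ s r h hr
    push Not at h
    exact (run_formProg_block fl m a b s).2 r hr h
  · rintro ⟨a, b⟩ _ s' hs r ⟨k, hk, rfl⟩
    rw [(run_formProg_block fl m a b s').1 k hk, hs (.xi a) (by simp [IsScratch]) (by simp)]

theorem divFree_mulProg (fl : Flavour) (m : ℕ) (mat : Fin L → Fin L → ℕ → Reg L) :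
    DivFree (mulProg fl L m mat) := by
  simp only [mulProg, divFree_append]
  refine ⟨⟨divFree_flatMap fun l _ => ?_, divFree_flatMap fun l _ => divFree_flatMap fun k _ => ?_⟩,
    divFree_flatMap fun l _ => ?_⟩
  · simp [divFree_fwd, divFree_scale]
  · rw [divFree_cons]
    exact ⟨by simp, divFree_flatMap fun l' _ => by simp⟩
  · simp [divFree_bwd, divFree_scale]

/-- A transform followed by scaling, on every array of a family. -/
theorem run_transform_family (m : ℕ) (a : Fin L → ℕ → Reg L) (ha : ∀ l, IsArray m (a l))
    (hdisj : ∀ l l' i j, a l i = a l' j → l = l' ∧ i = j) (P : Fin L → Prog L) (M : ℕ → ℕ → ℂ)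
    (hP : ∀ l (s : State L), (∀ k < 2 ^ m, run κ (P l) s (a l k) =
        ∑ i ∈ Finset.range (2 ^ m), M k i * s (a l i)) ∧
      ∀ r, ¬ IsScratch r → (∀ j < 2 ^ m, r ≠ a l j) → run κ (P l) s r = s r) (s : State L) :
    (∀ l, ∀ k < 2 ^ m,
      run κ ((List.finRange L).flatMap fun l => P l ++ scale m (a l)) s (a l k) =
        ((√((2 : ℝ) ^ m))⁻¹ : ℂ) * ∑ i ∈ Finset.range (2 ^ m), M k i * s (a l i)) ∧
    ∀ r, ¬ IsScratch r → (∀ l k, r ≠ a l k) →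
      run κ ((List.finRange L).flatMap fun l => P l ++ scale m (a l)) s r = s r := by
  classical
  obtain ⟨h1, h2⟩ := run_flatMap_indep (κ := κ) (fun l r => ∃ k < 2 ^ m, r = a l k) IsScratch
    (fun l => P l ++ scale m (a l))
    -- The index of a register is recovered by choice; injectivity of the array makes the choice the
    -- right one.
    (fun l r => if h : ∃ k < 2 ^ m, r = a l k then
      ((√((2 : ℝ) ^ m))⁻¹ : ℂ) * ∑ i ∈ Finset.range (2 ^ m), M h.choose i * s (a l i) else 0)
    (List.finRange L) s (List.nodup_finRange L)
    (by
      rintro l _ l' _ r ⟨k, _, rfl⟩ ⟨k', _, h⟩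
      exact (hdisj _ _ _ _ h).1)
    (by
      rintro l _ r ⟨k, hk, rfl⟩ h
      exact h.elim ((ha l).ne_tw k hk) ((ha l).ne_tmp k hk))
    (by
      intro l _ s r h hr
      push Not at h
      rw [run_append, (run_scale m _ (ha l) _).2 r hr h, (hP l s).2 r hr h])
    (by
      intro l _ s' hs r hr
      have hc := hr.choose_spec
      rw [dif_pos hr]
      conv_lhs => rw [hc.2]
      rw [run_append, (run_scale m _ (ha l) _).1 _ hc.1, (hP l s').1 _ hc.1]
      congr 1
      refine Finset.sum_congr rfl fun i hi => ?_
      rw [Finset.mem_range] at hi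
      rw [hs]
      · exact fun h => h.elim ((ha l).ne_tw i hi) ((ha l).ne_tmp i hi)
      · rintro b _ hb ⟨k, _, h⟩
        exact hb (hdisj _ _ _ _ h).1.symm)
  refine ⟨fun l k hk => ?_, fun r hr h => h2 r hr fun l _ => ?_⟩
  · have hex : ∃ k' < 2 ^ m, a l k = a l k' := ⟨k, hk, rfl⟩
    rw [h1 l (List.mem_finRange l) _ hex, dif_pos hex]
    have := (ha l).inj _ hk _ hex.choose_spec.1 hex.choose_spec.2
    rw [← this]
  · rintro ⟨k, _, e⟩
    exact h l k e

theorem bigV_apply (fl : Flavour) (m : ℕ) (p q : Fin L × Fin (2 ^ m)) :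
    bigV fl L m p q =
      if p.1 = q.1 then ((√((2 : ℝ) ^ m))⁻¹ : ℂ) * phase m fl p.2 q.2 else 0 := by
  rw [bigV]
  refine (Matrix.kroneckerMap_apply _ _ _ _ _).trans ?_
  rw [Matrix.one_apply, transform_apply]
  split_ifs <;> simp

theorem bigV_mulVec (fl : Flavour) (m : ℕ) (y : Fin L × Fin (2 ^ m) → ℂ) (l : Fin L)
    (i : Fin (2 ^ m)) :
    (bigV fl L m).mulVec y (l, i) =
      ((√((2 : ℝ) ^ m))⁻¹ : ℂ) * ∑ k : Fin (2 ^ m), phase m fl i k * y (l, k) := by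
  simp only [Matrix.mulVec, dotProduct, Fintype.sum_prod_type, bigV_apply]
  rw [Finset.sum_eq_single l (fun b _ hb => by simp [hb.symm]) (by simp), Finset.mul_sum]
  exact Finset.sum_congr rfl fun k _ => by rw [if_pos rfl, mul_assoc]

theorem bigV_conjTranspose_mulVec (fl : Flavour) (m : ℕ) (y : Fin L × Fin (2 ^ m) → ℂ) (l : Fin L)
    (k : Fin (2 ^ m)) :
    (bigV fl L m).conjTranspose.mulVec y (l, k) =
      ((√((2 : ℝ) ^ m))⁻¹ : ℂ) * ∑ i : Fin (2 ^ m), starRingEnd ℂ (phase m fl i k) * y (l, i) := by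
  simp only [Matrix.mulVec, dotProduct, Fintype.sum_prod_type, Matrix.conjTranspose_apply, bigV_apply]
  rw [Finset.sum_eq_single l (fun b _ hb => by simp [hb]) (by simp), Finset.mul_sum]
  refine Finset.sum_congr rfl fun i _ => ?_
  rw [if_pos rfl, ← starRingEnd_apply, map_mul, map_inv₀, Complex.conj_ofReal, mul_assoc]

theorem ofDiagBlocks_mulVec {n : ℕ} (a : Fin L → Fin L → ℕ → ℂ) (y : Fin L × Fin n → ℂ) (l : Fin L)
    (k : Fin n) : (ofDiagBlocks a).mulVec y (l, k) = ∑ l', a l l' k * y (l', k) := by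
  simp only [Matrix.mulVec, dotProduct, Fintype.sum_prod_type, ofDiagBlocks, Matrix.of_apply]
  refine Finset.sum_congr rfl fun l' _ => ?_
  rw [Finset.sum_eq_single k (fun b _ hb => by simp [hb.symm]) (by simp), if_pos rfl]

/-- The multiplication program computes the product with `V M Vᴴ`. -/
theorem run_mulProg (fl : Flavour) (m : ℕ) (mat : Fin L → Fin L → ℕ → Reg L)
    (hscr : ∀ l l' k, ¬ IsScratch (mat l l' k)) (hvec : ∀ l l' k j i, mat l l' k ≠ .vec j i)
    (hout : ∀ l l' k j i, mat l l' k ≠ .out j i) (s : State L) (l : Fin L) (k : Fin (2 ^ m)) :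
    run κ (mulProg fl L m mat) s (.out l k) =
      ((bigV fl L m) * ofDiagBlocks (fun l l' k => s (mat l l' k)) *
        (bigV fl L m).conjTranspose).mulVec (fun p => s (.vec p.1 p.2)) (l, k) := by
  rw [← Matrix.mulVec_mulVec, ← Matrix.mulVec_mulVec, bigV_mulVec]
  simp only [ofDiagBlocks_mulVec, bigV_conjTranspose_mulVec]
  simp only [mulProg, run_append]
  obtain ⟨v1, v2⟩ := run_transform_family (κ := κ) m Reg.vec (isArray_vec m)
    (by simp) (fun l => fwd fl m (.vec l))
    (fun k i => starRingEnd ℂ (phase m fl i k)) (fun l s => run_fwd fl m _ (isArray_vec m l) s) s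
  set s1 := run κ ((List.finRange L).flatMap fun l => fwd fl m (.vec l) ++ scale m (.vec l)) s
  rw [flatMap_product]
  have hbody : ∀ (p : Fin L × ℕ) (s : State L),
      run κ (.const (.out p.1 p.2) 0 :: (List.finRange L).flatMap fun l' =>
        [.mul .tmp (mat p.1 l' p.2) (.vec l' p.2), .add (.out p.1 p.2) (.out p.1 p.2) .tmp]) s
        (.out p.1 p.2) = ∑ l', s (mat p.1 l' p.2) * s (.vec l' p.2) ∧
      ∀ r, r ≠ .out p.1 p.2 → ¬ IsScratch r →
        run κ (.const (.out p.1 p.2) 0 :: (List.finRange L).flatMap fun l' =>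
        [.mul .tmp (mat p.1 l' p.2) (.vec l' p.2), .add (.out p.1 p.2) (.out p.1 p.2) .tmp]) s r =
          s r := by
    intro p s
    rw [run_cons]
    obtain ⟨h1, h2⟩ := run_accumulate (κ := κ) (.out p.1 p.2) (fun l' => mat p.1 l' p.2)
      (fun l' => .vec l' p.2) (List.finRange L) (Instr.exec κ s (.const (.out p.1 p.2) 0)) (by simp)
      (fun l' => ⟨fun h => hscr _ _ _ (Or.inr h), hout _ _ _ _ _⟩) (by simp)
    constructor
    · rw [h1, Fin.sum_univ_def]
      simp [Instr.exec, hout]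
    · intro r hr hs
      rw [h2 r hr fun e => hs (Or.inr e)]
      simp [Instr.exec, hr]
  obtain ⟨d1, d2⟩ := run_flatMap_single (κ := κ) (fun p : Fin L × ℕ => Reg.out p.1 p.2) IsScratch
    (fun p => .const (.out p.1 p.2) 0 :: (List.finRange L).flatMap fun l' =>
        [.mul .tmp (mat p.1 l' p.2) (.vec l' p.2), .add (.out p.1 p.2) (.out p.1 p.2) .tmp])
    (fun p => ∑ l', s1 (mat p.1 l' p.2) * s1 (.vec l' p.2))
    (List.finRange L ×ˢ List.range (2 ^ m)) s1 ((List.nodup_finRange L).product List.nodup_range)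
    (by
      rintro ⟨a, b⟩ _ ⟨a', b'⟩ _ h
      simpa using h)
    (by simp [IsScratch]) (fun p _ s => (hbody p s).2)
    (by
      intro p _ s' hs
      rw [(hbody p s').1]
      refine Finset.sum_congr rfl fun l' _ => ?_
      rw [hs _ (hscr _ _ _) fun _ _ _ => hout _ _ _ _ _,
        hs _ (by simp [IsScratch]) fun _ _ _ => by simp])
  set s2 := run κ ((List.finRange L ×ˢ List.range (2 ^ m)).flatMap _) s1
  rw [(run_transform_family (κ := κ) m Reg.out (isArray_out m)
    (by simp) (fun l => bwd fl m (.out l))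
    (fun i k => phase m fl i k) (fun l s => run_bwd fl m _ (isArray_out m l) s) s2).1 l k k.2,
    Finset.sum_range]
  congr 1
  refine Finset.sum_congr rfl fun i _ => ?_
  rw [d1 (l, (i : ℕ)) (by simp [List.mem_product])]
  congr 1
  refine Finset.sum_congr rfl fun l' _ => ?_
  -- The matrix registers survive the transform of the input vector because they are neither scratch
  -- registers nor entries of `vec`.
  rw [v1 l' i i.2, v2 _ (hscr _ _ _) fun _ _ => hvec _ _ _ _ _, Finset.sum_range]

end FormAndMultiply

/-! ### Block diagonalisation of the Gram matrix. -/

section Diagonalisation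

/-! ### Binary digits -/

/-- Some digit is zero, so the value is strictly below that of the all-ones expansion, which is at
most one. -/
theorem ofDigits_lt_one {a : ℕ → Fin 2} (ha : NoOnesTail a) : Real.ofDigits a < 1 := by
  have h : ∃ p, a p = 0 := by
    by_contra! h
    exact ha ⟨0, fun p _ => by have := h p; omega⟩
  obtain ⟨p, hp⟩ := h
  have hone : Real.ofDigits (fun _ => (1 : Fin 2)) ≤ 1 := Real.ofDigits_le_one _
  refine lt_of_lt_of_le ?_ hone
  refine Summable.tsum_lt_tsum (i := p) (fun i => ?_) ?_ Real.summable_ofDigitsTerm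
    Real.summable_ofDigitsTerm
  · simp only [Real.ofDigitsTerm]
    gcongr
    omega
  · simp only [Real.ofDigitsTerm, hp]
    simp

/-- After multiplication by `2 ^ (n + 1)` the leading digits form an integer of the parity of `a n`,
and the remaining tail is strictly less than one. Strictness, which comes from the absence of a tail
of ones, makes this integer the floor. -/
theorem digits_ofDigits {a : ℕ → Fin 2} (ha : NoOnesTail a) :
    Real.digits (Real.ofDigits a) 2 = a := by
  have htail : ∀ n, NoOnesTail fun i => a (i + n) := fun n ⟨P, hP⟩ =>
    ha ⟨P + n, fun p hp => by
      have := hP (p - n) (by omega)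
      simp only [Nat.sub_add_cancel (show n ≤ p by omega)] at this
      exact this⟩
  have hN : ∀ n, ∃ N : ℕ, (2 : ℝ) ^ n * ∑ i ∈ Finset.range n, Real.ofDigitsTerm a i = N := by
    intro n
    induction n with
    | zero => exact ⟨0, by simp⟩
    | succ n ih =>
      obtain ⟨N, hN⟩ := ih
      refine ⟨2 * N + a n, ?_⟩
      rw [Finset.sum_range_succ, mul_add, pow_succ', mul_assoc, hN, Real.ofDigitsTerm]
      push_cast
      field_simp
      ring
  funext n
  obtain ⟨N, hN⟩ := hN n
  have hT := ofDigits_lt_one (htail (n + 1))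
  have hT0 := Real.ofDigits_nonneg fun i => a (i + (n + 1))
  have hx : Real.ofDigits a * (2 : ℝ) ^ (n + 1) =
      ((2 * N + (a n : ℕ) : ℕ) : ℝ) + Real.ofDigits fun i => a (i + (n + 1)) := by
    rw [Real.ofDigits_eq_sum_add_ofDigits a (n + 1), Finset.sum_range_succ]
    push_cast
    rw [← hN, Real.ofDigitsTerm]
    push_cast
    field_simp
    ring
  have hfl : ⌊Real.ofDigits a * ((2 : ℕ) : ℝ) ^ (n + 1)⌋₊ = 2 * N + (a n : ℕ) := by
    rw [Nat.cast_ofNat, hx, Nat.floor_eq_iff (by positivity)]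
    constructor <;> linarith
  apply Fin.ext
  simp only [Real.digits, hfl, Fin.val_ofNat]
  omega

theorem fin_two_add_self (x : Fin 2) : x + x = 0 := by
  fin_cases x <;> rfl

/-- Modulo two, a generating column selected by both indices cancels. The exclusive or of two points
is therefore governed by the exclusive or of their indices, while both digital shifts stay in place.
-/
theorem dseqDigits_add {d m : ℕ} (g : ℕ → Fin d → ℝ) (Δ Δ' : Fin d → ℝ) {i i' : ℕ}
    (hi : i < 2 ^ m) (hi' : i' < 2 ^ m) (j : Fin d) (q : ℕ) :
    dseqDigits g Δ i j q + dseqDigits g Δ' i' j q =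
      dseqDigits g Δ (i ^^^ i') j q + dseqDigits g Δ' 0 j q := by
  simp only [dseqDigits]
  rw [sum_testBit_size hi, sum_testBit_size hi', sum_testBit_size (Nat.xor_lt_two_pow hi hi')]
  have : ∑ p ∈ Finset.range m, (if (i ^^^ i').testBit p then Real.digits (g p j) 2 q else 0) =
      ∑ p ∈ Finset.range m, (if i.testBit p then Real.digits (g p j) 2 q else 0) +
      ∑ p ∈ Finset.range m, (if i'.testBit p then Real.digits (g p j) 2 q else 0) := by
    rw [← Finset.sum_add_distrib]
    refine Finset.sum_congr rfl fun p _ => ?_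
    rw [Nat.testBit_xor]
    cases i.testBit p <;> cases i'.testBit p <;> simp [fin_two_add_self]
  rw [this]
  simp only [Nat.size_zero, Finset.range_zero, Finset.sum_empty, zero_add]
  abel

/-! ### Group structure of the point sets -/

theorem phase_mul_conj (m : ℕ) (fl : Flavour) (i k : ℕ) :
    phase m fl i k * starRingEnd ℂ (phase m fl i k) = 1 := by
  cases fl
  · rw [conj_phase_lattice, phase, ← Complex.exp_add, add_neg_cancel, Complex.exp_zero]
  · simp only [phase, map_prod, ← Finset.prod_mul_distrib]
    refine Finset.prod_eq_one fun p _ => ?_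
    split_ifs <;> simp

/-- Equal rows would have inner product `2 ^ m`, against orthogonality. An index can thus be
identified by its row of phases, without using the group law of the flavour. -/
theorem phase_row_injective {m : ℕ} {fl : Flavour} {i i' : Fin (2 ^ m)}
    (h : ∀ k : Fin (2 ^ m), phase m fl i k = phase m fl i' k) : i = i' := by
  by_contra hne
  have h1 := sum_phase_mul_conj_phase fl m i i'
  rw [if_neg hne] at h1
  simp only [h, phase_mul_conj] at h1
  simp at h1

theorem phase_xor (m i i' k : ℕ) :
    phase m .digital (i ^^^ i') k =
      phase m .digital i k * starRingEnd ℂ (phase m .digital i' k) := by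
  simp only [phase, map_prod, ← Finset.prod_mul_distrib]
  refine Finset.prod_congr rfl fun p _ => ?_
  rw [Nat.testBit_xor]
  cases i.testBit p <;> cases i'.testBit p <;> cases k.testBit p <;> simp

/-- Points of fast designs lie in the unit cube. -/
theorem IsFastDesign.mem_cube {L d m : ℕ} {Q : (Fin d → ℝ) → (Fin d → ℝ) → ℝ}
    {X : Fin L → ℕ → Fin d → ℝ} {fl : Flavour} (h : IsFastDesign m Q X fl) (l : Fin L) {i : ℕ}
    (hi : i < 2 ^ m) : X l i ∈ cube d := by
  cases fl
  · obtain ⟨-, g, Δ, -, hX⟩ := h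
    rw [hX l i hi]
    exact fun j => ⟨Int.fract_nonneg _, Int.fract_lt_one _⟩
  · obtain ⟨-, g, Δ, -, -, hX, htail, -⟩ := h
    rw [hX l i hi]
    exact fun j => ⟨Real.ofDigits_nonneg _, ofDigits_lt_one (htail l i hi j)⟩

/-- Points and transform share an index group: `j` is the difference of `i` and `i'`. -/
theorem IsFastDesign.exists_sub {L d m : ℕ} {Q : (Fin d → ℝ) → (Fin d → ℝ) → ℝ}
    {X : Fin L → ℕ → Fin d → ℝ} {fl : Flavour} (h : IsFastDesign m Q X fl) (i i' : Fin (2 ^ m)) :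
    ∃ j : Fin (2 ^ m),
      (∀ k : ℕ, phase m fl j k = phase m fl i k * starRingEnd ℂ (phase m fl i' k)) ∧
      ∀ l l', Q (X l i) (X l' i') = Q (X l j) (X l' 0) := by
  have hcube := fun l {i} hi => h.mem_cube l (i := i) hi
  have hpos : 0 < 2 ^ m := by positivity
  cases fl
  · obtain ⟨⟨Qhat, hQ⟩, g, Δ, -, hX⟩ := h
    obtain ⟨a, ha⟩ := exists_vdc_eq m i i.2
    obtain ⟨a', ha'⟩ := exists_vdc_eq m i' i'.2
    -- The difference of two radical inverses is again a radical inverse, up to an integer `z`.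
    obtain ⟨j, hj, z, hz⟩ := exists_vdc_sub m (a - a')
    have hv : vdc i - vdc i' = vdc j + z := by
      rw [← hz]
      push_cast
      rw [← ha, ← ha']
      field_simp
    refine ⟨⟨j, hj⟩, fun k => ?_, fun l l' => ?_⟩
    · rw [conj_phase_lattice]
      simp only [phase]
      rw [← Complex.exp_add, show (2 * Real.pi * Complex.I * vdc i * k +
        -(2 * Real.pi * Complex.I * vdc i' * k) : ℂ) =
        2 * Real.pi * Complex.I * (vdc i - vdc i' : ℝ) * k by push_cast; ring, hv]
      rw [show (2 * Real.pi * Complex.I * (vdc j + z : ℝ) * k : ℂ) =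
        2 * Real.pi * Complex.I * vdc j * k + (z * k : ℤ) * (2 * Real.pi * Complex.I) by
          push_cast; ring, Complex.exp_add, Complex.exp_int_mul_two_pi_mul_I, mul_one]
    · rw [hQ _ (hcube l i.2) _ (hcube l' i'.2), hQ _ (hcube l hj) _ (hcube l' hpos)]
      congr 1
      funext t
      simp only [hX l i i.2, hX l' i' i'.2, hX l j hj, hX l' 0 hpos, latticePt]
      rw [Int.fract_eq_fract]
      have h0 : vdc 0 = 0 := by simp [vdc]
      rw [h0]
      -- The integer collects the wraparound `z`, scaled by the generating vector, and the floors
      -- removed from the four lattice coordinates.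
      refine ⟨z * g t - ⌊vdc i * g t + Δ l t⌋ + ⌊vdc i' * g t + Δ l' t⌋
        + ⌊vdc j * g t + Δ l t⌋ - ⌊0 * (g t : ℝ) + Δ l' t⌋, ?_⟩
      simp only [Int.fract]
      push_cast
      have : vdc i = vdc i' + vdc j + z := by linarith
      rw [this]
      ring
  · obtain ⟨⟨Qhat, hQ⟩, g, Δ, -, -, hX, htail, hxor⟩ := h
    have hj := Nat.xor_lt_two_pow i.2 i'.2
    refine ⟨⟨i ^^^ i', hj⟩, fun k => phase_xor _ _ _ _, fun l l' => ?_⟩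
    rw [hQ _ (hcube l i.2) _ (hcube l' i'.2) (hxor l l' i i.2 i' i'.2),
      hQ _ (hcube l hj) _ (hcube l' hpos) (hxor l l' _ hj 0 hpos)]
    congr 1
    funext t
    simp only [dxor]
    congr 1
    funext q
    -- The points are stored as real numbers; their digits can be read back because no tail of ones
    -- occurs.
    have hd : ∀ l, ∀ i < 2 ^ m, Real.digits (X l i t) 2 = dseqDigits g (Δ l) i t := fun l i hi => by
      rw [hX l i hi]
      exact digits_ofDigits (htail l i hi t)
    simp only [xorDigits]
    rw [hd l i i.2, hd l' i' i'.2, hd l _ hj, hd l' 0 hpos]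
    exact dseqDigits_add g (Δ l) (Δ l') i.2 i'.2 t q

/-- Diagonals of the blocks of `Λ`. -/
noncomputable def eigenvalue {L d : ℕ} (fl : Flavour) (m : ℕ) (R : Fin L → Fin L → ℝ)
    (Q : (Fin d → ℝ) → (Fin d → ℝ) → ℝ) (ξ : Fin L → ℝ) (X : Fin L → ℕ → Fin d → ℝ)
    (l l' : Fin L) (k : ℕ) : ℂ :=
  ∑ i ∈ Finset.range (2 ^ m), starRingEnd ℂ (phase m fl i k) *
    ((kernelAt R Q X l i l' 0 : ℂ) + if l = l' ∧ i = 0 then (ξ l : ℂ) else 0)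

/-- In row `i`, the substitution of `sub i i'` for `i'` turns the product of a block with a
character into that character at `i` times the transform of the zeroth column. So every block has
the same eigenvectors. -/
theorem gram_mul_bigV {L d m : ℕ} {fl : Flavour} (R : Fin L → Fin L → ℝ)
    {Q : (Fin d → ℝ) → (Fin d → ℝ) → ℝ} (ξ : Fin L → ℝ) {X : Fin L → ℕ → Fin d → ℝ}
    (h : IsFastDesign m Q X fl) :
    gram m R Q ξ X * bigV fl L m = bigV fl L m * ofDiagBlocks (eigenvalue fl m R Q ξ X) := by
  choose sub hphase hQ using h.exists_sub
  have hinj : ∀ i, Function.Injective (sub i) := fun i i' i'' e => by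
    refine phase_row_injective (fl := fl) fun k => ?_
    have h1 := hphase i i' k
    rw [e, hphase i i'' k] at h1
    have hne : phase m fl i k ≠ 0 := left_ne_zero_of_mul_eq_one (phase_mul_conj m fl i k)
    exact ((starRingEnd ℂ).injective (mul_left_cancel₀ hne h1)).symm
  have hpos : 0 < 2 ^ m := by positivity
  -- The noise sits on the diagonal, which is exactly where the difference of indices is zero; hence
  -- it only changes entry zero of the zeroth column.
  have hsub0 : ∀ i i', ((sub i i' : Fin (2 ^ m)) : ℕ) = 0 ↔ i = i' := fun i i' => by
    constructor
    · intro h0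
      refine phase_row_injective (fl := fl) fun k => ?_
      have h1 := hphase i i' k
      rw [h0, phase_zero_row] at h1
      have h2 := phase_mul_conj m fl i' k
      rw [h1] at h2
      have hne : starRingEnd ℂ (phase m fl i' k) ≠ 0 := right_ne_zero_of_mul_eq_one h1.symm
      exact (mul_right_cancel₀ hne h2).symm
    · rintro rfl
      have : sub i i = ⟨0, hpos⟩ := phase_row_injective (fl := fl) fun k => by
        rw [hphase i i k, phase_mul_conj, phase_zero_row]
      rw [this]
  ext ⟨l, i⟩ ⟨l', k⟩
  simp only [Matrix.mul_apply, Fintype.sum_prod_type, bigV_apply, ofDiagBlocks, Matrix.of_apply]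
  rw [Finset.sum_eq_single l' (fun b _ hb => by simp [hb]) (by simp),
    Finset.sum_eq_single l (fun b _ hb => by simp [hb.symm]) (by simp)]
  conv_rhs => rw [Finset.sum_eq_single k (fun b _ hb => by simp [hb]) (by simp)]
  simp only [if_true, eigenvalue, Finset.sum_range]
  -- For fixed `i`, an injective self-map of a finite index set is a permutation, so the eigenvalue
  -- sum may be reindexed by it.
  conv_rhs => rw [Finset.mul_sum, ← Equiv.sum_comp (Equiv.ofBijective (sub i)
    (Finite.injective_iff_bijective.1 (hinj i)))]
  refine Finset.sum_congr rfl fun i' _ => ?_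
  simp only [Equiv.ofBijective_apply, hsub0, gram, Matrix.of_apply, kernelAt, Prod.mk.injEq,
    ← hQ i i' l l', hphase, map_mul, Complex.conj_conj]
  have h1 := phase_mul_conj m fl i k
  push_cast [apply_ite ((↑) : ℝ → ℂ)]
  rw [show ((√((2 : ℝ) ^ m))⁻¹ : ℂ) * phase m fl i k *
      (starRingEnd ℂ (phase m fl i k) * phase m fl i' k *
        ((R l l' : ℂ) * (Q (X l i) (X l' i') : ℂ) + if l = l' ∧ i = i' then (ξ l : ℂ) else 0)) =
      (phase m fl i k * starRingEnd ℂ (phase m fl i k)) * (((√((2 : ℝ) ^ m))⁻¹ : ℂ) *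
       phase m fl i' k *
        ((R l l' : ℂ) * (Q (X l i) (X l' i') : ℂ) + if l = l' ∧ i = i' then (ξ l : ℂ) else 0)) by
    ring, h1, one_mul, mul_comm]

theorem lambdaMat_eq {L d m : ℕ} {fl : Flavour} (R : Fin L → Fin L → ℝ)
    {Q : (Fin d → ℝ) → (Fin d → ℝ) → ℝ} (ξ : Fin L → ℝ) {X : Fin L → ℕ → Fin d → ℝ}
    (h : IsFastDesign m Q X fl) :
    lambdaMat fl m R Q ξ X = ofDiagBlocks (eigenvalue fl m R Q ξ X) := by
  rw [lambdaMat, Matrix.mul_assoc, gram_mul_bigV R ξ h, ← Matrix.mul_assoc,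
    bigV_conjTranspose_mul_self, Matrix.one_mul]

theorem gram_eq {L d : ℕ} (fl : Flavour) (m : ℕ) (R : Fin L → Fin L → ℝ)
    (Q : (Fin d → ℝ) → (Fin d → ℝ) → ℝ) (ξ : Fin L → ℝ) (X : Fin L → ℕ → Fin d → ℝ) :
    gram m R Q ξ X = bigV fl L m * lambdaMat fl m R Q ξ X * (bigV fl L m).conjTranspose := by
  rw [lambdaMat, ← Matrix.mul_assoc, ← Matrix.mul_assoc, bigV_mul_conjTranspose_self,
    Matrix.one_mul, Matrix.mul_assoc, bigV_mul_conjTranspose_self, Matrix.mul_one]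

theorem det_lambdaMat {L d : ℕ} (fl : Flavour) (m : ℕ) (R : Fin L → Fin L → ℝ)
    (Q : (Fin d → ℝ) → (Fin d → ℝ) → ℝ) (ξ : Fin L → ℝ) (X : Fin L → ℕ → Fin d → ℝ) :
    (lambdaMat fl m R Q ξ X).det = (gram m R Q ξ X).det := by
  have h := congrArg Matrix.det (bigV_conjTranspose_mul_self fl L m)
  rw [Matrix.det_mul, Matrix.det_one] at h
  rw [lambdaMat, Matrix.det_mul, Matrix.det_mul, mul_right_comm, h, one_mul]

end Diagonalisation

/-! ### Positive definiteness of the noisy Gram matrix. -/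

section PositiveDefinite

open scoped ComplexOrder Kronecker

/-- A real positive definite matrix is `Bᴴ B` with `B` invertible, and both the factorisation and
invertibility persist over the complex numbers. -/
theorem posDef_map_ofReal {ι : Type*} [Fintype ι] [DecidableEq ι] {M : Matrix ι ι ℝ}
    (hM : M.PosDef) : (M.map ((↑) : ℝ → ℂ)).PosDef := by
  obtain ⟨B, hB, rfl⟩ : ∃ B : Matrix ι ι ℝ, IsUnit B ∧ M = B.conjTranspose * B := by
    open scoped MatrixOrder in
    obtain ⟨B, hB⟩ := CStarAlgebra.nonneg_iff_eq_star_mul_self.mp hM.posSemidef.nonneg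
    refine ⟨B, ?_, hB⟩
    have h := hM.isUnit
    rw [hB] at h
    exact (Matrix.isUnit_iff_isUnit_det _).2
      (isUnit_of_mul_isUnit_right (by simpa using (Matrix.isUnit_iff_isUnit_det _).1 h))
  have hmap : ((B.conjTranspose * B).map ((↑) : ℝ → ℂ)) =
      (B.map ((↑) : ℝ → ℂ)).conjTranspose * B.map ((↑) : ℝ → ℂ) := by
    ext i j
    simp [Matrix.mul_apply]
  rw [hmap]
  have hu : IsUnit (B.map ((↑) : ℝ → ℂ)) := hB.map (Complex.ofRealHom.mapMatrix (m := ι))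
  exact Matrix.PosDef.conjTranspose_mul_self _ (Matrix.mulVec_injective_iff_isUnit.2 hu)

theorem IsSPDOn.posDef {α ι : Type*} [Fintype ι] [DecidableEq ι] {S : Set α} {K : α → α → ℝ}
    (h : IsSPDOn S K) {x : ι → α} (hx : ∀ i, x i ∈ S) (hinj : Function.Injective x) :
    (Matrix.of fun i j => K (x i) (x j)).PosDef := by
  refine Matrix.PosDef.of_dotProduct_mulVec_pos ?_ fun c hc => ?_
  · ext i j
    simp [h.1 _ (hx i) _ (hx j)]
  · let e := (Fintype.equivFin ι).symm
    have := h.2 _ (x ∘ e) (c ∘ e) (fun i => hx _) (hinj.comp e.injective)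
      (fun h0 => hc (funext fun i => by
        have := congrFun h0 (e.symm i)
        simpa using this))
    convert! this using 1
    simp only [dotProduct, Matrix.mulVec, Finset.mul_sum, Matrix.of_apply, star_trivial,
      Function.comp_apply]
    rw [← Equiv.sum_comp e]
    refine Finset.sum_congr rfl fun i _ => ?_
    rw [← Equiv.sum_comp e]
    exact Finset.sum_congr rfl fun j _ => by ring

/-- The real noisy Gram matrix. -/
noncomputable def realGram {L d : ℕ} (m : ℕ) (R : Fin L → Fin L → ℝ)
    (Q : (Fin d → ℝ) → (Fin d → ℝ) → ℝ) (ξ : Fin L → ℝ) (X : Fin L → ℕ → Fin d → ℝ) :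
    Matrix (Fin L × Fin (2 ^ m)) (Fin L × Fin (2 ^ m)) ℝ :=
  Matrix.of fun p q => kernelAt R Q X p.1 p.2 q.1 q.2 + if p = q then ξ p.1 else 0

/-- Points may coincide across tasks and, in noisy tasks, within one task, so positivity of `Q`
cannot be applied to the list of points. The coefficients are first summed over equal points of each
task; the resulting weights `w` belong to pairs of a task and a distinct point, where the Kronecker
product of the two kernel matrices is positive definite. -/
theorem realGram_posDef {L d m : ℕ} {R : Fin L → Fin L → ℝ}
    {Q : (Fin d → ℝ) → (Fin d → ℝ) → ℝ} {ξ : Fin L → ℝ} {X : Fin L → ℕ → Fin d → ℝ}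
    (hR : IsSPDOn Set.univ R) (hQ : IsSPDOn (cube d) Q) (hξ : ∀ l, 0 ≤ ξ l)
    (hX : ∀ l, ∀ i < 2 ^ m, X l i ∈ cube d)
    (hdist : ∀ l, 0 < ξ l ∨ Set.InjOn (X l) (Set.Iio (2 ^ m))) :
    (realGram m R Q ξ X).PosDef := by
  classical
  refine Matrix.PosDef.of_dotProduct_mulVec_pos ?_ fun c hc => ?_
  · ext p q
    simp only [realGram, Matrix.conjTranspose_apply, Matrix.of_apply, kernelAt, star_trivial,
      hR.1 q.1 trivial p.1 trivial, hQ.1 _ (hX q.1 q.2 q.2.2) _ (hX p.1 p.2 p.2.2)]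
    rcases eq_or_ne p q with rfl | hpq
    · rfl
    · simp [hpq, hpq.symm]
  · let S : Finset (Fin d → ℝ) := Finset.univ.image fun p : Fin L × Fin (2 ^ m) => X p.1 p.2
    have hS : ∀ x ∈ S, x ∈ cube d := by
      intro x hx
      obtain ⟨p, -, rfl⟩ := Finset.mem_image.1 hx
      exact hX _ _ p.2.2
    have hpt : ∀ p : Fin L × Fin (2 ^ m), X p.1 p.2 ∈ S := fun p =>
      Finset.mem_image.2 ⟨p, Finset.mem_univ _, rfl⟩
    -- total weight of task `l` at every distinct point
    let w : Fin L × S → ℝ := fun r => ∑ i : Fin (2 ^ m), if X r.1 i = r.2 then c (r.1, i) else 0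
    have hRQ := (hR.posDef (x := fun l : Fin L => l) (fun _ => trivial)
      Function.injective_id).kronecker
      (hQ.posDef (x := fun x : S => (x : Fin d → ℝ)) (fun x => hS x x.2) Subtype.val_injective)
    have hcollapse : ∀ (l : Fin L) (f : (Fin d → ℝ) → ℝ),
        ∑ i : Fin (2 ^ m), c (l, i) * f (X l i) = ∑ x : S, w (l, x) * f x := by
      intro l f
      simp only [w, Finset.sum_mul]
      rw [Finset.sum_comm]
      refine Finset.sum_congr rfl fun i _ => ?_
      rw [Finset.sum_eq_single (⟨X l i, hpt (l, i)⟩ : S)]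
      · simp
      · intro b _ hb
        rw [if_neg, zero_mul]
        exact fun e => hb (Subtype.ext e.symm)
      · simp
    have hform : star c ⬝ᵥ (realGram m R Q ξ X).mulVec c =
        star w ⬝ᵥ ((Matrix.of fun i j : Fin L => R i j) ⊗ₖ
          (Matrix.of fun x y : S => Q x y)).mulVec w + ∑ p, ξ p.1 * c p ^ 2 := by
      have e1 : star c ⬝ᵥ (realGram m R Q ξ X).mulVec c =
          (∑ l, ∑ l', R l l' * ∑ i : Fin (2 ^ m), c (l, i) *
            ∑ i' : Fin (2 ^ m), c (l', i') * Q (X l i) (X l' i')) + ∑ p, ξ p.1 * c p ^ 2 := by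
        simp only [dotProduct, Matrix.mulVec, realGram, Matrix.of_apply, star_trivial, kernelAt,
          add_mul, Finset.sum_add_distrib, mul_add]
        congr 1
        · rw [Fintype.sum_prod_type]
          refine Finset.sum_congr rfl fun l _ => ?_
          simp only [Fintype.sum_prod_type, Finset.mul_sum]
          rw [Finset.sum_comm]
          refine Finset.sum_congr rfl fun l' _ => Finset.sum_congr rfl fun i _ =>
            Finset.sum_congr rfl fun i' _ => ?_
          ring
        · refine Finset.sum_congr rfl fun p _ => ?_
          rw [Finset.sum_eq_single p (fun q _ hq => by simp [hq.symm]) (by simp), if_pos rfl]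
          ring
      rw [e1]
      congr 1
      simp only [dotProduct, Matrix.mulVec, Fintype.sum_prod_type, star_trivial,
        Matrix.kroneckerMap_apply, Matrix.of_apply]
      refine Finset.sum_congr rfl fun l _ => ?_
      have e2 : ∀ l', ∑ i : Fin (2 ^ m), c (l, i) * ∑ i' : Fin (2 ^ m), c (l', i') *
          Q (X l i) (X l' i') = ∑ x : S, w (l, x) * ∑ y : S, w (l', y) * Q x y := fun l' => by
        rw [Finset.sum_congr rfl fun i _ => by rw [hcollapse l' fun y => Q (X l i) y]]
        exact hcollapse l fun x => ∑ y : S, w (l', y) * Q x y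
      rw [Finset.sum_congr rfl fun l' _ => by rw [e2 l']]
      simp only [Finset.mul_sum]
      rw [Finset.sum_comm]
      refine Finset.sum_congr rfl fun x _ => Finset.sum_congr rfl fun l' _ =>
        Finset.sum_congr rfl fun y _ => ?_
      ring
    have hnoise : 0 ≤ ∑ p, ξ p.1 * c p ^ 2 :=
      Finset.sum_nonneg fun p _ => mul_nonneg (hξ _) (sq_nonneg _)
    rw [hform]
    -- Nonzero weights give a positive Kronecker form. If all weights vanish although some
    -- coefficient does not, its task cannot have distinct points, hence has positive noise.
    by_cases hw : w = 0
    · rw [hw]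
      simp only [Matrix.mulVec_zero, dotProduct_zero, zero_add]
      obtain ⟨⟨l, i⟩, hp⟩ : ∃ p, c p ≠ 0 := by
        by_contra! h
        exact hc (funext h)
      have hl : 0 < ξ l := by
        refine (hdist l).resolve_right fun hinj => hp ?_
        have h0 := congrFun hw (l, ⟨X l i, hpt (l, i)⟩)
        simp only [w, Pi.zero_apply] at h0
        rw [Finset.sum_eq_single i] at h0
        · simpa using h0
        · intro b _ hb
          exact if_neg fun e => hb (Fin.ext (hinj b.2 i.2 e))
        · simp
      refine Finset.sum_pos' (fun p _ => mul_nonneg (hξ _) (sq_nonneg _))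
        ⟨(l, i), Finset.mem_univ _, ?_⟩
      have : 0 < c (l, i) ^ 2 := by positivity
      exact mul_pos hl this
    · exact add_pos_of_pos_of_nonneg (hRQ.dotProduct_mulVec_pos hw) hnoise

theorem Condition.gram_posDef {L d m : ℕ} {fl : Flavour} {R : Fin L → Fin L → ℝ}
    {Q : (Fin d → ℝ) → (Fin d → ℝ) → ℝ} {ξ : Fin L → ℝ} {X : Fin L → ℕ → Fin d → ℝ}
    (h : Condition fl m R Q ξ X)
    (hdist : ∀ l, 0 < ξ l ∨ Set.InjOn (X l) (Set.Iio (2 ^ m))) :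
    (gram m R Q ξ X).PosDef :=
  posDef_map_ofReal (realGram_posDef h.taskKernel h.spatialKernel h.noise
    (fun l _ hi => h.design.mem_cube l hi) hdist)

theorem Condition.lambdaMat_posDef {L d m : ℕ} {fl : Flavour} {R : Fin L → Fin L → ℝ}
    {Q : (Fin d → ℝ) → (Fin d → ℝ) → ℝ} {ξ : Fin L → ℝ} {X : Fin L → ℕ → Fin d → ℝ}
    (h : Condition fl m R Q ξ X)
    (hdist : ∀ l, 0 < ξ l ∨ Set.InjOn (X l) (Set.Iio (2 ^ m))) :
    (lambdaMat fl m R Q ξ X).PosDef := by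
  refine (h.gram_posDef hdist).conjTranspose_mul_mul_same
    (Matrix.mulVec_injective_iff_isUnit.2 ?_)
  exact IsUnit.of_mul_eq_one _ (bigV_mul_conjTranspose_self fl L m)

end PositiveDefinite

/-! ### What one pass of the inversion loop does to the registers. -/

section InversionStage

variable {L : ℕ} {κ : Fin L → ℕ → Fin L → ℕ → ℝ}

theorem nodup_product_range {prev : List (Fin L)} (h : prev.Nodup) (n : ℕ) :
    (prev ×ˢ List.range n).Nodup :=
  h.product List.nodup_range

/-- `L ← A B`. -/
theorem run_stage_el {prev : List (Fin L)} (hprev : prev.Nodup) (n : ℕ) (l : Fin L) (s : State L) :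
    (∀ i ∈ prev, ∀ k < n, run κ (prev.flatMap fun i => (List.range n).flatMap fun k =>
      .const (.el i k) 0 :: prev.flatMap fun j =>
        [.mul .tmp (.inv i j k) (.lam j l k), .add (.el i k) (.el i k) .tmp]) s (.el i k) =
      (prev.map fun j => s (.inv i j k) * s (.lam j l k)).sum) ∧
    ∀ r, r ≠ .tmp → (∀ i k, r ≠ .el i k) → run κ (prev.flatMap fun i =>
      (List.range n).flatMap fun k => .const (.el i k) 0 :: prev.flatMap fun j =>
        [.mul .tmp (.inv i j k) (.lam j l k), .add (.el i k) (.el i k) .tmp]) s r = s r := by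
  rw [flatMap_product]
  have hbody := fun (p : Fin L × ℕ) (s : State L) =>
    run_accumulate (κ := κ) (.el p.1 p.2) (fun j => .inv p.1 j p.2)
      (fun j => .lam j l p.2) prev (Instr.exec κ s (.const (.el p.1 p.2) 0)) (by simp) (by simp)
      (by simp)
  obtain ⟨h1, h2⟩ := run_flatMap_single (κ := κ) (fun p : Fin L × ℕ => Reg.el p.1 p.2) (· = .tmp)
    (fun p => .const (.el p.1 p.2) 0 :: prev.flatMap fun j =>
      [.mul .tmp (.inv p.1 j p.2) (.lam j l p.2), .add (.el p.1 p.2) (.el p.1 p.2) .tmp])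
    (fun p => (prev.map fun j => s (.inv p.1 j p.2) * s (.lam j l p.2)).sum)
    (prev ×ˢ List.range n) s (nodup_product_range hprev n)
    (by rintro ⟨a, b⟩ _ ⟨a', b'⟩ _ h; simpa using h) (by simp)
    (by
      intro p _ s r hr ht
      rw [run_cons, (hbody p s).2 r hr ht]
      simp [Instr.exec, hr])
    (by
      intro p _ s' hs
      rw [run_cons, (hbody p s').1]
      simp only [Instr.exec, Function.update_self, zero_add, ne_eq, reduceCtorEq, not_false_eq_true,
        Function.update_of_ne]
      congr 1
      refine List.map_congr_left fun j _ => ?_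
      rw [hs _ (by simp) (by simp), hs _ (by simp) (by simp)])
  exact ⟨fun i hi k hk => h1 (i, k) (by simp [List.mem_product, hi, hk]),
    fun r hr h => h2 r hr fun p _ => h _ _⟩

/-- `F ← Bᴴ L`. -/
theorem run_stage_eff (prev : List (Fin L)) (n : ℕ) (l : Fin L) (s : State L) :
    (∀ k < n, run κ ((List.range n).flatMap fun k => .const (.eff k) 0 :: prev.flatMap fun i =>
      [.conj .tmp (.lam i l k), .mul .tmp .tmp (.el i k), .add (.eff k) (.eff k) .tmp]) s (.eff k) =
      (prev.map fun i => starRingEnd ℂ (s (.lam i l k)) * s (.el i k)).sum) ∧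
    ∀ r, r ≠ .tmp → (∀ k, r ≠ .eff k) →
      run κ ((List.range n).flatMap fun k => .const (.eff k) 0 :: prev.flatMap fun i =>
      [.conj .tmp (.lam i l k), .mul .tmp .tmp (.el i k), .add (.eff k) (.eff k) .tmp]) s r =
        s r := by
  have hbody := fun (k : ℕ) (s : State L) =>
    run_accumulate_conj (κ := κ) (.eff k) (fun i => .lam i l k)
      (fun i => .el i k) prev (Instr.exec κ s (.const (.eff k) 0)) (by simp) (by simp) (by simp)
  obtain ⟨h1, h2⟩ := run_flatMap_single (κ := κ) (Reg.eff) (· = .tmp)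
    (fun k => .const (.eff k) 0 :: prev.flatMap fun i =>
      [.conj .tmp (.lam i l k), .mul .tmp .tmp (.el i k), .add (.eff k) (.eff k) .tmp])
    (fun k => (prev.map fun i => starRingEnd ℂ (s (.lam i l k)) * s (.el i k)).sum)
    (List.range n) s List.nodup_range (by simp) (by simp)
    (by
      intro p _ s r hr ht
      rw [run_cons, (hbody p s).2 r hr ht]
      simp [Instr.exec, hr])
    (by
      intro p _ s' hs
      rw [run_cons, (hbody p s').1]
      simp only [Instr.exec, Function.update_self, zero_add, ne_eq, reduceCtorEq, not_false_eq_true,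
        Function.update_of_ne]
      congr 1
      refine List.map_congr_left fun j _ => ?_
      rw [hs _ (by simp) (by simp), hs _ (by simp) (by simp)])
  exact ⟨fun k hk => h1 k (by simp [hk]), fun r hr h => h2 r hr fun p _ => h _⟩

/-- A loop of single instructions whose operands are not targets. -/
theorem run_map_indep {α : Type*} (t : α → Reg L) (f : α → Instr L) (val : State L → α → ℂ)
    (xs : List α) (s : State L) (hnd : xs.Nodup)
    (ht : ∀ a ∈ xs, ∀ b ∈ xs, t a = t b → a = b)
    (hf : ∀ a s, (f a).exec κ s = Function.update s (t a) (val s a))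
    (hval : ∀ a ∈ xs, ∀ s', (∀ r, (∀ b ∈ xs, b ≠ a → r ≠ t b) → s' r = s r) → val s' a = val s a) :
    (∀ a ∈ xs, run κ (xs.map f) s (t a) = val s a) ∧
      ∀ r, (∀ a ∈ xs, r ≠ t a) → run κ (xs.map f) s r = s r := by
  rw [map_eq_flatMap_singleton]
  obtain ⟨h1, h2⟩ := run_flatMap_single (κ := κ) t (fun _ => False) (fun a => [f a]) (val s) xs s hnd
    ht (by simp) (fun a _ s r hr _ => by simp [hf, hr])
    (fun a ha s' hs => by
      simp only [run_cons, run_nil, hf, Function.update_self]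
      exact hval a ha s' fun r hr => hs r (by simp) hr)
  exact ⟨h1, fun r hr => h2 r (by simp) hr⟩

/-- `S ← D - F`. -/
theorem run_stage_schur (n : ℕ) (l : Fin L) (s : State L) :
    (∀ k < n, run κ ((List.range n).map fun k => .sub (.schur k) (.lam l l k) (.eff k)) s
      (.schur k) = s (.lam l l k) - s (.eff k)) ∧
    ∀ r, (∀ k, r ≠ .schur k) →
      run κ ((List.range n).map fun k => .sub (.schur k) (.lam l l k) (.eff k)) s r = s r := by
  obtain ⟨h1, h2⟩ := run_map_indep (κ := κ) Reg.schur
    (fun k => .sub (.schur k) (.lam l l k) (.eff k))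
    (fun s k => s (.lam l l k) - s (.eff k)) (List.range n) s List.nodup_range (by simp)
    (fun _ _ => rfl) (fun a _ s' hs => by rw [hs _ (by simp), hs _ (by simp)])
  exact ⟨fun k hk => h1 k (by simp [hk]), fun r h => h2 r fun p _ => h _⟩

/-- `G ← S⁻¹`. -/
theorem run_stage_gee (n : ℕ) (s : State L) :
    (∀ k < n, run κ ((List.range n).map fun k => .recip (.gee k) (.schur k)) s
      (.gee k) = (s (.schur k))⁻¹) ∧
    ∀ r, (∀ k, r ≠ .gee k) →
      run κ ((List.range n).map fun k => .recip (.gee k) (.schur k)) s r = s r := by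
  obtain ⟨h1, h2⟩ := run_map_indep (κ := κ) Reg.gee
    (fun k => .recip (.gee k) (.schur k))
    (fun s k => (s (.schur k))⁻¹) (List.range n) s List.nodup_range (by simp)
    (fun _ _ => rfl) (fun a _ s' hs => by rw [hs _ (by simp)])
  exact ⟨fun k hk => h1 k (by simp [hk]), fun r h => h2 r fun p _ => h _⟩

theorem flatMap_map_product {α β γ : Type*} (xs : List α) (ys : List β) (f : α → β → γ) :
    (xs.flatMap fun a => ys.map fun b => f a b) = (xs ×ˢ ys).map fun p => f p.1 p.2 := by
  induction xs with
  | nil => simp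
  | cons a xs ih => simp [List.product_cons, ih]

/-- `H ← L G`. -/
theorem run_stage_aitch {prev : List (Fin L)} (hprev : prev.Nodup) (n : ℕ) (s : State L) :
    (∀ i ∈ prev, ∀ k < n, run κ (prev.flatMap fun i => (List.range n).map fun k =>
      .mul (.aitch i k) (.el i k) (.gee k)) s (.aitch i k) = s (.el i k) * s (.gee k)) ∧
    ∀ r, (∀ i k, r ≠ .aitch i k) → run κ (prev.flatMap fun i => (List.range n).map fun k =>
      .mul (.aitch i k) (.el i k) (.gee k)) s r = s r := by
  rw [flatMap_map_product]
  obtain ⟨h1, h2⟩ := run_map_indep (κ := κ) (fun p : Fin L × ℕ => Reg.aitch p.1 p.2)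
    (fun p => .mul (.aitch p.1 p.2) (.el p.1 p.2) (.gee p.2))
    (fun s p => s (.el p.1 p.2) * s (.gee p.2)) (prev ×ˢ List.range n) s
    (nodup_product_range hprev n)
    (by rintro ⟨a, b⟩ _ ⟨a', b'⟩ _ h; simpa using h)
    (fun _ _ => rfl) (fun a _ s' hs => by rw [hs _ (by simp), hs _ (by simp)])
  exact ⟨fun i hi k hk => h1 (i, k) (by simp [List.mem_product, hi, hk]),
    fun r h => h2 r fun p _ => h _ _⟩

/-- `J ← H Lᴴ`. -/
theorem run_stage_jay {prev : List (Fin L)} (hprev : prev.Nodup) (n : ℕ) (s : State L) :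
    (∀ i ∈ prev, ∀ j ∈ prev, ∀ k < n, run κ (prev.flatMap fun i => prev.flatMap fun j =>
      (List.range n).flatMap fun k =>
        [.conj .tmp (.el j k), .mul (.jay i j k) (.aitch i k) .tmp]) s (.jay i j k) =
          s (.aitch i k) * starRingEnd ℂ (s (.el j k))) ∧
    ∀ r, r ≠ .tmp → (∀ i j k, r ≠ .jay i j k) → run κ (prev.flatMap fun i =>
      prev.flatMap fun j => (List.range n).flatMap fun k =>
        [.conj .tmp (.el j k), .mul (.jay i j k) (.aitch i k) .tmp]) s r = s r := by
  simp only [flatMap_product prev (List.range n)]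
  rw [flatMap_product]
  obtain ⟨h1, h2⟩ := run_flatMap_single (κ := κ)
    (fun p : Fin L × Fin L × ℕ => Reg.jay p.1 p.2.1 p.2.2) (· = .tmp)
    (fun p => [.conj .tmp (.el p.2.1 p.2.2),
      .mul (.jay p.1 p.2.1 p.2.2) (.aitch p.1 p.2.2) .tmp])
    (fun p => s (.aitch p.1 p.2.2) * starRingEnd ℂ (s (.el p.2.1 p.2.2)))
    (prev ×ˢ prev ×ˢ List.range n) s (hprev.product (nodup_product_range hprev n))
    (by rintro ⟨a, b, c⟩ _ ⟨a', b', c'⟩ _ h; simpa using h) (by simp)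
    (by
      intro p _ s r hr ht
      simp [Instr.exec, hr, ht])
    (by
      intro p _ s' hs
      simp [Instr.exec, hs])
  exact ⟨fun i hi j hj k hk => h1 (i, j, k) (by simp [List.mem_product, hi, hj, hk]),
    fun r hr h => h2 r hr fun p _ => h _ _ _⟩

/-- `M ← A + J`. -/
theorem run_stage_add {prev : List (Fin L)} (hprev : prev.Nodup) (n : ℕ) (s : State L) :
    (∀ i ∈ prev, ∀ j ∈ prev, ∀ k < n, run κ (prev.flatMap fun i => prev.flatMap fun j =>
      (List.range n).map fun k => .add (.inv i j k) (.inv i j k) (.jay i j k)) s (.inv i j k) =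
          s (.inv i j k) + s (.jay i j k)) ∧
    ∀ r, (∀ i j k, r ≠ .inv i j k) → run κ (prev.flatMap fun i => prev.flatMap fun j =>
      (List.range n).map fun k => .add (.inv i j k) (.inv i j k) (.jay i j k)) s r = s r := by
  simp only [flatMap_map_product]
  obtain ⟨h1, h2⟩ := run_map_indep (κ := κ)
    (fun p : Fin L × Fin L × ℕ => Reg.inv p.1 p.2.1 p.2.2)
    (fun p => .add (.inv p.1 p.2.1 p.2.2) (.inv p.1 p.2.1 p.2.2) (.jay p.1 p.2.1 p.2.2))
    (fun s p => s (.inv p.1 p.2.1 p.2.2) + s (.jay p.1 p.2.1 p.2.2))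
    (prev ×ˢ prev ×ˢ List.range n) s (hprev.product (nodup_product_range hprev n))
    (by rintro ⟨a, b, c⟩ _ ⟨a', b', c'⟩ _ h; simpa using h)
    (fun _ _ => rfl)
    (by
      -- One operand is the target of its own pass; it still holds the old value on entry, as no
      -- other pass writes to it.
      rintro ⟨a, b, c⟩ _ s' hs
      rw [hs, hs]
      · simp
      · rintro ⟨a', b', c'⟩ _ hne h
        simp only [Reg.inv.injEq] at h
        obtain ⟨rfl, rfl, rfl⟩ := h
        exact hne rfl)
  exact ⟨fun i hi j hj k hk => h1 (i, j, k) (by simp [List.mem_product, hi, hj, hk]),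
    fun r h => h2 r fun p _ => h _ _ _⟩

/-- The off-diagonal blocks `-H` and `-Hᴴ` of the new inverse. -/
theorem run_stage_border {prev : List (Fin L)} (hprev : prev.Nodup) (n : ℕ) (l : Fin L)
    (hl : l ∉ prev) (s : State L) :
    (∀ i ∈ prev, ∀ k < n, run κ (prev.flatMap fun i => (List.range n).flatMap fun k =>
      [.neg (.inv i l k) (.aitch i k), .conj .tmp (.aitch i k), .neg (.inv l i k) .tmp]) s
        (.inv i l k) = -s (.aitch i k)) ∧
    (∀ i ∈ prev, ∀ k < n, run κ (prev.flatMap fun i => (List.range n).flatMap fun k =>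
      [.neg (.inv i l k) (.aitch i k), .conj .tmp (.aitch i k), .neg (.inv l i k) .tmp]) s
        (.inv l i k) = -starRingEnd ℂ (s (.aitch i k))) ∧
    ∀ r, r ≠ .tmp → (∀ i k, r ≠ .inv i l k ∧ r ≠ .inv l i k) → run κ (prev.flatMap fun i =>
      (List.range n).flatMap fun k =>
      [.neg (.inv i l k) (.aitch i k), .conj .tmp (.aitch i k), .neg (.inv l i k) .tmp]) s r =
        s r := by
  rw [flatMap_product]
  -- Since `l` is not among the earlier tasks, the new row and the new column never share a
  -- register.
  have hne : ∀ p ∈ prev ×ˢ List.range n, p.1 ≠ l := by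
    rintro ⟨a, b⟩ h rfl
    exact hl (List.mem_product.1 h).1
  obtain ⟨h1, h2⟩ := run_flatMap_indep (κ := κ)
    (fun (p : Fin L × ℕ) r => r = Reg.inv p.1 l p.2 ∨ r = Reg.inv l p.1 p.2) (· = .tmp)
    (fun p => [.neg (.inv p.1 l p.2) (.aitch p.1 p.2), .conj .tmp (.aitch p.1 p.2),
      .neg (.inv l p.1 p.2) .tmp])
    (fun p r => if r = .inv p.1 l p.2 then -s (.aitch p.1 p.2)
      else -starRingEnd ℂ (s (.aitch p.1 p.2)))
    (prev ×ˢ List.range n) s (nodup_product_range hprev n)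
    (by
      rintro ⟨a, b⟩ ha ⟨a', b'⟩ ha' r h h'
      have := hne _ ha
      have := hne _ ha'
      rcases h with rfl | rfl <;> rcases h' with h' | h' <;> simp_all)
    (by rintro p _ r (rfl | rfl) <;> simp)
    (by
      intro p _ s r hr ht
      rw [not_or] at hr
      simp [Instr.exec, hr.1, hr.2, ht])
    (by
      intro p hp s' hs r hr
      have h0 := hne p hp
      have h1 : s' (.aitch p.1 p.2) = s (.aitch p.1 p.2) := hs _ (by simp) (by simp)
      rcases hr with rfl | rfl <;> simp [Instr.exec, h0, h0.symm, h1])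
  have hmem : ∀ i ∈ prev, ∀ k < n, (i, k) ∈ prev ×ˢ List.range n := fun i hi k hk => by
    simp [List.mem_product, hi, hk]
  refine ⟨fun i hi k hk => ?_, fun i hi k hk => ?_, fun r hr h => h2 r hr fun p _ => ?_⟩
  · rw [h1 _ (hmem i hi k hk) _ (Or.inl rfl), if_pos rfl]
  · rw [h1 _ (hmem i hi k hk) _ (Or.inr rfl), if_neg]
    have := hne _ (hmem i hi k hk)
    simp [Ne.symm this]
  · rw [not_or]
    exact h _ _

/-- The last diagonal block `G` of the new inverse. -/
theorem run_stage_corner (n : ℕ) (l : Fin L) (s : State L) :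
    (∀ k < n, run κ ((List.range n).map fun k => .copy (.inv l l k) (.gee k)) s
      (.inv l l k) = s (.gee k)) ∧
    ∀ r, (∀ k, r ≠ .inv l l k) →
      run κ ((List.range n).map fun k => .copy (.inv l l k) (.gee k)) s r = s r := by
  obtain ⟨h1, h2⟩ := run_map_indep (κ := κ) (Reg.inv l l)
    (fun k => .copy (.inv l l k) (.gee k))
    (fun s k => s (.gee k)) (List.range n) s List.nodup_range (by simp)
    (fun _ _ => rfl) (fun a _ s' hs => by rw [hs _ (by simp)])
  exact ⟨fun k hk => h1 k (by simp [hk]), fun r h => h2 r fun p _ => h _⟩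

/-- Diagonal entry `k` of block `i` of the product `A B` in the pass for task `l`. -/
noncomputable def stageEl (s : State L) (l i : Fin L) (k : ℕ) : ℂ :=
  ∑ j with j < l, s (.inv i j k) * s (.lam j l k)

/-- Diagonal entry `k` of the Schur complement in the pass for task `l`. -/
noncomputable def stageSchur (s : State L) (l : Fin L) (k : ℕ) : ℂ :=
  s (.lam l l k) - ∑ i with i < l, starRingEnd ℂ (s (.lam i l k)) * stageEl s l i k

theorem sum_map_filter_finRange (l : Fin L) (f : Fin L → ℂ) :
    (((List.finRange L).filter fun i => i < l).map f).sum = ∑ i with i < l, f i := by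
  rw [← List.sum_toFinset f ((List.nodup_finRange L).filter _)]
  congr 1
  ext i
  simp

/-- What one pass of the inversion algorithm computes. -/
theorem run_invDetStage (n : ℕ) (l : Fin L) (s : State L) :
    ((∀ k < n, stageSchur s l k ≠ 0) → DivSafe κ (invDetStage L n l) s) ∧
    run κ (invDetStage L n l) s .rho = s .rho * ∏ k ∈ Finset.range n, stageSchur s l k ∧
    (∀ i j k, run κ (invDetStage L n l) s (.lam i j k) = s (.lam i j k)) ∧
    (∀ i < l, ∀ j < l, ∀ k < n, run κ (invDetStage L n l) s (.inv i j k) =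
      s (.inv i j k) + stageEl s l i k * (stageSchur s l k)⁻¹ *
        starRingEnd ℂ (stageEl s l j k)) ∧
    (∀ i < l, ∀ k < n, run κ (invDetStage L n l) s (.inv i l k) =
      -(stageEl s l i k * (stageSchur s l k)⁻¹)) ∧
    (∀ i < l, ∀ k < n, run κ (invDetStage L n l) s (.inv l i k) =
      -starRingEnd ℂ (stageEl s l i k * (stageSchur s l k)⁻¹)) ∧
    (∀ k < n, run κ (invDetStage L n l) s (.inv l l k) = (stageSchur s l k)⁻¹) := by
  simp only [invDetStage, run_append, divSafe_append]
  have hprev : ((List.finRange L).filter fun i => i < l).Nodup := (List.nodup_finRange L).filter _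
  have hmem : ∀ i, i ∈ ((List.finRange L).filter fun i => i < l) ↔ i < l := by simp
  have hsum := sum_map_filter_finRange l
  -- Only membership, absence of repetitions and the summation formula for the earlier tasks matter
  -- from here on.
  generalize ((List.finRange L).filter fun i => i < l) = prev at *
  obtain ⟨a1, b1⟩ := run_stage_el (κ := κ) hprev n l s
  set s1 := run κ (prev.flatMap fun i => _) s
  obtain ⟨a2, b2⟩ := run_stage_eff (κ := κ) prev n l s1
  set s2 := run κ ((List.range n).flatMap fun k => _) s1
  obtain ⟨a3, b3⟩ := run_stage_schur (κ := κ) n l s2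
  set s3 := run κ ((List.range n).map fun k => _) s2
  obtain ⟨a4, b4⟩ := run_accumulate_mul (κ := κ) .rho Reg.schur (List.range n) s3 (by simp)
  set s4 := run κ ((List.range n).map fun k => _) s3
  obtain ⟨a5, b5⟩ := run_stage_gee (κ := κ) n s4
  set s5 := run κ ((List.range n).map fun k => _) s4
  obtain ⟨a6, b6⟩ := run_stage_aitch (κ := κ) hprev n s5
  set s6 := run κ (prev.flatMap fun i => _) s5
  obtain ⟨a7, b7⟩ := run_stage_jay (κ := κ) hprev n s6
  set s7 := run κ (prev.flatMap fun i => _) s6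
  obtain ⟨a8, b8⟩ := run_stage_add (κ := κ) hprev n s7
  set s8 := run κ (prev.flatMap fun i => _) s7
  obtain ⟨a9, a9', b9⟩ := run_stage_border (κ := κ) hprev n l (by simp [hmem]) s8
  set s9 := run κ (prev.flatMap fun i => _) s8
  obtain ⟨a10, b10⟩ := run_stage_corner (κ := κ) n l s9
  set s10 := run κ ((List.range n).map fun k => _) s9
  have eEl : ∀ i < l, ∀ k < n, s1 (.el i k) = stageEl s l i k := fun i hi k hk => by
    rw [a1 i ((hmem i).2 hi) k hk, hsum]; rfl
  have eEff : ∀ k < n, s2 (.eff k) =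
      ∑ i with i < l, starRingEnd ℂ (s (.lam i l k)) * stageEl s l i k := fun k hk => by
    rw [a2 k hk, hsum]
    refine Finset.sum_congr rfl fun i hi => ?_
    rw [eEl i (by simpa using hi) k hk, b1 _ (by simp) (by simp)]
  have eS3 : ∀ k < n, s3 (.schur k) = stageSchur s l k := fun k hk => by
    rw [a3 k hk, eEff k hk, b2 _ (by simp) (by simp), b1 _ (by simp) (by simp)]; rfl
  have eS : ∀ k < n, s4 (.schur k) = stageSchur s l k := fun k hk => by
    rw [b4 _ (by simp), eS3 k hk]
  have eRho : s4 .rho = s .rho * ∏ k ∈ Finset.range n, stageSchur s l k := by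
    rw [a4, b3 _ (by simp), b2 _ (by simp) (by simp), b1 _ (by simp) (by simp)]
    congr 1
    rw [Finset.prod_range, ← List.prod_ofFn, List.ofFn_eq_map, ← List.map_coe_finRange_eq_range,
      List.map_map]
    congr 1
    exact List.map_congr_left fun k _ => eS3 k k.2
  have eG : ∀ k < n, s5 (.gee k) = (stageSchur s l k)⁻¹ := fun k hk => by rw [a5 k hk, eS k hk]
  have eEl5 : ∀ i < l, ∀ k < n, s5 (.el i k) = stageEl s l i k := fun i hi k hk => by
    rw [b5 _ (by simp), b4 _ (by simp), b3 _ (by simp), b2 _ (by simp) (by simp), eEl i hi k hk]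
  have eH : ∀ i < l, ∀ k < n, s6 (.aitch i k) = stageEl s l i k * (stageSchur s l k)⁻¹ :=
    fun i hi k hk => by rw [a6 i ((hmem i).2 hi) k hk, eEl5 i hi k hk, eG k hk]
  have eJ : ∀ i < l, ∀ j < l, ∀ k < n, s7 (.jay i j k) =
      stageEl s l i k * (stageSchur s l k)⁻¹ * starRingEnd ℂ (stageEl s l j k) :=
    fun i hi j hj k hk => by
      rw [a7 i ((hmem i).2 hi) j ((hmem j).2 hj) k hk, eH i hi k hk, b6 _ (by simp),
        eEl5 j hj k hk]
  have eInv : ∀ i j k, s7 (.inv i j k) = s (.inv i j k) := fun i j k => by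
    rw [b7 _ (by simp) (by simp), b6 _ (by simp), b5 _ (by simp), b4 _ (by simp), b3 _ (by simp),
      b2 _ (by simp) (by simp), b1 _ (by simp) (by simp)]
  have eH8 : ∀ i < l, ∀ k < n, s8 (.aitch i k) = stageEl s l i k * (stageSchur s l k)⁻¹ :=
    fun i hi k hk => by rw [b8 _ (by simp), b7 _ (by simp) (by simp), eH i hi k hk]
  refine ⟨fun hS => ?_, ?_, fun i j k => ?_, fun i hi j hj k hk => ?_, fun i hi k hk => ?_,
    fun i hi k hk => ?_, fun k hk => ?_⟩
  · refine ⟨⟨⟨⟨⟨⟨⟨⟨⟨?_, ?_⟩, ?_⟩, ?_⟩, ?_⟩, ?_⟩, ?_⟩, ?_⟩, ?_⟩, ?_⟩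
    · refine DivFree.divSafe (divFree_flatMap fun i _ => divFree_flatMap fun k _ => ?_) _
      rw [divFree_cons]
      exact ⟨by simp, divFree_flatMap fun j _ => by simp⟩
    · refine DivFree.divSafe (divFree_flatMap fun k _ => ?_) _
      rw [divFree_cons]
      exact ⟨by simp, divFree_flatMap fun j _ => by simp⟩
    · exact DivFree.divSafe (divFree_map fun k _ => by simp) _
    · exact DivFree.divSafe (divFree_map fun k _ => by simp) _
    · refine divSafe_recip_map Reg.gee Reg.schur _ _ (by simp) fun k hk => ?_
      have hk := List.mem_range.1 hk
      rw [eS k hk]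
      exact hS k hk
    · exact DivFree.divSafe (divFree_flatMap fun i _ => divFree_map fun k _ => by simp) _
    · exact DivFree.divSafe (divFree_flatMap fun i _ => divFree_flatMap fun j _ =>
        divFree_flatMap fun k _ => by simp) _
    · exact DivFree.divSafe (divFree_flatMap fun i _ => divFree_flatMap fun j _ =>
        divFree_map fun k _ => by simp) _
    · exact DivFree.divSafe (divFree_flatMap fun i _ => divFree_flatMap fun k _ => by simp) _
    · exact DivFree.divSafe (divFree_map fun k _ => by simp) _
  · rw [b10 _ (by simp), b9 _ (by simp) (by simp), b8 _ (by simp), b7 _ (by simp) (by simp),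
      b6 _ (by simp), b5 _ (by simp), eRho]
  · rw [b10 _ (by simp), b9 _ (by simp) (by simp), b8 _ (by simp), b7 _ (by simp) (by simp),
      b6 _ (by simp), b5 _ (by simp), b4 _ (by simp), b3 _ (by simp), b2 _ (by simp) (by simp),
      b1 _ (by simp) (by simp)]
  -- The border and the corner only write to row and column `l`, so the old block keeps the values
  -- left by the addition of `J`.
  · rw [b10 _ (by simp [hi.ne]), b9 _ (by simp) (by simp [hi.ne, hj.ne]),
      a8 i ((hmem i).2 hi) j ((hmem j).2 hj) k hk, eInv, eJ i hi j hj k hk]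
  · rw [b10 _ (by simp [hi.ne]), a9 i ((hmem i).2 hi) k hk, eH8 i hi k hk]
  · rw [b10 _ (by simp [hi.ne]), a9' i ((hmem i).2 hi) k hk, eH8 i hi k hk]
  · rw [a10 k hk, b9 _ (by simp) (by simp), b8 _ (by simp), b7 _ (by simp) (by simp),
      b6 _ (by simp), eG k hk]

end InversionStage

/-! ### Inverse and determinant by bordering, frequency by frequency. -/

section Inversion

open scoped ComplexOrder

/-! ### Bordering a positive definite matrix -/

/-- These are the Schur complement formulas for a block matrix whose last block is `1 × 1`. Because
`M` is Hermitian, one vector `el` serves both borders. The pivot `S` is nonzero since its product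
with the leading minor is the nonzero determinant of `M`. -/
theorem posDef_border {t : ℕ} {M : Matrix (Fin (t + 1)) (Fin (t + 1)) ℂ} (hM : M.PosDef)
    {A : Matrix (Fin t) (Fin t) ℂ} (hA : A = (M.submatrix Fin.castSucc Fin.castSucc)⁻¹)
    {el : Fin t → ℂ} (hel : ∀ i, el i = ∑ j, A i j * M j.castSucc (Fin.last t)) {S : ℂ}
    (hS : S = M (Fin.last t) (Fin.last t) -
      ∑ i, starRingEnd ℂ (M i.castSucc (Fin.last t)) * el i) :
    S ≠ 0 ∧ M.det = (M.submatrix Fin.castSucc Fin.castSucc).det * S ∧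
    (∀ i j, M⁻¹ i.castSucc j.castSucc = A i j + el i * S⁻¹ * starRingEnd ℂ (el j)) ∧
    (∀ i, M⁻¹ i.castSucc (Fin.last t) = -(el i * S⁻¹)) ∧
    (∀ i, M⁻¹ (Fin.last t) i.castSucc = -starRingEnd ℂ (el i * S⁻¹)) ∧
    M⁻¹ (Fin.last t) (Fin.last t) = S⁻¹ := by
  set P := M.submatrix Fin.castSucc Fin.castSucc with hP
  have hPd : P.PosDef := hM.submatrix (Fin.castSucc_injective t)
  have hAherm : ∀ i j, starRingEnd ℂ (A i j) = A j i := fun i j => by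
    have h := hPd.inv.isHermitian.apply j i
    rw [← hA] at h
    exact h
  let e : Fin t ⊕ Fin 1 ≃ Fin (t + 1) := finSumFinEquiv
  have el0 : ∀ i, e (Sum.inl i) = i.castSucc := fun i => rfl
  have er0 : ∀ i, e (Sum.inr i) = Fin.last t := fun i => by
    obtain rfl := Subsingleton.elim i 0
    rfl
  let B : Matrix (Fin t) (Fin 1) ℂ := Matrix.of fun i _ => M i.castSucc (Fin.last t)
  let C : Matrix (Fin 1) (Fin t) ℂ := Matrix.of fun _ i => M (Fin.last t) i.castSucc
  let D : Matrix (Fin 1) (Fin 1) ℂ := Matrix.of fun _ _ => M (Fin.last t) (Fin.last t)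
  have hC : ∀ i : Fin t, M (Fin.last t) i.castSucc = starRingEnd ℂ (M i.castSucc (Fin.last t)) := fun i =>
    (hM.isHermitian.apply _ _).symm
  have hblocks : M.submatrix e e = Matrix.fromBlocks P B C D := by
    ext i j
    rcases i with i | i <;> rcases j with j | j <;>
      simp [el0, er0, P, B, C, D]
  have : Invertible P := hPd.isUnit.invertible
  have hAinv : ⅟P = A := by rw [hA, Matrix.invOf_eq_nonsing_inv]
  have hAB : ∀ i x, (A * B) i x = el i := fun i x => by
    rw [hel, Matrix.mul_apply]; rfl
  -- The row `C` is the conjugate transpose of `B` and `A` is Hermitian, so `C A` is the conjugate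
  -- transpose of `A B`.
  have hCA : ∀ x j, (C * A) x j = starRingEnd ℂ (el j) := fun x j => by
    rw [hel, Matrix.mul_apply, map_sum]
    refine Finset.sum_congr rfl fun i _ => ?_
    rw [map_mul, hAherm, ← hC, mul_comm]; rfl
  have hSchur : D - C * ⅟P * B = Matrix.of fun _ _ => S := by
    ext x y
    rw [hAinv, Matrix.mul_assoc, Matrix.sub_apply, Matrix.mul_apply, hS]
    simp only [hAB]
    simp only [C, D, Matrix.of_apply, hC]
  have hdet : M.det = P.det * S := by
    rw [← Matrix.det_submatrix_equiv_self e M, hblocks, Matrix.det_fromBlocks₁₁, hSchur]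
    simp
  have hS0 : S ≠ 0 := by
    intro h0
    rw [h0, mul_zero] at hdet
    exact ((Matrix.isUnit_iff_isUnit_det _).1 hM.isUnit).ne_zero hdet
  have hSu : IsUnit (D - C * ⅟P * B) := by
    rw [hSchur, Matrix.isUnit_iff_isUnit_det]
    simpa using hS0
  have : Invertible (D - C * ⅟P * B) := hSu.invertible
  have hGinv : ∀ x y, (⅟(D - C * ⅟P * B)) x y = S⁻¹ := fun x y => by
    rw [Matrix.invOf_eq_nonsing_inv, hSchur, Matrix.inv_subsingleton]
    simp [Subsingleton.elim x y]
  have hMu : IsUnit (M.submatrix e e) := (Matrix.isUnit_submatrix_equiv (A := M) e e).2 hM.isUnit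
  rw [hblocks] at hMu
  have : Invertible (Matrix.fromBlocks P B C D) := hMu.invertible
  have hinv : M⁻¹.submatrix e e = Matrix.fromBlocks
      (A + A * B * ⅟(D - C * ⅟P * B) * (C * A)) (-(A * B * ⅟(D - C * ⅟P * B)))
      (-(⅟(D - C * ⅟P * B) * (C * A))) (⅟(D - C * ⅟P * B)) := by
    rw [← Matrix.inv_submatrix_equiv, hblocks, ← Matrix.invOf_eq_nonsing_inv,
      Matrix.invOf_fromBlocks₁₁_eq]
    generalize ⅟(D - C * ⅟P * B) = G
    rw [hAinv]
    simp only [Matrix.mul_assoc]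
  have happ : ∀ x y, M⁻¹ (e x) (e y) = (M⁻¹.submatrix e e) x y := fun _ _ => rfl
  have h12 : ∀ i, M⁻¹ i.castSucc (Fin.last t) = -(el i * S⁻¹) := fun i => by
    rw [← el0, ← er0 0, happ, hinv, Matrix.fromBlocks_apply₁₂, Matrix.neg_apply, Matrix.mul_apply,
      Fin.sum_univ_one, hAB, hGinv]
  refine ⟨hS0, hdet, fun i j => ?_, h12, fun i => ?_, ?_⟩
  · rw [← el0, ← el0, happ, hinv, Matrix.fromBlocks_apply₁₁, Matrix.add_apply, Matrix.mul_apply,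
      Fin.sum_univ_one, Matrix.mul_apply, Fin.sum_univ_one, hAB, hGinv, hCA]
  · rw [← map_neg, ← h12]
    exact (hM.inv.isHermitian.apply _ _).symm
  · rw [← er0 0, happ, hinv, Matrix.fromBlocks_apply₂₂, hGinv]

/-! ### The loop -/

variable {L : ℕ} {κ : Fin L → ℕ → Fin L → ℕ → ℝ}

theorem sum_filter_lt (l : Fin L) (f : Fin L → ℂ) :
    ∑ j with j < l, f j = ∑ j : Fin l, f (Fin.castLE l.2.le j) := by
  refine (Finset.sum_bij (fun (j : Fin l) _ => Fin.castLE l.2.le j) ?_ ?_ ?_ ?_).symm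
  · intro j _
    exact Finset.mem_filter.2 ⟨Finset.mem_univ _, j.2⟩
  · intro i _ j _ h
    simpa using h
  · intro j hj
    exact ⟨⟨j, by simpa using hj⟩, by simp, rfl⟩
  · intro j _
    rfl

/-- Leading principal submatrix of order `t`. -/
def leading (a : Matrix (Fin L) (Fin L) ℂ) {t : ℕ} (h : t ≤ L) : Matrix (Fin t) (Fin t) ℂ :=
  a.submatrix (Fin.castLE h) (Fin.castLE h)

/-- The registers `inv` hold the inverses of the leading submatrices of order `t`, and `rho` the
product of their determinants. -/
structure InvState (n : ℕ) (a : ℕ → Matrix (Fin L) (Fin L) ℂ) {t : ℕ} (h : t ≤ L)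
    (s : State L) : Prop where
  lam : ∀ l l', ∀ k < n, s (.lam l l' k) = a k l l'
  rho : s .rho = ∏ k ∈ Finset.range n, (leading (a k) h).det
  inv : ∀ i j, ∀ k < n, s (.inv (Fin.castLE h i) (Fin.castLE h j) k) = (leading (a k) h)⁻¹ i j

/-- Applies bordering to the leading submatrices of order `l + 1`, separately for every `k`. Leading
submatrices of positive definite matrices are positive definite, which is why each pass is safe. -/
theorem InvState.step {n : ℕ} {a : ℕ → Matrix (Fin L) (Fin L) ℂ} (ha : ∀ k < n, (a k).PosDef)
    (l : Fin L) {s : State L} (hs : InvState n a l.2.le s) :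
    DivSafe κ (invDetStage L n l) s ∧
      InvState n a (Nat.succ_le_of_lt l.2) (run κ (invDetStage L n l) s) := by
  obtain ⟨hsafe, hrho, hlam, h11, h12, h21, h22⟩ := run_invDetStage (κ := κ) n l s
  have hlt : ∀ i : Fin l, Fin.castLE l.2.le i < l := fun i => i.2
  have key := fun k (hk : k < n) => posDef_border (M := leading (a k) (Nat.succ_le_of_lt l.2))
    ((ha k hk).submatrix (Fin.castLE_injective _)) rfl
    (el := fun i => stageEl s l (Fin.castLE l.2.le i) k)
    (fun i => by
      rw [stageEl, sum_filter_lt]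
      refine Finset.sum_congr rfl fun j _ => ?_
      rw [hs.inv i j k hk, hs.lam _ _ k hk]
      rfl)
    (S := stageSchur s l k)
    (by
      rw [stageSchur, sum_filter_lt, hs.lam _ _ k hk]
      congr 1
      refine Finset.sum_congr rfl fun j _ => ?_
      rw [hs.lam _ _ k hk]
      rfl)
  have hsub : ∀ k, (leading (a k) (Nat.succ_le_of_lt l.2)).submatrix Fin.castSucc Fin.castSucc =
      leading (a k) l.2.le := fun k => rfl
  refine ⟨hsafe fun k hk => (key k hk).1, ⟨fun i j k hk => by rw [hlam, hs.lam i j k hk], ?_, ?_⟩⟩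
  · rw [hrho, hs.rho, ← Finset.prod_mul_distrib]
    refine Finset.prod_congr rfl fun k hk => ?_
    rw [(key k (Finset.mem_range.1 hk)).2.1, hsub]
  · intro i j k hk
    obtain ⟨-, -, k11, k12, k21, k22⟩ := key k hk
    have hlast : Fin.castLE (Nat.succ_le_of_lt l.2) (Fin.last l) = l := rfl
    have hcast : ∀ i : Fin l, Fin.castLE (Nat.succ_le_of_lt l.2) i.castSucc =
      Fin.castLE l.2.le i := fun i => rfl
    refine Fin.lastCases ?_ (fun i => ?_) i <;> refine Fin.lastCases ?_ (fun j => ?_) j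
    · rw [hlast, h22 k hk]
      exact k22.symm
    · rw [hlast, hcast, h21 _ (hlt j) k hk]
      exact (k21 j).symm
    · rw [hlast, hcast, h12 _ (hlt i) k hk]
      exact (k12 i).symm
    · rw [hcast, hcast, h11 _ (hlt i) _ (hlt j) k hk, hs.inv i j k hk]
      exact (k11 i j).symm

theorem run_invDetProg {n : ℕ} {a : ℕ → Matrix (Fin L) (Fin L) ℂ} (ha : ∀ k < n, (a k).PosDef)
    (s : State L) (hs : ∀ l l', ∀ k < n, s (.lam l l' k) = a k l l') :
    DivSafe κ (invDetProg L n) s ∧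
    run κ (invDetProg L n) s .rho = ∏ k ∈ Finset.range n, (a k).det ∧
    ∀ i j, ∀ k < n, run κ (invDetProg L n) s (.inv i j k) = (a k)⁻¹ i j := by
  set s0 := Instr.exec κ s (.const .rho 1) with hs0
  -- Induction on the number of tasks treated, starting from order zero: the empty matrix has
  -- determinant one, matching the initial value of `rho`, and there is no entry of an inverse to
  -- check.
  have H : ∀ t (ht : t ≤ L),
      DivSafe κ (((List.finRange L).take t).flatMap (invDetStage L n)) s0 ∧
      InvState n a ht (run κ (((List.finRange L).take t).flatMap (invDetStage L n)) s0) := by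
    intro t
    induction t with
    | zero =>
      intro ht
      refine ⟨by simp [DivSafe], ⟨fun i j k hk => ?_, ?_, fun i => i.elim0⟩⟩
      · simp [s0, Instr.exec, hs i j k hk]
      · simp [s0, Instr.exec]
    | succ t ih =>
      intro ht
      obtain ⟨h1, h2⟩ := ih (by omega)
      have htake : (List.finRange L).take (t + 1) =
          (List.finRange L).take t ++ [⟨t, ht⟩] := by
        rw [List.take_succ_eq_append_getElem (by simpa using ht)]
        simp
      have hstep := InvState.step (κ := κ) ha ⟨t, ht⟩ h2
      rw [htake, List.flatMap_append, List.flatMap_cons, List.flatMap_nil, List.append_nil,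
        divSafe_append, run_append]
      exact ⟨⟨h1, hstep.1⟩, hstep.2⟩
  obtain ⟨h1, h2⟩ := H L le_rfl
  rw [List.take_of_length_le (by simp)] at h1 h2
  exact ⟨⟨by simp, h1⟩, h2.rho, h2.inv⟩

/-! ### Block matrices with diagonal blocks -/

/-- The change of viewpoint behind the algorithm: a task-by-task array of diagonal blocks is,
frequency by frequency, a direct sum of `L × L` matrices. Determinant, inverse and positivity can
then be treated for each `k` alone. -/
theorem ofDiagBlocks_eq_blockDiagonal {n : ℕ} (a : Fin L → Fin L → ℕ → ℂ) :
    (ofDiagBlocks a : Matrix (Fin L × Fin n) (Fin L × Fin n) ℂ) =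
      Matrix.blockDiagonal fun k : Fin n => Matrix.of fun l l' => a l l' k := by
  ext ⟨l, k⟩ ⟨l', k'⟩
  simp [ofDiagBlocks, Matrix.blockDiagonal_apply]

theorem ofDiagBlocks_congr {n : ℕ} {a b : Fin L → Fin L → ℕ → ℂ}
    (h : ∀ l l', ∀ k < n, a l l' k = b l l' k) :
    (ofDiagBlocks a : Matrix (Fin L × Fin n) (Fin L × Fin n) ℂ) = ofDiagBlocks b := by
  ext ⟨l, k⟩ ⟨l', k'⟩
  simp only [ofDiagBlocks, Matrix.of_apply, h l l' k k.2]

theorem det_ofDiagBlocks {n : ℕ} (a : Fin L → Fin L → ℕ → ℂ) :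
    (ofDiagBlocks a : Matrix (Fin L × Fin n) (Fin L × Fin n) ℂ).det =
      ∏ k ∈ Finset.range n, (Matrix.of fun l l' => a l l' k).det := by
  rw [ofDiagBlocks_eq_blockDiagonal, Matrix.det_blockDiagonal, Finset.prod_range]

theorem inv_ofDiagBlocks {n : ℕ} (a : Fin L → Fin L → ℕ → ℂ)
    (h : ∀ k < n, IsUnit (Matrix.of fun l l' => a l l' k)) :
    (ofDiagBlocks a : Matrix (Fin L × Fin n) (Fin L × Fin n) ℂ)⁻¹ =
      ofDiagBlocks fun l l' k => (Matrix.of fun l l' => a l l' k)⁻¹ l l' := by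
  refine Matrix.inv_eq_right_inv ?_
  rw [ofDiagBlocks_eq_blockDiagonal, ofDiagBlocks_eq_blockDiagonal, ← Matrix.blockDiagonal_mul,
    ← Matrix.blockDiagonal_one]
  congr 1
  funext k
  exact Matrix.mul_nonsing_inv _ ((Matrix.isUnit_iff_isUnit_det _).1 (h k k.2))

theorem posDef_of_ofDiagBlocks {n : ℕ} {a : Fin L → Fin L → ℕ → ℂ}
    (h : (ofDiagBlocks a : Matrix (Fin L × Fin n) (Fin L × Fin n) ℂ).PosDef) {k : ℕ} (hk : k < n) :
    (Matrix.of fun l l' => a l l' k).PosDef := by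
  have h1 := h.submatrix (e := fun l : Fin L => (l, (⟨k, hk⟩ : Fin n)))
    fun i j e => by simpa using e
  convert! h1 using 1
  ext l l'
  simp [ofDiagBlocks]

end Inversion

/-! ### Counting registers and operations. -/

section Complexity

variable {L : ℕ}

/-! ### Storage -/

/-- The program only uses registers in `S`. -/
def UsesOnly (S : Reg L → Prop) (P : Prog L) : Prop := ∀ I ∈ P, ∀ r ∈ I.regs, S r

@[simp] theorem usesOnly_nil (S : Reg L → Prop) : UsesOnly S [] := by simp [UsesOnly]

@[simp] theorem usesOnly_cons (S : Reg L → Prop) (I : Instr L) (P : Prog L) :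
    UsesOnly S (I :: P) ↔ (∀ r ∈ I.regs, S r) ∧ UsesOnly S P := by
  simp [UsesOnly]

theorem UsesOnly.append {S : Reg L → Prop} {P Q : Prog L} (hP : UsesOnly S P) (hQ : UsesOnly S Q) :
    UsesOnly S (P ++ Q) := fun I hI => (List.mem_append.1 hI).elim (hP I) (hQ I)

theorem usesOnly_flatMap {α : Type*} {S : Reg L → Prop} {xs : List α} {P : α → Prog L}
    (h : ∀ a ∈ xs, UsesOnly S (P a)) : UsesOnly S (xs.flatMap P) := by
  intro I hI
  obtain ⟨a, ha, hIa⟩ := List.mem_flatMap.1 hI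
  exact h a ha I hIa

theorem usesOnly_map {α : Type*} {S : Reg L → Prop} {xs : List α} {f : α → Instr L}
    (h : ∀ a ∈ xs, ∀ r ∈ (f a).regs, S r) : UsesOnly S (xs.map f) := by
  intro I hI
  obtain ⟨a, ha, rfl⟩ := List.mem_map.1 hI
  exact h a ha

theorem UsesOnly.storage_le {S : Reg L → Prop} {P : Prog L} (h : UsesOnly S P)
    (F : Finset (Reg L)) (hF : ∀ r, S r → r ∈ F) : storage P ≤ F.card := by
  refine Finset.card_le_card fun r hr => hF r ?_
  rw [List.mem_toFinset, List.mem_flatMap] at hr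
  obtain ⟨I, hI, hr⟩ := hr
  exact h I hI r hr

theorem usesOnly_fwd (fl : Flavour) (S : Reg L → Prop) (htw : S .tw) (htmp : S .tmp) (m : ℕ)
    (a : ℕ → Reg L) (ha : ∀ k < 2 ^ m, S (a k)) : UsesOnly S (fwd fl m a) := by
  induction m generalizing a with
  | zero => simp [fwd]
  | succ m ih =>
    have hlow : ∀ k < 2 ^ m, S (a k) := fun k hk => ha k (lt_two_pow_succ hk)
    have hhigh : ∀ k < 2 ^ m, S (a (k + 2 ^ m)) := fun k hk => ha _ (add_two_pow_lt hk)
    refine ((ih a hlow).append (ih _ hhigh)).append (usesOnly_flatMap fun j hj => ?_)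
    rw [List.mem_range] at hj
    simp [Instr.regs, htw, htmp, hlow j hj, hhigh j hj]

/-- Registers used by the evaluation of `Λ`. -/
def IsFormReg (n : ℕ) : Reg L → Prop
  | .lam _ _ k => k < n
  | .xi _ => True
  | .tw => True
  | .tmp => True
  | _ => False

theorem usesOnly_formProg (fl : Flavour) (L m : ℕ) :
    UsesOnly (IsFormReg (2 ^ m)) (formProg fl L m) := by
  refine usesOnly_flatMap fun l _ => usesOnly_flatMap fun l' _ => ?_
  refine UsesOnly.append (UsesOnly.append (usesOnly_map fun i hi => ?_) ?_)
    (usesOnly_fwd fl _ trivial trivial m _ fun k hk => hk)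
  · simpa [Instr.regs, IsFormReg] using hi
  · split_ifs <;> simp [Instr.regs, IsFormReg]

theorem storage_formProg_le (fl : Flavour) (L m : ℕ) :
    storage (formProg fl L m) ≤ L * (L * 2 ^ m) + L + 2 := by
  refine ((usesOnly_formProg fl L m).storage_le
    ((Finset.univ ×ˢ Finset.univ ×ˢ Finset.range (2 ^ m)).image
        (fun p : Fin L × Fin L × ℕ => Reg.lam p.1 p.2.1 p.2.2) ∪
      Finset.univ.image Reg.xi ∪ {.tw, .tmp}) fun r hr => ?_).trans ?_
  · cases r <;> simp_all [IsFormReg]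
  · refine (Finset.card_union_le _ _).trans (add_le_add ((Finset.card_union_le _ _).trans
      (add_le_add (Finset.card_image_le.trans ?_) (Finset.card_image_le.trans ?_))) ?_)
    · simp [Finset.card_product]
    · simp
    · exact Finset.card_le_two

/-- Registers used by the inversion algorithm. -/
def IsInvReg (n : ℕ) : Reg L → Prop
  | .lam _ _ k => k < n
  | .inv _ _ k => k < n
  | .jay _ _ k => k < n
  | .el _ k => k < n
  | .aitch _ k => k < n
  | .eff k => k < n
  | .schur k => k < n
  | .gee k => k < n
  | .rho => True
  | .tmp => True
  | _ => False

theorem usesOnly_invDetProg (L n : ℕ) : UsesOnly (IsInvReg n) (invDetProg L n) := by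
  rw [invDetProg, usesOnly_cons]
  refine ⟨by simp [Instr.regs, IsInvReg], usesOnly_flatMap fun l _ => ?_⟩
  refine UsesOnly.append (UsesOnly.append (UsesOnly.append (UsesOnly.append (UsesOnly.append
    (UsesOnly.append (UsesOnly.append (UsesOnly.append (UsesOnly.append ?_ ?_) ?_) ?_) ?_) ?_) ?_)
    ?_) ?_) ?_
  · refine usesOnly_flatMap fun i _ => usesOnly_flatMap fun k hk => ?_
    rw [List.mem_range] at hk
    rw [usesOnly_cons]
    exact ⟨by simp [Instr.regs, IsInvReg, hk],
      usesOnly_flatMap fun j _ => by simp [Instr.regs, IsInvReg, hk]⟩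
  · refine usesOnly_flatMap fun k hk => ?_
    rw [List.mem_range] at hk
    rw [usesOnly_cons]
    exact ⟨by simp [Instr.regs, IsInvReg, hk],
      usesOnly_flatMap fun j _ => by simp [Instr.regs, IsInvReg, hk]⟩
  · refine usesOnly_map fun k hk => ?_
    rw [List.mem_range] at hk
    simp [Instr.regs, IsInvReg, hk]
  · refine usesOnly_map fun k hk => ?_
    rw [List.mem_range] at hk
    simp [Instr.regs, IsInvReg, hk]
  · refine usesOnly_map fun k hk => ?_
    rw [List.mem_range] at hk
    simp [Instr.regs, IsInvReg, hk]
  · refine usesOnly_flatMap fun i _ => usesOnly_map fun k hk => ?_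
    rw [List.mem_range] at hk
    simp [Instr.regs, IsInvReg, hk]
  · refine usesOnly_flatMap fun i _ => usesOnly_flatMap fun j _ => usesOnly_flatMap fun k hk => ?_
    rw [List.mem_range] at hk
    simp [Instr.regs, IsInvReg, hk]
  · refine usesOnly_flatMap fun i _ => usesOnly_flatMap fun j _ => usesOnly_map fun k hk => ?_
    rw [List.mem_range] at hk
    simp [Instr.regs, IsInvReg, hk]
  · refine usesOnly_flatMap fun i _ => usesOnly_flatMap fun k hk => ?_
    rw [List.mem_range] at hk
    simp [Instr.regs, IsInvReg, hk]
  · refine usesOnly_map fun k hk => ?_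
    rw [List.mem_range] at hk
    simp [Instr.regs, IsInvReg, hk]

/-- The terms count three families indexed by two tasks and `k` (`lam`, `inv`, `jay`), two indexed
by one task and `k` (`el`, `aitch`), three indexed by `k` alone, and the single registers `rho` and
`tmp`. -/
theorem storage_invDetProg_le (L n : ℕ) :
    storage (invDetProg L n) ≤ 3 * (L * (L * n)) + 2 * (L * n) + 3 * n + 2 := by
  let F3 : (Fin L → Fin L → ℕ → Reg L) → Finset (Reg L) := fun f =>
    (Finset.univ ×ˢ Finset.univ ×ˢ Finset.range n).image
      fun p : Fin L × Fin L × ℕ => f p.1 p.2.1 p.2.2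
  let F2 : (Fin L → ℕ → Reg L) → Finset (Reg L) := fun f =>
    (Finset.univ ×ˢ Finset.range n).image fun p : Fin L × ℕ => f p.1 p.2
  let F1 : (ℕ → Reg L) → Finset (Reg L) := fun f => (Finset.range n).image f
  have h3 : ∀ f, (F3 f).card ≤ L * (L * n) := fun f =>
    Finset.card_image_le.trans (by simp [Finset.card_product])
  have h2 : ∀ f, (F2 f).card ≤ L * n := fun f =>
    Finset.card_image_le.trans (by simp [Finset.card_product])
  have h1 : ∀ f, (F1 f).card ≤ n := fun f => Finset.card_image_le.trans (by simp)
  refine ((usesOnly_invDetProg L n).storage_le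
    (F3 .lam ∪ (F3 .inv ∪ (F3 .jay ∪ (F2 .el ∪ (F2 .aitch ∪ (F1 .eff ∪ (F1 .schur ∪
      (F1 .gee ∪ {.rho, .tmp})))))))) fun r hr => ?_).trans ?_
  · have m3 : ∀ f l l' k, k < n → f l l' k ∈ F3 f := fun f l l' k hk =>
      Finset.mem_image.2 ⟨(l, l', k), by simpa using hk, rfl⟩
    have m2 : ∀ f l k, k < n → f l k ∈ F2 f := fun f l k hk =>
      Finset.mem_image.2 ⟨(l, k), by simpa using hk, rfl⟩
    have m1 : ∀ f k, k < n → f k ∈ F1 f := fun f k hk =>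
      Finset.mem_image.2 ⟨k, by simpa using hk, rfl⟩
    clear_value F1 F2 F3
    simp only [Finset.mem_union]
    cases r with
    | lam l l' k => exact Or.inl (m3 _ l l' k hr)
    | inv l l' k => exact Or.inr (Or.inl (m3 _ l l' k hr))
    | jay l l' k => exact Or.inr (Or.inr (Or.inl (m3 _ l l' k hr)))
    | el l k => exact Or.inr (Or.inr (Or.inr (Or.inl (m2 _ l k hr))))
    | aitch l k => exact Or.inr (Or.inr (Or.inr (Or.inr (Or.inl (m2 _ l k hr)))))
    | eff k => exact Or.inr (Or.inr (Or.inr (Or.inr (Or.inr (Or.inl (m1 _ k hr))))))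
    | schur k => exact Or.inr (Or.inr (Or.inr (Or.inr (Or.inr (Or.inr (Or.inl (m1 _ k hr)))))))
    | gee k =>
      exact Or.inr (Or.inr (Or.inr (Or.inr (Or.inr (Or.inr (Or.inr (Or.inl (m1 _ k hr))))))))
    | rho => simp
    | tmp => simp
    | xi _ | vec _ _ | out _ _ | tw => exact hr.elim
  · have hu := fun (a b : Finset (Reg L)) (x y : ℕ) (ha : a.card ≤ x) (hb : b.card ≤ y) =>
      (Finset.card_union_le a b).trans (add_le_add ha hb)
    refine (hu _ _ _ _ (h3 _) (hu _ _ _ _ (h3 _) (hu _ _ _ _ (h3 _) (hu _ _ _ _ (h2 _)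
      (hu _ _ _ _ (h2 _) (hu _ _ _ _ (h1 _) (hu _ _ _ _ (h1 _) (hu _ _ _ _ (h1 _)
      Finset.card_le_two)))))))).trans (le_of_eq ?_)
    ring

/-! ### Cost -/

@[simp] theorem cost_nil (q : ℕ) : cost q ([] : Prog L) = 0 := rfl

@[simp] theorem cost_cons (q : ℕ) (I : Instr L) (P : Prog L) :
    cost q (I :: P) = I.cost q + cost q P := by simp [cost]

@[simp] theorem cost_append (q : ℕ) (P Q : Prog L) : cost q (P ++ Q) = cost q P + cost q Q := by
  simp [cost]

theorem cost_flatMap_le {α : Type*} {q B n : ℕ} {xs : List α} {P : α → Prog L}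
    (hn : xs.length ≤ n) (h : ∀ a, cost q (P a) ≤ B) : cost q (xs.flatMap P) ≤ n * B := by
  refine le_trans ?_ (Nat.mul_le_mul_right B hn)
  clear hn
  induction xs with
  | nil => simp
  | cons a xs ih =>
    rw [List.flatMap_cons, cost_append, List.length_cons, add_mul, one_mul, add_comm]
    exact add_le_add ih (h a)

theorem cost_map_le {α : Type*} {q B n : ℕ} {xs : List α} {f : α → Instr L}
    (hn : xs.length ≤ n) (h : ∀ a, (f a).cost q ≤ B) : cost q (xs.map f) ≤ n * B := by
  rw [map_eq_flatMap_singleton]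
  exact cost_flatMap_le hn fun a => by simpa using h a

/-- Each butterfly takes four instructions, so the cost `T` satisfies `T (m + 1) = 2 T m + 4 * 2 ^
m`, solved by `2 m 2 ^ m`. -/
theorem cost_fwd_le (fl : Flavour) (q m : ℕ) (a : ℕ → Reg L) :
    cost q (fwd fl m a) ≤ 2 * m * 2 ^ m := by
  induction m generalizing a with
  | zero => simp [fwd]
  | succ m ih =>
    simp only [fwd, cost_append]
    refine (add_le_add (add_le_add (ih _) (ih _)) (cost_flatMap_le (n := 2 ^ m) (B := 4) (by simp)
      fun j => by simp [Instr.cost])).trans (le_of_eq ?_)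
    rw [pow_succ]; ring

theorem cost_bwd_le (fl : Flavour) (q m : ℕ) (a : ℕ → Reg L) :
    cost q (bwd fl m a) ≤ 2 * m * 2 ^ m := by
  induction m generalizing a with
  | zero => simp [bwd]
  | succ m ih =>
    simp only [bwd, cost_append]
    refine (add_le_add (add_le_add (cost_flatMap_le (n := 2 ^ m) (B := 4) (by simp)
      fun j => by simp [Instr.cost]) (ih _)) (ih _)).trans (le_of_eq ?_)
    rw [pow_succ]; ring

theorem cost_scale_le (q m : ℕ) (a : ℕ → Reg L) : cost q (scale m a) ≤ 1 + 2 ^ m := by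
  rw [scale, cost_cons]
  refine add_le_add (by simp [Instr.cost]) ?_
  refine (cost_map_le (n := 2 ^ m) (B := 1) (by simp) fun k => by simp [Instr.cost]).trans (by simp)

theorem cost_formProg_le (fl : Flavour) (L m q : ℕ) :
    cost q (formProg fl L m) ≤ L * (L * (2 ^ m * q + 1 + 2 * m * 2 ^ m)) := by
  refine cost_flatMap_le (by simp) fun l => cost_flatMap_le (by simp) fun l' => ?_
  simp only [cost_append]
  refine add_le_add (add_le_add (cost_map_le (by simp) fun i => by simp [Instr.cost]) ?_)
    (cost_fwd_le _ _ _ _)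
  split_ifs <;> simp [Instr.cost]

theorem cost_mulProg_le (fl : Flavour) (m q : ℕ) (mat : Fin L → Fin L → ℕ → Reg L) :
    cost q (mulProg fl L m mat) ≤ L * (2 * m * 2 ^ m + (1 + 2 ^ m)) +
      L * (2 ^ m * (1 + L * 2)) + L * (2 * m * 2 ^ m + (1 + 2 ^ m)) := by
  simp only [mulProg, cost_append]
  refine add_le_add (add_le_add (cost_flatMap_le (by simp) fun l => ?_)
    (cost_flatMap_le (by simp) fun l => cost_flatMap_le (by simp) fun k => ?_))
    (cost_flatMap_le (by simp) fun l => ?_)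
  · rw [cost_append]
    exact add_le_add (cost_fwd_le _ _ _ _) (cost_scale_le _ _ _)
  · rw [cost_cons]
    exact add_le_add (by simp [Instr.cost])
      (cost_flatMap_le (by simp) fun l' => by simp [Instr.cost])
  · rw [cost_append]
    exact add_le_add (cost_bwd_le _ _ _ _) (cost_scale_le _ _ _)

/-- One summand for each loop of the pass, in program order, with the number of earlier tasks
bounded by `L`. -/
theorem cost_invDetStage_le (n q : ℕ) (l : Fin L) :
    cost q (invDetStage L n l) ≤ L * (n * (1 + L * 2)) + n * (1 + L * 3) + n * 1 + n * 1 + n * 1 +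
      L * (n * 1) + L * (L * (n * 2)) + L * (L * (n * 1)) + L * (n * 3) + n * 1 := by
  simp only [invDetStage, cost_append]
  have hp : ((List.finRange L).filter fun i => i < l).length ≤ L :=
    (List.length_filter_le _ _).trans (by simp)
  have hn : (List.range n).length ≤ n := by simp
  refine add_le_add (add_le_add (add_le_add (add_le_add (add_le_add (add_le_add (add_le_add
    (add_le_add (add_le_add ?_ ?_) ?_) ?_) ?_) ?_) ?_) ?_) ?_) ?_
  · refine cost_flatMap_le hp fun i => cost_flatMap_le hn fun k => ?_
    rw [cost_cons]
    exact add_le_add (by simp [Instr.cost]) (cost_flatMap_le hp fun j => by simp [Instr.cost])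
  · refine cost_flatMap_le hn fun k => ?_
    rw [cost_cons]
    exact add_le_add (by simp [Instr.cost]) (cost_flatMap_le hp fun j => by simp [Instr.cost])
  · exact cost_map_le hn fun k => by simp [Instr.cost]
  · exact cost_map_le hn fun k => by simp [Instr.cost]
  · exact cost_map_le hn fun k => by simp [Instr.cost]
  · exact cost_flatMap_le hp fun i => cost_map_le hn fun k => by simp [Instr.cost]
  · exact cost_flatMap_le hp fun i => cost_flatMap_le hp fun j => cost_flatMap_le hn fun k => by
      simp [Instr.cost]
  · exact cost_flatMap_le hp fun i => cost_flatMap_le hp fun j => cost_map_le hn fun k => by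
      simp [Instr.cost]
  · exact cost_flatMap_le hp fun i => cost_flatMap_le hn fun k => by simp [Instr.cost]
  · exact cost_map_le hn fun k => by simp [Instr.cost]

theorem cost_invDetProg_le {L n : ℕ} (hL : 1 ≤ L) (hn : 1 ≤ n) (q : ℕ) :
    cost q (invDetProg L n) ≤ 20 * (L ^ 3 * n) := by
  rw [invDetProg, cost_cons]
  have h1 : cost q ((List.finRange L).flatMap (invDetStage L n)) ≤ _ :=
    cost_flatMap_le (n := L) (by simp) fun l => cost_invDetStage_le n q l
  have e1 : L * n ≤ L * L * n := by gcongr; nlinarith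
  have e2 : n ≤ L * n := by nlinarith
  have e3 : 1 ≤ L * (L * L * n) := Nat.mul_pos hL (Nat.mul_pos (Nat.mul_pos hL hL) hn)
  -- The coefficients of all monomials add up to 18, and each monomial is at most `L * L * n`.
  -- Loading `rho` adds one more unit, so 20 suffices in the end.
  have h2 : L * (n * (1 + L * 2)) + n * (1 + L * 3) + n * 1 + n * 1 + n * 1 +
      L * (n * 1) + L * (L * (n * 2)) + L * (L * (n * 1)) + L * (n * 3) + n * 1 ≤
      19 * (L * L * n) := by
    ring_nf at e1 e2 ⊢
    omega
  have h3 := Nat.mul_le_mul_left L h2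
  have h4 : Instr.cost q (.const .rho 1 : Instr L) = 1 := rfl
  rw [h4]
  calc _ ≤ L * (L * L * n) + L * (19 * (L * L * n)) := add_le_add e3 (h1.trans h3)
    _ = 20 * (L ^ 3 * n) := by ring

/-- All complexity bounds with one constant. -/
theorem complexity_bounds (c : ℝ) (fl : Flavour) {L m d q : ℕ} (hL : 1 ≤ L) (hd : 1 ≤ d)
    (hq : (q : ℝ) ≤ c * d) {n : ℕ} (hn : n = 2 ^ m) :
    (cost q (formProg fl L m) : ℝ) ≤
        (|c| + 100) * ((L : ℝ) ^ 2 * (n * Real.log n + d * n)) ∧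
      (storage (formProg fl L m) : ℝ) ≤ (|c| + 100) * ((L : ℝ) ^ 2 * n) ∧
      (∀ mat : Fin L → Fin L → ℕ → Reg L, (cost q (mulProg fl L m mat) : ℝ) ≤
        (|c| + 100) * (L * n * Real.log n + (L : ℝ) ^ 2 * n)) ∧
      (cost q (invDetProg L n) : ℝ) ≤ (|c| + 100) * ((L : ℝ) ^ 3 * n) ∧
      (storage (invDetProg L n) : ℝ) ≤ (|c| + 100) * ((L : ℝ) ^ 2 * n) := by
  have hn1 : 1 ≤ n := hn ▸ Nat.one_le_two_pow
  have hLr : (1 : ℝ) ≤ L := by exact_mod_cast hL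
  have hnr : (1 : ℝ) ≤ n := by exact_mod_cast hn1
  have hdr : (1 : ℝ) ≤ d := by exact_mod_cast hd
  -- Here `log n = m log 2`, and `log 2` exceeds one half. For `m = 0` both sides vanish; the
  -- operations that remain are absorbed by the terms without logarithm.
  have hlog : (m : ℝ) ≤ 2 * Real.log n := by
    rw [hn, Nat.cast_pow, Real.log_pow, Nat.cast_ofNat]
    have := Real.log_two_gt_d9
    have hm : (0 : ℝ) ≤ m := Nat.cast_nonneg m
    nlinarith
  have hlog0 : 0 ≤ Real.log n := Real.log_nonneg hnr
  have hq' : (q : ℝ) ≤ |c| * d := hq.trans (by gcongr; exact le_abs_self c)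
  have hc := abs_nonneg c
  have hnm : ((2 : ℝ) ^ m) = n := by rw [hn]; push_cast; rfl
  -- monomials are bounded by `L ^ 2 n`
  have hLL : (L : ℝ) ≤ L ^ 2 := by nlinarith
  have hL2 : (1 : ℝ) ≤ (L : ℝ) ^ 2 := hLr.trans hLL
  have hL2n : (L : ℝ) ^ 2 ≤ L ^ 2 * n := le_mul_of_one_le_right (by positivity) hnr
  have hLn : (L : ℝ) * n ≤ L ^ 2 * n := by gcongr
  have hnL : (n : ℝ) ≤ L ^ 2 * n := le_mul_of_one_le_left (by positivity) hL2
  have hpos : 0 ≤ (L : ℝ) ^ 2 * n := by positivity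
  have hcpos : 0 ≤ |c| * ((L : ℝ) ^ 2 * n) := by positivity
  refine ⟨?_, ?_, fun mat => ?_, ?_, ?_⟩
  · have h : (cost q (formProg fl L m) : ℝ) ≤ L * (L * (n * q + 1 + 2 * m * n)) := by
      have := cost_formProg_le fl L m q
      rw [← hnm]
      exact_mod_cast this
    have h1 : (L : ℝ) ^ 2 * n * q ≤ (L : ℝ) ^ 2 * n * (|c| * d) := by gcongr
    have h2 : (L : ℝ) ^ 2 * n * m ≤ (L : ℝ) ^ 2 * n * (2 * Real.log n) := by gcongr
    have h3 : (L : ℝ) ^ 2 * n ≤ (L : ℝ) ^ 2 * n * d := le_mul_of_one_le_right hpos hdr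
    have h4 : 0 ≤ (L : ℝ) ^ 2 * n * Real.log n := by positivity
    have h5 : 0 ≤ |c| * ((L : ℝ) ^ 2 * n * Real.log n) := by positivity
    linarith
  · have h : (storage (formProg fl L m) : ℝ) ≤ L * (L * n) + L + 2 := by
      have := storage_formProg_le fl L m
      rw [← hnm]
      exact_mod_cast this
    linarith
  · have h : (cost q (mulProg fl L m mat) : ℝ) ≤ L * (2 * m * n + (1 + n)) +
        L * (n * (1 + L * 2)) + L * (2 * m * n + (1 + n)) := by
      have := cost_mulProg_le fl m q mat
      rw [← hnm]
      exact_mod_cast this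
    have h1 : (L : ℝ) * n * m ≤ L * n * (2 * Real.log n) := by gcongr
    have h2 : 0 ≤ (L : ℝ) * n * Real.log n := by positivity
    have h3 : 0 ≤ |c| * ((L : ℝ) * n * Real.log n) := by positivity
    linarith
  · have h : (cost q (invDetProg L n) : ℝ) ≤ 20 * (L ^ 3 * n) := by
      exact_mod_cast cost_invDetProg_le hL hn1 q
    have h1 : 0 ≤ (L : ℝ) ^ 3 * n := by positivity
    have h2 : 0 ≤ |c| * ((L : ℝ) ^ 3 * n) := by positivity
    linarith
  · have h : (storage (invDetProg L n) : ℝ) ≤ 3 * (L * (L * n)) + 2 * (L * n) + 3 * n + 2 := by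
      exact_mod_cast storage_invDetProg_le L n
    linarith

end Complexity

end FastMTGP

/-! ### Assembly of algebra, program correctness and complexity. -/

theorem mainTheorem7 (c : ℝ) :
    ∃ C : ℝ, ∀ (fl : FastMTGP.Flavour) (L m d q n : ℕ), 1 ≤ L → 1 ≤ d → (q : ℝ) ≤ c * d → n = 2 ^ m →
      -- costs and storage of the four programs; a kernel evaluation costs `q = O(d)`
      ((FastMTGP.cost q (FastMTGP.formProg fl L m) : ℝ) ≤
          C * ((L : ℝ) ^ 2 * (n * Real.log n + d * n)) ∧
        (FastMTGP.storage (FastMTGP.formProg fl L m) : ℝ) ≤ C * ((L : ℝ) ^ 2 * n) ∧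
        (FastMTGP.cost q (FastMTGP.mulProg fl L m FastMTGP.Reg.lam) : ℝ) ≤
          C * (L * n * Real.log n + (L : ℝ) ^ 2 * n) ∧
        (FastMTGP.cost q (FastMTGP.invDetProg L n) : ℝ) ≤ C * ((L : ℝ) ^ 3 * n) ∧
        (FastMTGP.storage (FastMTGP.invDetProg L n) : ℝ) ≤ C * ((L : ℝ) ^ 2 * n) ∧
        (FastMTGP.cost q (FastMTGP.mulProg fl L m FastMTGP.Reg.inv) : ℝ) ≤
          C * (L * n * Real.log n + (L : ℝ) ^ 2 * n)) ∧
      -- what the four programs compute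
      ∀ (R : Fin L → Fin L → ℝ) (Q : (Fin d → ℝ) → (Fin d → ℝ) → ℝ) (ξ : Fin L → ℝ)
        (X : Fin L → ℕ → Fin d → ℝ), FastMTGP.Condition fl m R Q ξ X →
        let K := FastMTGP.gram m R Q ξ X
        let V := FastMTGP.bigV fl L m
        let Λ := FastMTGP.lambdaMat fl m R Q ξ X
        let κ := FastMTGP.kernelAt R Q X
        V ∈ Matrix.unitaryGroup (Fin L × Fin (2 ^ m)) ℂ ∧
        K = V * Λ * V.conjTranspose ∧
        (∀ s : FastMTGP.State L, (∀ l, s (.xi l) = ξ l) →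
          FastMTGP.DivSafe κ (FastMTGP.formProg fl L m) s ∧
          Λ = FastMTGP.ofDiagBlocks fun l l' k =>
            FastMTGP.run κ (FastMTGP.formProg fl L m) s (.lam l l' k)) ∧
        (∀ (y : Fin L × Fin (2 ^ m) → ℝ) (s : FastMTGP.State L),
          (∀ l l' (k : Fin (2 ^ m)), s (.lam l l' k) = Λ (l, k) (l', k)) →
          (∀ l (k : Fin (2 ^ m)), s (.vec l k) = y (l, k)) →
          FastMTGP.DivSafe κ (FastMTGP.mulProg fl L m .lam) s ∧
          ∀ l (k : Fin (2 ^ m)), FastMTGP.run κ (FastMTGP.mulProg fl L m .lam) s (.out l k) =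
            K.mulVec (fun p => (y p : ℂ)) (l, k)) ∧
        -- in tasks without noise the points are distinct, that is, `K` is nonsingular
        ((∀ l, 0 < ξ l ∨ Set.InjOn (X l) (Set.Iio (2 ^ m))) →
          IsUnit K.det ∧ IsUnit Λ.det ∧
          (∀ s : FastMTGP.State L,
            (∀ l l' (k : Fin (2 ^ m)), s (.lam l l' k) = Λ (l, k) (l', k)) →
            FastMTGP.DivSafe κ (FastMTGP.invDetProg L n) s ∧
            (Λ⁻¹ = FastMTGP.ofDiagBlocks fun l l' k =>
              FastMTGP.run κ (FastMTGP.invDetProg L n) s (.inv l l' k)) ∧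
            FastMTGP.run κ (FastMTGP.invDetProg L n) s .rho = Λ.det ∧ Λ.det = K.det) ∧
          (∀ (y : Fin L × Fin (2 ^ m) → ℝ) (s : FastMTGP.State L),
            (∀ l l' (k : Fin (2 ^ m)), s (.inv l l' k) = Λ⁻¹ (l, k) (l', k)) →
            (∀ l (k : Fin (2 ^ m)), s (.vec l k) = y (l, k)) →
            FastMTGP.DivSafe κ (FastMTGP.mulProg fl L m .inv) s ∧
            ∀ l (k : Fin (2 ^ m)), FastMTGP.run κ (FastMTGP.mulProg fl L m .inv) s (.out l k) =
              K⁻¹.mulVec (fun p => (y p : ℂ)) (l, k))) := by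
  -- The summand `|c|` pays for kernel evaluations, and 100 generously covers all numerical
  -- constants.
  refine ⟨|c| + 100, fun fl L m d q n hL hd hq hn => ?_⟩
  obtain ⟨c1, c2, c3, c4, c5⟩ := FastMTGP.complexity_bounds c fl hL hd hq hn
  refine ⟨⟨c1, c2, c3 _, c4, c5, c3 _⟩, fun R Q ξ X hcond => ?_⟩
  subst hn
  intro K V Λ κ
  have hΛ : Λ = FastMTGP.ofDiagBlocks (FastMTGP.eigenvalue fl m R Q ξ X) :=
    FastMTGP.lambdaMat_eq R ξ hcond.design
  have hK : K = V * Λ * V.conjTranspose := FastMTGP.gram_eq fl m R Q ξ X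
  -- Stated for an arbitrary register family, as products with `K` and with its inverse use the same
  -- program on `lam` and on `inv`.
  have hmul : ∀ (mat : Fin L → Fin L → ℕ → FastMTGP.Reg L)
      (hscr : ∀ l l' k, ¬ FastMTGP.IsScratch (mat l l' k))
      (hvec : ∀ l l' k j i, mat l l' k ≠ .vec j i) (hout : ∀ l l' k j i, mat l l' k ≠ .out j i)
      (a : Fin L → Fin L → ℕ → ℂ) (y : Fin L × Fin (2 ^ m) → ℝ) (s : FastMTGP.State L),
      (∀ l l' (k : Fin (2 ^ m)), s (mat l l' k) =
        (FastMTGP.ofDiagBlocks a : Matrix (Fin L × Fin (2 ^ m)) (Fin L × Fin (2 ^ m)) ℂ) (l, k) (l', k)) →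
      (∀ l (k : Fin (2 ^ m)), s (.vec l k) = y (l, k)) →
      FastMTGP.DivSafe κ (FastMTGP.mulProg fl L m mat) s ∧
      ∀ l (k : Fin (2 ^ m)), FastMTGP.run κ (FastMTGP.mulProg fl L m mat) s (.out l k) =
        (V * FastMTGP.ofDiagBlocks a * V.conjTranspose).mulVec (fun p => (y p : ℂ)) (l, k) := by
    intro mat hscr hvec hout a y s hmat hy
    refine ⟨(FastMTGP.divFree_mulProg fl m mat).divSafe s, fun l k => ?_⟩
    rw [FastMTGP.run_mulProg fl m mat hscr hvec hout s l k]
    have e1 : (FastMTGP.ofDiagBlocks (fun l l' k => s (mat l l' k)) :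
        Matrix (Fin L × Fin (2 ^ m)) (Fin L × Fin (2 ^ m)) ℂ) = FastMTGP.ofDiagBlocks a :=
      FastMTGP.ofDiagBlocks_congr fun l l' k hk => by
        rw [hmat l l' ⟨k, hk⟩]; simp [FastMTGP.ofDiagBlocks]
    have e2 : (fun p : Fin L × Fin (2 ^ m) => s (.vec p.1 p.2)) = fun p => (y p : ℂ) :=
      funext fun p => hy p.1 p.2
    rw [e1, e2]
  refine ⟨FastMTGP.bigV_mem_unitaryGroup fl L m, hK, fun s hs => ⟨?_, ?_⟩, fun y s hlam hvec => ?_,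
    fun hdist => ?_⟩
  · exact (FastMTGP.divFree_formProg fl L m).divSafe s
  · rw [hΛ]
    refine FastMTGP.ofDiagBlocks_congr fun l l' k hk => ?_
    rw [FastMTGP.run_formProg fl m l l' s k hk, hs]
    rfl
  · rw [hK, hΛ]
    exact hmul .lam (by simp [FastMTGP.IsScratch]) (by simp) (by simp) _ y s (hΛ ▸ hlam) hvec
  · open scoped ComplexOrder in
    have hKpd := hcond.gram_posDef hdist
    have hΛpd : Λ.PosDef := hcond.lambdaMat_posDef hdist
    have hpd : ∀ k < 2 ^ m,
        (Matrix.of fun l l' => FastMTGP.eigenvalue fl m R Q ξ X l l' k).PosDef := fun k hk =>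
      FastMTGP.posDef_of_ofDiagBlocks (hΛ ▸ hΛpd) hk
    have hinv : Λ⁻¹ = FastMTGP.ofDiagBlocks fun l l' k =>
        (Matrix.of fun l l' => FastMTGP.eigenvalue fl m R Q ξ X l l' k)⁻¹ l l' := by
      rw [hΛ]
      exact FastMTGP.inv_ofDiagBlocks _ fun k hk => (hpd k hk).isUnit
    refine ⟨(Matrix.isUnit_iff_isUnit_det _).1 hKpd.isUnit,
      (Matrix.isUnit_iff_isUnit_det _).1 hΛpd.isUnit, fun s hs => ?_, fun y s hs hvec => ?_⟩
    · obtain ⟨r1, r2, r3⟩ := FastMTGP.run_invDetProg (κ := κ) hpd s fun l l' k hk => by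
        rw [hs l l' ⟨k, hk⟩, hΛ]; simp [FastMTGP.ofDiagBlocks]
      refine ⟨r1, ?_, ?_, FastMTGP.det_lambdaMat fl m R Q ξ X⟩
      · rw [hinv]
        exact FastMTGP.ofDiagBlocks_congr fun l l' k hk => (r3 l l' k hk).symm
      · rw [r2, hΛ, FastMTGP.det_ofDiagBlocks]
    -- Unitarity of `V` moves the inverse inside, which reduces the solve to the multiplication
    -- already treated.
    · have hKinv : K⁻¹ = V * Λ⁻¹ * V.conjTranspose := by
        refine Matrix.inv_eq_right_inv ?_
        have hV : V.conjTranspose * V = 1 := FastMTGP.bigV_conjTranspose_mul_self fl L m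
        have hV' : V * V.conjTranspose = 1 := FastMTGP.bigV_mul_conjTranspose_self fl L m
        have hΛΛ : Λ * Λ⁻¹ = 1 :=
          Matrix.mul_nonsing_inv _ ((Matrix.isUnit_iff_isUnit_det _).1 hΛpd.isUnit)
        calc K * (V * Λ⁻¹ * V.conjTranspose)
            = V * Λ * (V.conjTranspose * V) * Λ⁻¹ * V.conjTranspose := by
              rw [hK]; simp only [Matrix.mul_assoc]
          _ = 1 := by rw [hV, Matrix.mul_one, Matrix.mul_assoc V, hΛΛ, Matrix.mul_one, hV']
      rw [hKinv, hinv]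
      exact hmul .inv (by simp [FastMTGP.IsScratch]) (by simp) (by simp) _ y s (hinv ▸ hs) hvec
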